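/- Let $N\ge 2$ and $n\ge 1$ be integers, $\zeta=\exp(2\pi\sqrt{-1}/2N)$, and $\zeta^{a}=\exp(\pi\sqrt{-1}\,a/N)$ for $a\in\mathbb{C}$. Put $[a]_\zeta=\frac{\zeta^{a}-\zeta^{-a}}{\zeta-\zeta^{-1}}$, $[a;0]_\zeta=1$, $[a;i]_\zeta=[a]_\zeta[a-1]_\zeta\cdots[a+1-i]_\zeta$ for $i>0$, and $[k]_\zeta!=[k;k]_\zeta$. Let $U_\zeta(\mathfrak{sl}_2)$ be the algebra generated by $K^{\pm1},E,F$ with $KEK^{-1}=\zeta^2E$, $KFK^{-1}=\zeta^{-2}F$, $[E,F]=\frac{K-K^{-1}}{\zeta-\zeta^{-1}}$, and with coproduct $\Delta(E)=1\otimes E+E\otimes K$, $\Delta(F)=K^{-1}\otimes F+F\otimes 1$, $\Delta(K)=K\otimes K$. For $\lambda\in\mathbb{C}$ let $U_N(\lambda)$ be the complex vector space with basis $v_0,\dots,v_{N-1}$ and with the action $Kv_i=\zeta^{\lambda-2i}v_i$, $Ev_i=[\lambda+1-i]_\zeta v_{i-1}$, $Fv_i=[i+1]_\zeta v_{i+1}$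 (where $v_{-1}=v_N=0$), and let $h=K^{1-N}$. Let $\mathsf{R}=\zeta^{-\lambda^2/2}\,T\circ\mathcal{R}$ on $U_N(\lambda)\otimes U_N(\lambda)$, where $T(v\otimes w)=w\otimes v$ and $$\mathcal{R}=\zeta^{\frac12 H\otimes H}\sum_{k=0}^{N-1}\frac{\zeta^{k(k-1)/2}(\zeta-\zeta^{-1})^k}{[k]_\zeta!}\,E^k\otimes F^k,\qquad Hv_i=(\lambda-2i)v_i .$$ Let $\varphi:B_n\to \mathrm{GL}(U_N(\lambda)^{\otimes n})$ be the representation of the braid group given by $\varphi(\sigma_i)=\mathrm{id}^{\otimes(i-1)}\otimes\mathsf{R}\otimes\mathrm{id}^{\otimes(n-1-i)}$; it commutes with the action of $U_\zeta(\mathfrak{sl}_2)$. Suppose that $[\lambda-i]_\zeta\ne 0$ for all $i\in\mathbb{Z}$ and that $[n\lambda-2i;N-1]_\zeta\neq 0$ for $i=0,\dots,N-1$. For $0\le k\le N-1$ let $T_k=\mathrm{Hom}_{U_\zeta(\mathfrak{sl}_2)}(U_N(n\lambda-2k),U_N(\lambda)^{\otimes n})$ be the intertwiner space, with the action $\varphi_{T_k}$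 of $B_n$ by composition with $\varphi$. Then the canonical map $X\otimes v\mapsto X(v)$ is an isomorphism $$\bigoplus_{k=0}^{N-1}T_k\otimes U_N(n\lambda-2k)\;\cong\; U_N(\lambda)^{\otimes n},$$ and for every $\beta\in B_n$ $$\mathrm{tr}_{2,\dots,n}\bigl((\mathrm{id}\otimes h^{\otimes(n-1)})\circ\varphi(\beta)\bigr)=\left(\sum_{i=0}^{N-1}\frac{[\lambda;N-1]_\zeta}{[n\lambda-2i;N-1]_\zeta}\,\mathrm{tr}\,\varphi_{T_i}(\beta)\right)\mathrm{id}_{U_N(\lambda)},$$ where $\mathrm{tr}_{2,\dots,n}:\mathrm{End}(U_N(\lambda)^{\otimes n})\to\mathrm{End}(U_N(\lambda))$ is the partial trace over all tensor factors but the first. -/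

import Mathlib

/-!
The braid group representation on `U_N(l)^{⊗n}`, where `U_N(l)` is the `N`-dimensional module of
quantum `sl_2` at `q = ζ = exp (2π√-1 / 2N)` with highest weight `l`.

Coordinates: `U_N(l)` has the basis `v_0, …, v_{N-1}`, and an operator on it is a matrix whose
entry `(i, j)` is the coefficient of `v_i` in the image of `v_j`. The tensor power `U_N(l)^{⊗n}`
has the basis `v_{e_1} ⊗ ⋯ ⊗ v_{e_n}`, indexed by the functions `e : Fin n → Fin N`. In `Fin n`
the tensor factors are counted from `0`.

The lemmas prove that the operator `R` is invertible, solves the braid relation and commutes with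
quantum `sl_2`, so that the representations of the braid group below are well defined.
-/

namespace ColoredAlexander

noncomputable section

open scoped Kronecker

/-- `ζ ^ a` for a complex exponent `a`, where `ζ = exp (2π√-1 / 2N)`. -/
def zetaPow (N : ℕ) (a : ℂ) : ℂ := Complex.exp (Real.pi * Complex.I * a / N)

/-- The quantum integer `[a]_ζ = (ζ^a - ζ^(-a)) / (ζ - ζ⁻¹)`, for complex `a`. -/
def qInt (N : ℕ) (a : ℂ) : ℂ :=
  (zetaPow N a - zetaPow N (-a)) / (zetaPow N 1 - zetaPow N (-1))

/-- `[a; i]_ζ = [a]_ζ [a - 1]_ζ ⋯ [a + 1 - i]_ζ` (the empty product `1` for `i = 0`). -/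
def qFall (N : ℕ) (a : ℂ) (i : ℕ) : ℂ := ∏ j ∈ Finset.range i, qInt N (a - j)

/-- The coefficient `ζ^(k(k-1)/2) (ζ - ζ⁻¹)^k / [k]_ζ!` of `E^k ⊗ F^k` in the universal
`R`-matrix. -/
def rCoeff (N k : ℕ) : ℂ :=
  zetaPow N ((k : ℂ) * ((k : ℂ) - 1) / 2) * (zetaPow N 1 - zetaPow N (-1)) ^ k / qFall N k k

theorem zetaPow_add (N : ℕ) (a b : ℂ) : zetaPow N (a + b) = zetaPow N a * zetaPow N b := by
  rw [zetaPow, zetaPow, zetaPow, ← Complex.exp_add]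
  congr 1
  ring

theorem zetaPow_zero (N : ℕ) : zetaPow N 0 = 1 := by simp [zetaPow]

theorem zetaPow_ne_zero (N : ℕ) (a : ℂ) : zetaPow N a ≠ 0 := Complex.exp_ne_zero _

theorem zetaPow_two_mul_self {N : ℕ} (hN : 2 ≤ N) : zetaPow N (2 * N) = 1 := by
  have h : (N : ℂ) ≠ 0 := by exact_mod_cast (by omega : N ≠ 0)
  rw [zetaPow, ← Complex.exp_two_pi_mul_I]
  congr 1
  field_simp

theorem zetaPow_eq_neg_iff {N : ℕ} (hN : 2 ≤ N) (k : ℕ) (h : zetaPow N k = zetaPow N (-k)) :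
    N ∣ k := by
  have h0 : (N : ℂ) ≠ 0 := by exact_mod_cast (by omega : N ≠ 0)
  rw [zetaPow, zetaPow, Complex.exp_eq_exp_iff_exists_int] at h
  obtain ⟨m, hm⟩ := h
  have hpi : (Real.pi : ℂ) * Complex.I ≠ 0 :=
    mul_ne_zero (by exact_mod_cast Real.pi_ne_zero) Complex.I_ne_zero
  have h2 : (k : ℂ) = m * N := by
    have : (Real.pi : ℂ) * Complex.I * k = (Real.pi * Complex.I) * (m * N) := by
      field_simp at hm
      linear_combination (Real.pi * Complex.I / 2) * hm
    exact mul_left_cancel₀ hpi this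
  have h3 : (k : ℤ) = m * N := by exact_mod_cast h2
  exact_mod_cast (Dvd.intro_left m h3.symm : (N : ℤ) ∣ k)

theorem zeta_sub_ne_zero {N : ℕ} (hN : 2 ≤ N) : zetaPow N 1 - zetaPow N (-1) ≠ 0 := by
  intro h
  have := zetaPow_eq_neg_iff hN 1 (by simpa [sub_eq_zero] using h)
  have := Nat.le_of_dvd one_pos this
  omega

theorem qInt_ne_zero {N : ℕ} (hN : 2 ≤ N) {k : ℕ} (h0 : 0 < k) (hk : k < N) :
    qInt N k ≠ 0 := by
  refine div_ne_zero ?_ (zeta_sub_ne_zero hN)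
  intro h
  have := Nat.le_of_dvd h0 (zetaPow_eq_neg_iff hN k (by simpa [sub_eq_zero] using h))
  omega

theorem qInt_zero (N : ℕ) : qInt N 0 = 0 := by simp [qInt]

theorem qFall_succ_self (N k : ℕ) :
    qFall N ((k + 1 : ℕ) : ℂ) (k + 1) = qInt N ((k : ℂ) + 1) * qFall N k k := by
  rw [qFall, Finset.prod_range_succ', mul_comm, qFall]
  congr 1
  · simp
  · refine Finset.prod_congr rfl fun j _ => ?_
    congr 1
    push_cast
    ring

theorem rCoeff_zero (N : ℕ) : rCoeff N 0 = 1 := by simp [rCoeff, qFall, zetaPow_zero]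

theorem rCoeff_succ {N : ℕ} (hN : 2 ≤ N) {k : ℕ} (hk : k + 1 < N) :
    qInt N ((k : ℂ) + 1) * rCoeff N (k + 1) =
      zetaPow N k * (zetaPow N 1 - zetaPow N (-1)) * rCoeff N k := by
  have h1 : qInt N ((k : ℂ) + 1) ≠ 0 := by
    have := qInt_ne_zero hN (k := k + 1) (by omega) hk
    push_cast at this
    exact this
  rw [rCoeff, qFall_succ_self, rCoeff]
  have h2 : zetaPow N (((k + 1 : ℕ) : ℂ) * (((k + 1 : ℕ) : ℂ) - 1) / 2) =
      zetaPow N k * zetaPow N ((k : ℂ) * ((k : ℂ) - 1) / 2) := by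
    rw [← zetaPow_add]
    congr 1
    push_cast
    ring
  rw [h2, pow_succ, ← mul_div_assoc, mul_div_mul_left _ _ h1]
  ring

/-! ### Identities in an arbitrary algebra -/

/-- The truncated series `Σ_{k<N} c_k x^k z^k`. -/
def theta (N : ℕ) {A : Type*} [Ring A] [Algebra ℂ A] (x z : A) : A :=
  ∑ k ∈ Finset.range N, rCoeff N k • (x ^ k * z ^ k)

theorem qInt_add (N : ℕ) (a b : ℂ) :
    qInt N (a + b) = zetaPow N b * qInt N a + zetaPow N (-a) * qInt N b := by
  simp only [qInt, neg_add, zetaPow_add]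
  ring

section Algebra
variable {A : Type*} [Ring A] [Algebra ℂ A]

theorem comm_pow {N : ℕ} {x y : A} (h : y * x = zetaPow N (-2) • (x * y)) (a : ℕ) :
    y * x ^ a = zetaPow N (-2 * a) • (x ^ a * y) := by
  induction a with
  | zero => simp [zetaPow_zero]
  | succ a ih =>
    rw [pow_succ, ← mul_assoc, ih, smul_mul_assoc, mul_assoc, h, mul_smul_comm, smul_smul,
      ← zetaPow_add, mul_assoc]
    congr 2
    push_cast
    ring

theorem qbinom {N : ℕ} (hN : 2 ≤ N) {x y : A} (h : y * x = zetaPow N (-2) • (x * y)) (k : ℕ)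
    (hk : k < N) :
    rCoeff N k • (x + y) ^ k =
      ∑ p ∈ Finset.HasAntidiagonal.antidiagonal k, (rCoeff N p.1 * rCoeff N p.2) • (x ^ p.1 * y ^ p.2) := by
  induction k with
  | zero => simp [rCoeff_zero]
  | succ k ih =>
    have h1 : qInt N ((k : ℂ) + 1) ≠ 0 := by
      have := qInt_ne_zero hN (k := k + 1) (by omega) hk
      push_cast at this
      exact this
    refine smul_right_injective A h1 ?_
    simp only
    rw [smul_smul, rCoeff_succ hN hk, pow_succ', mul_smul, ← mul_smul_comm, ih (by omega),
      Finset.mul_sum, Finset.smul_sum, Finset.smul_sum]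
    have split : ∀ p ∈ Finset.HasAntidiagonal.antidiagonal (k + 1),
        qInt N ((k : ℂ) + 1) • ((rCoeff N p.1 * rCoeff N p.2) • (x ^ p.1 * y ^ p.2)) =
        (zetaPow N p.2 * (qInt N p.1 * rCoeff N p.1) * rCoeff N p.2) • (x ^ p.1 * y ^ p.2) +
        (zetaPow N (-p.1) * rCoeff N p.1 * (qInt N p.2 * rCoeff N p.2)) •
          (x ^ p.1 * y ^ p.2) := by
      intro p hp
      rw [Finset.HasAntidiagonal.mem_antidiagonal] at hp
      have : (k : ℂ) + 1 = p.1 + p.2 := by exact_mod_cast hp.symm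
      rw [this, qInt_add, smul_smul, ← add_smul]
      congr 1
      ring
    rw [Finset.sum_congr rfl split, Finset.sum_add_distrib, Finset.Nat.sum_antidiagonal_succ,
      Finset.Nat.sum_antidiagonal_succ']
    simp only [Nat.cast_zero, qInt_zero, zero_mul, mul_zero, zero_smul, zero_add]
    rw [← Finset.sum_add_distrib]
    refine Finset.sum_congr rfl fun p hp => ?_
    rw [Finset.HasAntidiagonal.mem_antidiagonal] at hp
    push_cast
    rw [rCoeff_succ hN (by omega), rCoeff_succ hN (by omega), mul_smul_comm, add_mul,
      ← mul_assoc, ← mul_assoc, comm_pow h, ← pow_succ', smul_mul_assoc, mul_assoc, ← pow_succ',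
      smul_smul, smul_add, smul_smul]
    have hk' : (k : ℂ) = p.1 + p.2 := by exact_mod_cast hp.symm
    have e1 : zetaPow N k = zetaPow N p.2 * zetaPow N p.1 := by
      rw [hk', add_comm, zetaPow_add]
    have e2 : zetaPow N k * zetaPow N (-2 * p.1) = zetaPow N (-p.1) * zetaPow N p.2 := by
      rw [← zetaPow_add, ← zetaPow_add, hk']
      congr 1
      ring
    congr 2
    · rw [e1]; ring
    · linear_combination ((zetaPow N 1 - zetaPow N (-1)) * rCoeff N p.1 * rCoeff N p.2) * e2

theorem theta_mul {N : ℕ} (hN : 2 ≤ N) {x y z : A} (h : y * x = zetaPow N (-2) • (x * y))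
    (hy : Commute z y) (hz : z ^ N = 0) :
    theta N x z * theta N y z = theta N (x + y) z := by
  have h1 : theta N (x + y) z = ∑ k ∈ Finset.range N, ∑ p ∈ Finset.HasAntidiagonal.antidiagonal k,
      (rCoeff N p.1 * rCoeff N p.2) • (x ^ p.1 * y ^ p.2 * z ^ (p.1 + p.2)) := by
    refine Finset.sum_congr rfl fun k hk => ?_
    rw [← smul_mul_assoc, qbinom hN h k (Finset.mem_range.1 hk), Finset.sum_mul]
    refine Finset.sum_congr rfl fun p hp => ?_
    rw [Finset.HasAntidiagonal.mem_antidiagonal.1 hp, smul_mul_assoc]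
  have h2 : theta N x z * theta N y z = ∑ p ∈ Finset.range N ×ˢ Finset.range N,
      (rCoeff N p.1 * rCoeff N p.2) • (x ^ p.1 * y ^ p.2 * z ^ (p.1 + p.2)) := by
    rw [theta, theta, Finset.sum_mul_sum, Finset.sum_product]
    refine Finset.sum_congr rfl fun a _ => Finset.sum_congr rfl fun b _ => ?_
    rw [smul_mul_smul_comm]
    congr 1
    have : z ^ a * y ^ b = y ^ b * z ^ a := (hy.pow_pow a b).eq
    rw [pow_add, mul_assoc, ← mul_assoc (z ^ a), this]
    simp only [mul_assoc]
  rw [h1, h2, Finset.sum_sigma']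
  refine (Finset.sum_of_injOn (fun s => s.2) ?_ ?_ ?_ ?_).symm
  · rintro ⟨k, p⟩ hs ⟨k', p'⟩ hs' e
    simp only [Finset.coe_sigma, Set.mem_sigma_iff, Finset.mem_coe, Finset.HasAntidiagonal.mem_antidiagonal,
      Finset.mem_range] at hs hs' e
    subst e
    obtain rfl : k = k' := by omega
    rfl
  · rintro ⟨k, p⟩ hs
    simp only [Finset.coe_sigma, Set.mem_sigma_iff, Finset.mem_coe, Finset.HasAntidiagonal.mem_antidiagonal,
      Finset.mem_range, Finset.mem_product] at hs ⊢
    omega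
  · rintro p hp hp'
    have : N ≤ p.1 + p.2 := by
      by_contra hlt
      exact hp' ⟨⟨p.1 + p.2, p⟩, Finset.mem_coe.2 (Finset.mem_sigma.2
        ⟨Finset.mem_range.2 (not_le.1 hlt), Finset.HasAntidiagonal.mem_antidiagonal.2 rfl⟩), rfl⟩
    rw [pow_eq_zero_of_le this hz, mul_zero, smul_zero]
  · rintro _ _
    rfl

theorem qInt_one {N : ℕ} (hN : 2 ≤ N) : qInt N 1 = 1 := div_self (zeta_sub_ne_zero hN)

theorem qInt_add' (N : ℕ) (a b : ℂ) :
    qInt N (a + b) = zetaPow N (-b) * qInt N a + zetaPow N a * qInt N b := by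
  simp only [qInt, neg_add, zetaPow_add]
  ring

theorem e_comm_fpow {N : ℕ} (hN : 2 ≤ N) {E F K K' : A}
    (hEF : E * F - F * E = (zetaPow N 1 - zetaPow N (-1))⁻¹ • (K - K'))
    (hK : K * F = zetaPow N (-2) • (F * K)) (hK' : K' * F = zetaPow N 2 • (F * K')) (n : ℕ) :
    E * F ^ (n + 1) - F ^ (n + 1) * E =
      ((zetaPow N 1 - zetaPow N (-1))⁻¹ * qInt N ((n : ℂ) + 1)) •
        (F ^ n * (zetaPow N (-n) • K - zetaPow N n • K')) := by
  induction n with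
  | zero => simp [hEF, qInt_one hN, zetaPow_zero]
  | succ n ih =>
    have h1 : E * F ^ (n + 1 + 1) - F ^ (n + 1 + 1) * E =
        (E * F ^ (n + 1) - F ^ (n + 1) * E) * F + F ^ (n + 1) * (E * F - F * E) := by
      rw [pow_succ F (n + 1)]
      noncomm_ring
    have h2 : (zetaPow N (-n) • K - zetaPow N n • K') * F =
        F * (zetaPow N (-n - 2) • K - zetaPow N (n + 2) • K') := by
      rw [sub_mul, smul_mul_assoc, smul_mul_assoc, hK, hK', mul_sub, mul_smul_comm,
        mul_smul_comm, smul_smul, smul_smul, ← zetaPow_add, ← zetaPow_add, ← sub_eq_add_neg]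
    rw [h1, ih, hEF, smul_mul_assoc, mul_assoc, h2, ← mul_assoc, ← pow_succ, mul_smul_comm,
      mul_smul, mul_smul, ← smul_add]
    congr 1
    rw [← mul_smul_comm, ← mul_smul_comm, ← mul_add]
    congr 1
    rw [smul_sub, smul_smul, smul_smul, smul_sub, smul_smul, smul_smul]
    push_cast
    have e1 : qInt N ((n : ℂ) + 1 + 1) * zetaPow N (-(n + 1)) =
        qInt N ((n : ℂ) + 1) * zetaPow N (-n - 2) + 1 := by
      rw [qInt_add', qInt_one hN, add_mul, mul_right_comm, ← zetaPow_add, mul_one,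
        ← zetaPow_add, add_neg_cancel, zetaPow_zero, mul_comm]
      congr 3
      ring
    have e2 : qInt N ((n : ℂ) + 1 + 1) * zetaPow N (n + 1) =
        qInt N ((n : ℂ) + 1) * zetaPow N (n + 2) + 1 := by
      rw [qInt_add, qInt_one hN, add_mul, mul_right_comm, ← zetaPow_add, mul_one,
        ← zetaPow_add, neg_add_cancel, zetaPow_zero, mul_comm]
      congr 3
      ring
    rw [e1, e2, add_smul, add_smul, one_smul, one_smul]
    abel

theorem theta_e {N : ℕ} (hN : 2 ≤ N) {X E F K K' : A}
    (hEF : E * F - F * E = (zetaPow N 1 - zetaPow N (-1))⁻¹ • (K - K'))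
    (hK : K * F = zetaPow N (-2) • (F * K)) (hK' : K' * F = zetaPow N 2 • (F * K'))
    (hXE : Commute X E) (hXF : Commute X F) (hXK' : Commute X K')
    (hX : X ^ N = 0) :
    (E + K' * X) * theta N X F = theta N X F * (E + X * K) := by
  have hKF : ∀ k : ℕ, K' * F ^ k = zetaPow N (2 * k) • (F ^ k * K') := by
    intro k
    induction k with
    | zero => simp [zetaPow_zero]
    | succ k ih =>
      rw [pow_succ, ← mul_assoc, ih, smul_mul_assoc, mul_assoc, hK', mul_smul_comm, smul_smul,
        ← zetaPow_add, mul_assoc]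
      congr 2
      push_cast
      ring
  obtain ⟨M, rfl⟩ : ∃ M, N = M + 1 := ⟨N - 1, by omega⟩
  have h1 : E * theta (M + 1) X F - theta (M + 1) X F * E =
      ∑ k ∈ Finset.range M, rCoeff (M + 1) k •
        (X ^ (k + 1) * F ^ k * (K - zetaPow (M + 1) (2 * k) • K')) := by
    have : E * theta (M + 1) X F - theta (M + 1) X F * E = ∑ k ∈ Finset.range (M + 1),
        rCoeff (M + 1) k • (X ^ k * (E * F ^ k - F ^ k * E)) := by
      rw [theta, Finset.mul_sum, Finset.sum_mul, ← Finset.sum_sub_distrib]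
      refine Finset.sum_congr rfl fun k _ => ?_
      rw [mul_smul_comm, smul_mul_assoc, ← smul_sub, mul_sub, ← mul_assoc, ← mul_assoc,
        ← (hXE.pow_left k).eq, mul_assoc, mul_assoc (X ^ k)]
    rw [this, Finset.sum_range_succ']
    simp only [pow_zero, mul_one, one_mul, sub_self, mul_zero, smul_zero, add_zero]
    refine Finset.sum_congr rfl fun k hk => ?_
    rw [e_comm_fpow hN hEF hK hK', mul_smul_comm, smul_smul, mul_left_comm,
      mul_comm (rCoeff _ _), rCoeff_succ hN (by have := Finset.mem_range.1 hk; omega),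
      ← mul_assoc, mul_comm (zetaPow (M + 1) k), ← mul_assoc,
      inv_mul_cancel₀ (zeta_sub_ne_zero hN), one_mul, mul_comm, mul_smul, mul_assoc]
    congr 1
    rw [← mul_smul_comm, ← mul_smul_comm, smul_sub, smul_smul, smul_smul, ← zetaPow_add,
      ← zetaPow_add, add_neg_cancel, zetaPow_zero, one_smul, two_mul]
  have h2 : theta (M + 1) X F * (X * K) - K' * X * theta (M + 1) X F =
      ∑ k ∈ Finset.range M, rCoeff (M + 1) k •
        (X ^ (k + 1) * F ^ k * (K - zetaPow (M + 1) (2 * k) • K')) := by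
    have : theta (M + 1) X F * (X * K) - K' * X * theta (M + 1) X F =
        ∑ k ∈ Finset.range (M + 1), rCoeff (M + 1) k •
        (X ^ (k + 1) * F ^ k * (K - zetaPow (M + 1) (2 * k) • K')) := by
      rw [theta, Finset.mul_sum, Finset.sum_mul, ← Finset.sum_sub_distrib]
      refine Finset.sum_congr rfl fun k _ => ?_
      rw [mul_smul_comm, smul_mul_assoc, ← smul_sub]
      congr 1
      rw [mul_sub, mul_smul_comm]
      congr 1
      · rw [← mul_assoc, mul_assoc (X ^ k), ← (hXF.pow_right k).eq, ← mul_assoc, ← pow_succ]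
      · rw [← mul_assoc, mul_assoc K', ← pow_succ', ← (hXK'.pow_left (k + 1)).eq, mul_assoc,
          hKF, mul_smul_comm, mul_assoc]
    rw [this, Finset.sum_range_succ, hX]
    simp
  have h3 := h1.trans h2.symm
  rw [add_mul, mul_add]
  rw [sub_eq_sub_iff_add_eq_add] at h3
  rw [h3, add_comm]

theorem theta_f {N : ℕ} (hN : 2 ≤ N) {X E F K K' : A}
    (hEF : E * F - F * E = (zetaPow N 1 - zetaPow N (-1))⁻¹ • (K - K'))
    (hK : E * K = zetaPow N (-2) • (K * E)) (hK' : E * K' = zetaPow N 2 • (K' * E))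
    (hXE : Commute X E) (hXF : Commute X F) (hXK' : Commute X K')
    (hX : X ^ N = 0) :
    theta N E X * (F + X * K') = (F + K * X) * theta N E X := by
  have ht : MulOpposite.op (theta N E X) = theta N (MulOpposite.op X) (MulOpposite.op E) := by
    simp only [theta, Finset.op_sum, MulOpposite.op_smul, MulOpposite.op_mul, MulOpposite.op_pow]
  have := theta_e hN (X := MulOpposite.op X) (E := MulOpposite.op F) (F := MulOpposite.op E)
    (K := MulOpposite.op K) (K' := MulOpposite.op K')
    (by simp only [← MulOpposite.op_mul, ← MulOpposite.op_sub, ← MulOpposite.op_smul, hEF])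
    (by simp only [← MulOpposite.op_mul, ← MulOpposite.op_smul, hK])
    (by simp only [← MulOpposite.op_mul, ← MulOpposite.op_smul, hK'])
    hXF.op hXE.op hXK'.op (by rw [← MulOpposite.op_pow, hX, MulOpposite.op_zero])
  rw [← ht] at this
  apply MulOpposite.op_injective
  simpa only [← MulOpposite.op_mul, ← MulOpposite.op_add] using this

theorem theta_semiconj {N : ℕ} {d x x' z z' : A} (hx : SemiconjBy d x x')
    (hz : SemiconjBy d z z') : SemiconjBy d (theta N x z) (theta N x' z') := by
  rw [SemiconjBy, theta, theta, Finset.mul_sum, Finset.sum_mul]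
  refine Finset.sum_congr rfl fun k _ => ?_
  rw [mul_smul_comm, smul_mul_assoc]
  congr 1
  exact ((hx.pow_right k).mul_right (hz.pow_right k)).eq

theorem theta_shift {N : ℕ} {k x z : A} (hx : Commute k x) (hz : Commute k z) :
    theta N x (k * z) = theta N (x * k) z := by
  refine Finset.sum_congr rfl fun m _ => ?_
  rw [hz.mul_pow, hx.symm.mul_pow, mul_assoc]

theorem isUnit_theta {N : ℕ} (hN : 2 ≤ N) {x z : A} (h : Commute x z) (hz : z ^ N = 0) :
    IsUnit (theta N x z) := by
  obtain ⟨M, rfl⟩ : ∃ M, N = M + 1 := ⟨N - 1, by omega⟩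
  have h1 : theta (M + 1) x z =
      (x * ∑ k ∈ Finset.range M, rCoeff (M + 1) (k + 1) • (x ^ k * z ^ k)) * z + 1 := by
    rw [theta, Finset.sum_range_succ', Finset.mul_sum, Finset.sum_mul]
    congr 1
    · refine Finset.sum_congr rfl fun k _ => ?_
      rw [mul_smul_comm, smul_mul_assoc, pow_succ', pow_succ]
      simp only [mul_assoc]
    · simp [rCoeff_zero]
  rw [h1]
  refine IsNilpotent.isUnit_add_one ?_
  refine Commute.isNilpotent_mul_left ?_ ⟨M + 1, hz⟩
  refine h.mul_left (Commute.sum_left _ _ _ fun k _ => ?_)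
  exact ((h.pow_left k).mul_left ((Commute.refl z).pow_left k)).smul_left _

end Algebra

/-! ### The module `U_N(l)` -/

/-- `E` on `U_N(l)` in the basis `v_0, …, v_{N-1}`: `E v_j = [l + 1 - j] v_{j-1}`. -/
def actE (N : ℕ) (l : ℂ) : Matrix (Fin N) (Fin N) ℂ :=
  Matrix.of fun i j => if (i : ℕ) + 1 = j then qInt N (l + 1 - (j : ℕ)) else 0

/-- `F` on `U_N(l)`: `F v_j = [j + 1] v_{j+1}` for `j < N - 1`, and `F v_{N-1} = 0`. -/
def actF (N : ℕ) : Matrix (Fin N) (Fin N) ℂ :=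
  Matrix.of fun i j => if (i : ℕ) = j + 1 then qInt N ((j : ℕ) + 1) else 0

/-- The power `K^m` on `U_N(l)`: `K^m v_j = ζ^(m (l - 2j)) v_j`. -/
def actK (N : ℕ) (l : ℂ) (m : ℤ) : Matrix (Fin N) (Fin N) ℂ :=
  Matrix.diagonal fun j => zetaPow N (m * (l - 2 * (j : ℕ)))

theorem actE_shift {N : ℕ} {l : ℂ} {i j : Fin N} (h : actE N l i j ≠ 0) : (i : ℕ) + 1 = j := by
  by_contra h'
  exact h (by simp [actE, h'])

theorem actF_shift {N : ℕ} {i j : Fin N} (h : actF N i j ≠ 0) : (i : ℕ) = j + 1 := by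
  by_contra h'
  exact h (by simp [actF, h'])

theorem actE_pow (N : ℕ) (l : ℂ) : actE N l ^ N = 0 := by
  have key : ∀ (k : ℕ) (i j : Fin N), (actE N l ^ k) i j ≠ 0 → (i : ℕ) + k = j := by
    intro k
    induction k with
    | zero =>
      intro i j h
      by_contra h'
      exact h (by rw [pow_zero, Matrix.one_apply_ne]; rintro rfl; exact h' rfl)
    | succ k ih =>
      intro i j h
      rw [pow_succ, Matrix.mul_apply] at h
      obtain ⟨x, -, hx⟩ := Finset.exists_ne_zero_of_sum_ne_zero h
      have h1 := ih i x (left_ne_zero_of_mul hx)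
      have h2 := actE_shift (right_ne_zero_of_mul hx)
      omega
  ext i j
  by_contra h
  have := key N i j h
  omega

theorem actF_pow (N : ℕ) : actF N ^ N = 0 := by
  have key : ∀ (k : ℕ) (i j : Fin N), (actF N ^ k) i j ≠ 0 → (i : ℕ) = j + k := by
    intro k
    induction k with
    | zero =>
      intro i j h
      by_contra h'
      exact h (by rw [pow_zero, Matrix.one_apply_ne]; rintro rfl; exact h' rfl)
    | succ k ih =>
      intro i j h
      rw [pow_succ, Matrix.mul_apply] at h
      obtain ⟨x, -, hx⟩ := Finset.exists_ne_zero_of_sum_ne_zero h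
      have h1 := ih i x (left_ne_zero_of_mul hx)
      have h2 := actF_shift (right_ne_zero_of_mul hx)
      omega
  ext i j
  by_contra h
  have := key N i j h
  omega

theorem actK_zero (N : ℕ) (l : ℂ) : actK N l 0 = 1 := by
  simp [actK, zetaPow_zero]

theorem actK_mul (N : ℕ) (l : ℂ) (m m' : ℤ) : actK N l m * actK N l m' = actK N l (m + m') := by
  rw [actK, actK, actK, Matrix.diagonal_mul_diagonal]
  congr 1
  ext j
  rw [← zetaPow_add]
  congr 1
  push_cast
  ring

theorem actK_mul_actE (N : ℕ) (l : ℂ) (m : ℤ) :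
    actK N l m * actE N l = zetaPow N (2 * m) • (actE N l * actK N l m) := by
  ext i j
  rw [actK, Matrix.diagonal_mul, Matrix.smul_apply, Matrix.mul_diagonal, smul_eq_mul]
  by_cases h : actE N l i j = 0
  · simp [h]
  · have hs : (j : ℂ) = i + 1 := by exact_mod_cast (actE_shift h).symm
    rw [mul_left_comm, mul_comm, ← zetaPow_add]
    congr 2
    rw [hs]
    ring

theorem actK_mul_actF (N : ℕ) (l : ℂ) (m : ℤ) :
    actK N l m * actF N = zetaPow N (-2 * m) • (actF N * actK N l m) := by
  ext i j
  rw [actK, Matrix.diagonal_mul, Matrix.smul_apply, Matrix.mul_diagonal, smul_eq_mul]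
  by_cases h : actF N i j = 0
  · simp [h]
  · have hs : (i : ℂ) = j + 1 := by exact_mod_cast (actF_shift h)
    rw [mul_left_comm, mul_comm, ← zetaPow_add]
    congr 2
    rw [hs]
    ring

theorem qInt_self {N : ℕ} (hN : 2 ≤ N) : qInt N N = 0 := by
  have : zetaPow N (N : ℂ) = zetaPow N (-N) := by
    have h := zetaPow_two_mul_self hN
    rw [two_mul, zetaPow_add] at h
    have h' : zetaPow N (N : ℂ) * zetaPow N (-N) = 1 := by
      rw [← zetaPow_add, add_neg_cancel, zetaPow_zero]
    exact mul_left_cancel₀ (zetaPow_ne_zero N N) (h.trans h'.symm)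
  rw [qInt, this, sub_self, zero_div]

theorem qInt_comm {N : ℕ} (hN : 2 ≤ N) (l i : ℂ) :
    qInt N (l - i) * qInt N (i + 1) - qInt N i * qInt N (l + 1 - i) = qInt N (l - 2 * i) := by
  have h0 := zeta_sub_ne_zero hN
  have e1 : l - i = (l - 2 * i) + i := by ring
  have e2 : l + 1 - i = (l - 2 * i) + i + 1 := by ring
  rw [e1, e2]
  generalize l - 2 * i = a
  simp only [qInt, neg_add, zetaPow_add]
  have h1 := zetaPow_ne_zero N a
  have h2 := zetaPow_ne_zero N i
  have h3 := zetaPow_ne_zero N 1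
  have r : ∀ b, zetaPow N (-b) = (zetaPow N b)⁻¹ := fun b =>
    eq_inv_of_mul_eq_one_left (by rw [← zetaPow_add, neg_add_cancel, zetaPow_zero])
  simp only [r] at h0 ⊢
  generalize zetaPow N a = x at *
  generalize zetaPow N i = y at *
  generalize zetaPow N 1 = z at *
  have h4 : z ^ 2 - 1 ≠ 0 := by
    intro h
    apply h0
    field_simp
    linear_combination h
  field_simp
  ring

theorem actE_mul_actF {N : ℕ} (hN : 2 ≤ N) (l : ℂ) :
    actE N l * actF N - actF N * actE N l =
      (zetaPow N 1 - zetaPow N (-1))⁻¹ • (actK N l 1 - actK N l (-1)) := by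
  have h1 : actE N l * actF N =
      Matrix.diagonal fun i : Fin N => qInt N (l - (i : ℕ)) * qInt N ((i : ℕ) + 1) := by
    ext i j
    rw [Matrix.mul_apply]
    by_cases hi : (i : ℕ) + 1 < N
    · rw [Finset.sum_eq_single ⟨(i : ℕ) + 1, hi⟩]
      · by_cases hij : i = j
        · subst hij
          simp [actE, actF]
        · have : (i : ℕ) ≠ j := fun h => hij (Fin.ext h)
          simp [actF, hij, this]
      · intro x _ hx
        have : (i : ℕ) + 1 ≠ x := fun h => hx (Fin.ext h.symm)
        simp [actE, this]
      · simp
    · have hi' : (i : ℕ) + 1 = N := by omega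
      have hz : qInt N ((i : ℕ) + 1) = 0 := by
        have hc : ((i : ℕ) : ℂ) + 1 = N := by exact_mod_cast hi'
        rw [hc, qInt_self hN]
      rw [Finset.sum_eq_zero]
      · by_cases hij : i = j
        · subst hij
          simp [hz]
        · simp [hij]
      · intro x _
        have : (i : ℕ) + 1 ≠ x := by omega
        simp [actE, this]
  have h2 : actF N * actE N l =
      Matrix.diagonal fun i : Fin N => qInt N (i : ℕ) * qInt N (l + 1 - (i : ℕ)) := by
    ext i j
    rw [Matrix.mul_apply]
    by_cases hi : 0 < (i : ℕ)
    · rw [Finset.sum_eq_single ⟨(i : ℕ) - 1, by omega⟩]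
      · have hi' : (((i : ℕ) - 1 : ℕ) : ℂ) + 1 = (i : ℕ) := by
          exact_mod_cast (by omega : (i : ℕ) - 1 + 1 = i)
        by_cases hij : i = j
        · subst hij
          simp [actE, actF, hi', Nat.sub_add_cancel hi]
        · have : (i : ℕ) ≠ j := fun h => hij (Fin.ext h)
          simp [actE, hij, Nat.sub_add_cancel hi, this]
      · intro x _ hx
        have : (i : ℕ) ≠ x + 1 := fun h => hx (Fin.ext (by simp [h]))
        simp [actF, this]
      · simp
    · have hi' : (i : ℕ) = 0 := by omega
      rw [Finset.sum_eq_zero]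
      · by_cases hij : i = j
        · subst hij
          simp [hi', qInt_zero]
        · simp [hij]
      · intro x _
        have : (i : ℕ) ≠ x + 1 := by omega
        simp [actF, this]
  rw [h1, h2, actK, actK, Matrix.diagonal_sub, Matrix.diagonal_sub, ← Matrix.diagonal_smul]
  congr 1
  ext i
  rw [qInt_comm hN, Pi.smul_apply, smul_eq_mul, qInt, div_eq_inv_mul]
  push_cast
  simp


/-! ### Tensor powers -/

/-- The operator `M_1 ⊗ ⋯ ⊗ M_n` on `U_N(l)^{⊗n}`. The latter has the basis
`v_{e_1} ⊗ ⋯ ⊗ v_{e_n}`, indexed by `e : Fin n → Fin N`. -/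
def tensorOp {N n : ℕ} (M : Fin n → Matrix (Fin N) (Fin N) ℂ) :
    Matrix (Fin n → Fin N) (Fin n → Fin N) ℂ :=
  Matrix.of fun e e' => ∏ j, M j (e j) (e' j)

theorem tensorOp_mul {N n : ℕ} (M M' : Fin n → Matrix (Fin N) (Fin N) ℂ) :
    tensorOp (M * M') = tensorOp M * tensorOp M' := by
  ext e e'
  simp only [tensorOp, Matrix.mul_apply, Matrix.of_apply, Pi.mul_apply, ← Finset.prod_mul_distrib]
  rw [Finset.prod_univ_sum, Fintype.piFinset_univ]

theorem tensorOp_one {N n : ℕ} : tensorOp (1 : Fin n → Matrix (Fin N) (Fin N) ℂ) = 1 := by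
  ext e e'
  simp only [tensorOp, Matrix.of_apply, Pi.one_apply]
  by_cases h : e = e'
  · subst h
    simp
  · rw [Matrix.one_apply_ne h]
    obtain ⟨j, hj⟩ := Function.ne_iff.1 h
    exact Finset.prod_eq_zero (Finset.mem_univ j) (Matrix.one_apply_ne hj)

/-- The operator `M` acting on the `i`-th tensor factor. -/
def site {N n : ℕ} (i : Fin n) (M : Matrix (Fin N) (Fin N) ℂ) :
    Matrix (Fin n → Fin N) (Fin n → Fin N) ℂ :=
  tensorOp (Pi.mulSingle i M)

theorem site_mul {N n : ℕ} (i : Fin n) (M M' : Matrix (Fin N) (Fin N) ℂ) :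
    site i (M * M') = site i M * site i M' := by
  rw [site, Pi.mulSingle_mul, tensorOp_mul]; rfl

theorem site_one {N n : ℕ} (i : Fin n) : site i (1 : Matrix (Fin N) (Fin N) ℂ) = 1 := by
  rw [site, Pi.mulSingle_one, tensorOp_one]

theorem site_pow {N n : ℕ} (i : Fin n) (M : Matrix (Fin N) (Fin N) ℂ) (k : ℕ) :
    site i (M ^ k) = site i M ^ k := by
  induction k with
  | zero => simp [site_one]
  | succ k ih => rw [pow_succ, pow_succ, site_mul, ih]

theorem site_apply {N n : ℕ} (i : Fin n) (M : Matrix (Fin N) (Fin N) ℂ) (e e' : Fin n → Fin N) :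
    site i M e e' = if ∀ k, k ≠ i → e k = e' k then M (e i) (e' i) else 0 := by
  simp only [site, tensorOp, Matrix.of_apply]
  split_ifs with h
  · rw [Finset.prod_eq_single i]
    · simp
    · intro k _ hk
      rw [Pi.mulSingle_eq_of_ne hk, h k hk, Matrix.one_apply_eq]
    · simp
  · push Not at h
    obtain ⟨k, hk, hne⟩ := h
    exact Finset.prod_eq_zero (Finset.mem_univ k)
      (by rw [Pi.mulSingle_eq_of_ne hk, Matrix.one_apply_ne hne])

theorem site_sub {N n : ℕ} (i : Fin n) (M M' : Matrix (Fin N) (Fin N) ℂ) :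
    site i (M - M') = site i M - site i M' := by
  ext e e'
  simp only [Matrix.sub_apply, site_apply]
  split_ifs <;> simp

theorem site_smul {N n : ℕ} (i : Fin n) (c : ℂ) (M : Matrix (Fin N) (Fin N) ℂ) :
    site i (c • M) = c • site i M := by
  ext e e'
  simp only [Matrix.smul_apply, site_apply]
  split_ifs <;> simp

theorem site_zero {N n : ℕ} (i : Fin n) : site i (0 : Matrix (Fin N) (Fin N) ℂ) = 0 := by
  ext e e'
  simp [site_apply]

theorem site_diagonal {N n : ℕ} (i : Fin n) (d : Fin N → ℂ) :
    site i (Matrix.diagonal d) = Matrix.diagonal fun e : Fin n → Fin N => d (e i) := by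
  ext e e'
  rw [site_apply]
  by_cases h : e = e'
  · subst h
    simp
  · rw [Matrix.diagonal_apply_ne _ h]
    split_ifs with h'
    · apply Matrix.diagonal_apply_ne
      intro hi
      refine h (funext fun k => ?_)
      by_cases hk : k = i
      · rw [hk, hi]
      · exact h' k hk
    · rfl

theorem site_commute {N n : ℕ} {i j : Fin n} (h : i ≠ j) (M M' : Matrix (Fin N) (Fin N) ℂ) :
    Commute (site i M) (site j M') := by
  have h1 : (Pi.mulSingle i M * Pi.mulSingle j M' : Fin n → Matrix (Fin N) (Fin N) ℂ) =
      Pi.mulSingle j M' * Pi.mulSingle i M :=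
    (Pi.mulSingle_commute (f := fun _ : Fin n => Matrix (Fin N) (Fin N) ℂ) h M M').eq
  rw [Commute, SemiconjBy, site, site, ← tensorOp_mul, h1, tensorOp_mul]

/-! ### The `R`-operator -/

/-- The transposition `T (v_a ⊗ v_b) = v_b ⊗ v_a` on `U_N(l) ⊗ U_N(l)`. -/
def flipMatrix (N : ℕ) : Matrix (Fin N × Fin N) (Fin N × Fin N) ℂ :=
  Matrix.of fun p p' => if p = p'.swap then 1 else 0

/-- The operator `R = ζ^(-l²/2) T ∘ ℛ` on `U_N(l) ⊗ U_N(l)`, where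
`ℛ = ζ^(H ⊗ H / 2) Σ_k ζ^(k(k-1)/2) (ζ - ζ⁻¹)^k / [k]! E^k ⊗ F^k` is the universal `R`-matrix
and `H v_j = (l - 2j) v_j` (so `K = ζ^H`). Since `E^N = F^N = 0` on `U_N(l)`, the sum runs over
`k < N`. -/
def rMatrix (N : ℕ) (l : ℂ) : Matrix (Fin N × Fin N) (Fin N × Fin N) ℂ :=
  zetaPow N (-(l * l) / 2) • (flipMatrix N *
    ((Matrix.diagonal fun p : Fin N × Fin N =>
        zetaPow N ((l - 2 * (p.1 : ℕ)) * (l - 2 * (p.2 : ℕ)) / 2)) *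
      ∑ k ∈ Finset.range N, rCoeff N k • ((actE N l ^ k) ⊗ₖ (actF N ^ k))))

/-- The operator `A` on `U_N(l) ⊗ U_N(l)`, acting on the tensor factors `i` and `j` (`i ≠ j`) of
`U_N(l)^{⊗n}`, and as the identity on the other factors. -/
def atSites {N n : ℕ} (i j : Fin n) (A : Matrix (Fin N × Fin N) (Fin N × Fin N) ℂ) :
    Matrix (Fin n → Fin N) (Fin n → Fin N) ℂ :=
  Matrix.of fun e e' =>
    if ∀ k, k ≠ i → k ≠ j → e k = e' k then A (e i, e j) (e' i, e' j) else 0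

/-- Permutation of the tensor factors. -/
def permOp (N : ℕ) {n : ℕ} (s : Equiv.Perm (Fin n)) :
    Matrix (Fin n → Fin N) (Fin n → Fin N) ℂ :=
  Matrix.of fun e e' => if e = e' ∘ s then 1 else 0

/-- `ζ^(H ⊗ H / 2)` on the factors `i` and `j`. -/
def diagOp (N : ℕ) (l : ℂ) {n : ℕ} (i j : Fin n) :
    Matrix (Fin n → Fin N) (Fin n → Fin N) ℂ :=
  Matrix.diagonal fun e => zetaPow N ((l - 2 * (e i : ℕ)) * (l - 2 * (e j : ℕ)) / 2)

/-- The universal `R`-matrix on the factors `i` and `j`. -/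
def rOp (N : ℕ) (l : ℂ) {n : ℕ} (i j : Fin n) : Matrix (Fin n → Fin N) (Fin n → Fin N) ℂ :=
  diagOp N l i j * theta N (site i (actE N l)) (site j (actF N))

theorem permOp_mul_apply {N n : ℕ} (s : Equiv.Perm (Fin n))
    (X : Matrix (Fin n → Fin N) (Fin n → Fin N) ℂ) (e e' : Fin n → Fin N) :
    (permOp N s * X) e e' = X (e ∘ s.symm) e' := by
  rw [Matrix.mul_apply, Finset.sum_eq_single (e ∘ s.symm)]
  · simp [permOp, Function.comp_assoc]
  · intro f _ hf
    rw [permOp, Matrix.of_apply, if_neg, zero_mul]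
    rintro rfl
    exact hf (by simp [Function.comp_assoc])
  · simp

theorem mul_permOp_apply {N n : ℕ} (s : Equiv.Perm (Fin n))
    (X : Matrix (Fin n → Fin N) (Fin n → Fin N) ℂ) (e e' : Fin n → Fin N) :
    (X * permOp N s) e e' = X e (e' ∘ s) := by
  rw [Matrix.mul_apply, Finset.sum_eq_single (e' ∘ s)]
  · simp [permOp]
  · intro f _ hf
    rw [permOp, Matrix.of_apply, if_neg hf, mul_zero]
  · simp

theorem permOp_mul {N n : ℕ} (s t : Equiv.Perm (Fin n)) :
    permOp N s * permOp N t = permOp N (t * s) := by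
  ext e e'
  rw [mul_permOp_apply]
  rfl

theorem permOp_one {N n : ℕ} : permOp N (1 : Equiv.Perm (Fin n)) = 1 := by
  ext e e'
  simp [permOp, Matrix.one_apply]

theorem permOp_tensorOp {N n : ℕ} (s : Equiv.Perm (Fin n))
    (M : Fin n → Matrix (Fin N) (Fin N) ℂ) :
    permOp N s * tensorOp M = tensorOp (M ∘ s) * permOp N s := by
  ext e e'
  rw [permOp_mul_apply, mul_permOp_apply]
  simp only [tensorOp, Matrix.of_apply, Function.comp]
  rw [← Equiv.prod_comp s]
  simp

theorem permOp_site {N n : ℕ} (s : Equiv.Perm (Fin n)) (a : Fin n)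
    (M : Matrix (Fin N) (Fin N) ℂ) :
    permOp N s * site (s a) M = site a M * permOp N s := by
  rw [site, permOp_tensorOp, site]
  congr 2
  ext k : 1
  by_cases h : k = a
  · subst h
    simp
  · rw [Function.comp_apply, Pi.mulSingle_eq_of_ne h, Pi.mulSingle_eq_of_ne]
    simpa using h

theorem permOp_diagOp {N n : ℕ} (l : ℂ) (s : Equiv.Perm (Fin n)) (a b : Fin n) :
    permOp N s * diagOp N l (s a) (s b) = diagOp N l a b * permOp N s := by
  ext e e'
  rw [diagOp, diagOp, Matrix.mul_diagonal, Matrix.diagonal_mul]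
  simp only [permOp, Matrix.of_apply]
  split_ifs with h
  · subst h
    simp
  · simp

theorem permOp_rOp {N n : ℕ} (l : ℂ) (s : Equiv.Perm (Fin n)) (a b : Fin n) :
    permOp N s * rOp N l (s a) (s b) = rOp N l a b * permOp N s := by
  have h : SemiconjBy (permOp N s) (theta N (site (s a) (actE N l)) (site (s b) (actF N)))
      (theta N (site a (actE N l)) (site b (actF N))) :=
    theta_semiconj (permOp_site s a _) (permOp_site s b _)
  rw [rOp, rOp, ← mul_assoc, permOp_diagOp, mul_assoc, h.eq, mul_assoc]

theorem diagOp_comm {N n : ℕ} (l : ℂ) (a b : Fin n) : diagOp N l a b = diagOp N l b a := by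
  simp only [diagOp, mul_comm]

theorem diagonal_commute {m : Type*} [Fintype m] [DecidableEq m] (d d' : m → ℂ) :
    Commute (Matrix.diagonal d) (Matrix.diagonal d') := by
  rw [Commute, SemiconjBy, Matrix.diagonal_mul_diagonal, Matrix.diagonal_mul_diagonal]
  simp only [mul_comm]

theorem site_diagOp {N n : ℕ} (l : ℂ) {a c : Fin n} (hac : a ≠ c)
    {M : Matrix (Fin N) (Fin N) ℂ} {s : ℤ}
    (hM : ∀ i j, M i j ≠ 0 → ((j : ℕ) : ℂ) = (i : ℕ) - s) :
    site a M * diagOp N l a c = diagOp N l a c * (site c (actK N l s) * site a M) := by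
  ext e e'
  rw [actK, site_diagonal, diagOp, Matrix.mul_diagonal, Matrix.diagonal_mul,
    Matrix.diagonal_mul, site_apply]
  split_ifs with h
  · by_cases h0 : M (e a) (e' a) = 0
    · simp [h0]
    · rw [mul_comm, ← mul_assoc, ← zetaPow_add]
      congr 2
      rw [hM _ _ h0, ← h c hac.symm]
      ring
  · simp

theorem siteE_diagOp {N n : ℕ} (l : ℂ) {a c : Fin n} (hac : a ≠ c) :
    site a (actE N l) * diagOp N l a c =
      diagOp N l a c * (site c (actK N l (-1)) * site a (actE N l)) :=
  site_diagOp l hac fun i j h => by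
    have := actE_shift h
    push_cast
    have : ((i : ℕ) : ℂ) + 1 = (j : ℕ) := by exact_mod_cast this
    linear_combination -this

theorem siteF_diagOp {N n : ℕ} (l : ℂ) {a c : Fin n} (hac : a ≠ c) :
    site a (actF N) * diagOp N l a c =
      diagOp N l a c * (site c (actK N l 1) * site a (actF N)) :=
  site_diagOp l hac fun i j h => by
    have := actF_shift h
    push_cast
    have : ((i : ℕ) : ℂ) = (j : ℕ) + 1 := by exact_mod_cast this
    linear_combination -this

theorem tensorOp_diagOp_commute {N n : ℕ} (l : ℂ) {a b : Fin n}
    {M : Fin n → Matrix (Fin N) (Fin N) ℂ} {d d' : Fin N → ℂ}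
    (ha : M a = Matrix.diagonal d) (hb : M b = Matrix.diagonal d') :
    Commute (tensorOp M) (diagOp N l a b) := by
  ext e e'
  rw [diagOp, Matrix.mul_diagonal, Matrix.diagonal_mul]
  by_cases h : e a = e' a ∧ e b = e' b
  · rw [h.1, h.2, mul_comm]
  · have : tensorOp M e e' = 0 := by
      rw [not_and_or] at h
      rcases h with h | h
      · exact Finset.prod_eq_zero (Finset.mem_univ a) (by rw [ha, Matrix.diagonal_apply_ne _ h])
      · exact Finset.prod_eq_zero (Finset.mem_univ b) (by rw [hb, Matrix.diagonal_apply_ne _ h])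
    rw [this, zero_mul, mul_zero]

theorem site_diagOp_commute {N n : ℕ} (l : ℂ) {a b c : Fin n} (ha : c ≠ a) (hb : c ≠ b)
    (M : Matrix (Fin N) (Fin N) ℂ) : Commute (site c M) (diagOp N l a b) :=
  tensorOp_diagOp_commute (d := 1) (d' := 1) l
    (by rw [Pi.mulSingle_eq_of_ne ha.symm]; exact Matrix.diagonal_one.symm)
    (by rw [Pi.mulSingle_eq_of_ne hb.symm]; exact Matrix.diagonal_one.symm)

theorem siteK_diagOp_commute {N n : ℕ} (l : ℂ) (a b c : Fin n) (m : ℤ) :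
    Commute (site c (actK N l m)) (diagOp N l a b) := by
  rw [actK, site_diagonal]
  exact diagonal_commute _ _

theorem siteK_mul {N n : ℕ} (l : ℂ) (a : Fin n) (m m' : ℤ) :
    site a (actK N l m) * site a (actK N l m') = site a (actK N l (m + m')) := by
  rw [← site_mul, actK_mul]

theorem siteK_inv {N n : ℕ} (l : ℂ) (a : Fin n) :
    site a (actK N l 1) * site a (actK N l (-1)) = 1 := by
  rw [siteK_mul, add_neg_cancel, actK_zero, site_one]

theorem siteK_inv' {N n : ℕ} (l : ℂ) (a : Fin n) :
    site a (actK N l (-1)) * site a (actK N l 1) = 1 := by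
  rw [siteK_mul, neg_add_cancel, actK_zero, site_one]

theorem siteEF {N n : ℕ} (hN : 2 ≤ N) (l : ℂ) (a : Fin n) :
    site a (actE N l) * site a (actF N) - site a (actF N) * site a (actE N l) =
      (zetaPow N 1 - zetaPow N (-1))⁻¹ • (site a (actK N l 1) - site a (actK N l (-1))) := by
  rw [← site_mul, ← site_mul, ← site_sub, actE_mul_actF hN, site_smul, site_sub]

theorem siteKE {N n : ℕ} (l : ℂ) (a : Fin n) (m : ℤ) :
    site a (actK N l m) * site a (actE N l) =
      zetaPow N (2 * m) • (site a (actE N l) * site a (actK N l m)) := by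
  rw [← site_mul, actK_mul_actE, site_smul, site_mul]

theorem siteEK {N n : ℕ} (l : ℂ) (a : Fin n) (m : ℤ) :
    site a (actE N l) * site a (actK N l m) =
      zetaPow N (-2 * m) • (site a (actK N l m) * site a (actE N l)) := by
  rw [siteKE, smul_smul, ← zetaPow_add]
  simp [zetaPow_zero]

theorem siteKF {N n : ℕ} (l : ℂ) (a : Fin n) (m : ℤ) :
    site a (actK N l m) * site a (actF N) =
      zetaPow N (-2 * m) • (site a (actF N) * site a (actK N l m)) := by
  rw [← site_mul, actK_mul_actF, site_smul, site_mul]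

theorem siteE_pow {N n : ℕ} (l : ℂ) (a : Fin n) : site a (actE N l) ^ N = 0 := by
  rw [← site_pow, actE_pow, site_zero]

theorem siteF_pow {N n : ℕ} (a : Fin n) : site a (actF N) ^ N = 0 := by
  rw [← site_pow, actF_pow, site_zero]

theorem rOp_E {N n : ℕ} (hN : 2 ≤ N) (l : ℂ) {a b : Fin n} (hab : a ≠ b) :
    SemiconjBy (rOp N l a b)
      (site b (actE N l) + site a (actE N l) * site b (actK N l 1))
      (site a (actE N l) + site a (actK N l 1) * site b (actE N l)) := by
  have h1 := theta_e hN (X := site a (actE N l)) (siteEF hN l b)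
    (by rw [siteKF]; simp) (by rw [siteKF]; simp)
    (site_commute hab _ _) (site_commute hab _ _) (site_commute hab _ _) (siteE_pow l a)
  have h2 : SemiconjBy (diagOp N l a b)
      (site b (actE N l) + site b (actK N l (-1)) * site a (actE N l))
      (site a (actE N l) + site a (actK N l 1) * site b (actE N l)) := by
    rw [SemiconjBy, mul_add, add_mul, ← siteE_diagOp l hab, mul_assoc, diagOp_comm l a b,
      siteE_diagOp l hab.symm, ← mul_assoc, (siteK_diagOp_commute l b a a 1).eq, mul_assoc,
      ← mul_assoc (site a _) (site a _), siteK_inv, one_mul, add_comm]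
  rw [rOp]
  exact SemiconjBy.mul_left h2 h1.symm

theorem rOp_F {N n : ℕ} (hN : 2 ≤ N) (l : ℂ) {a b : Fin n} (hab : a ≠ b) :
    SemiconjBy (rOp N l a b)
      (site a (actF N) + site a (actK N l (-1)) * site b (actF N))
      (site b (actF N) + site b (actK N l (-1)) * site a (actF N)) := by
  have h1 := theta_f hN (X := site b (actF N)) (siteEF hN l a)
    (by rw [siteEK]; simp) (by rw [siteEK]; simp)
    (site_commute hab.symm _ _) (site_commute hab.symm _ _) (site_commute hab.symm _ _)
    (siteF_pow b)
  rw [(site_commute hab.symm (actF N) (actK N l (-1))).eq] at h1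
  have h2 : SemiconjBy (diagOp N l a b)
      (site a (actF N) + site a (actK N l 1) * site b (actF N))
      (site b (actF N) + site b (actK N l (-1)) * site a (actF N)) := by
    rw [SemiconjBy, mul_add, add_mul, mul_assoc (site b (actK N l (-1))), siteF_diagOp l hab,
      ← mul_assoc (site b _), (siteK_diagOp_commute l a b b (-1)).eq, mul_assoc,
      ← mul_assoc (site b _) (site b _), siteK_inv', one_mul, diagOp_comm l a b,
      siteF_diagOp l hab.symm, add_comm]
  rw [rOp]
  exact SemiconjBy.mul_left h2 h1

theorem rOp_mul_rOp {N n : ℕ} (hN : 2 ≤ N) (l : ℂ) {a b c : Fin n} (hab : a ≠ b) (hac : a ≠ c)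
    (hbc : b ≠ c) :
    rOp N l a c * rOp N l b c = diagOp N l a c * diagOp N l b c *
      theta N (site a (actE N l) * site b (actK N l 1) + site b (actE N l)) (site c (actF N)) := by
  have h1 : SemiconjBy (diagOp N l b c)
      (theta N (site a (actE N l)) (site b (actK N l 1) * site c (actF N)))
      (theta N (site a (actE N l)) (site c (actF N))) := by
    apply theta_semiconj
    · exact (site_diagOp_commute l hab hac _).symm
    · rw [SemiconjBy, diagOp_comm l b c, siteF_diagOp l hbc.symm]
  rw [theta_shift (site_commute hab.symm _ _) (site_commute hbc _ _)] at h1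
  have h2 := theta_mul hN (x := site a (actE N l) * site b (actK N l 1))
    (y := site b (actE N l)) (z := site c (actF N)) (by
      rw [← mul_assoc, (site_commute hab.symm _ _).eq, mul_assoc, siteEK, mul_smul_comm]
      simp only [mul_assoc]
      simp) (site_commute hbc.symm _ _) (siteF_pow c)
  rw [rOp, rOp, ← h2, mul_assoc, ← mul_assoc (theta N _ _) (diagOp N l b c), ← h1.eq]
  simp only [mul_assoc]

theorem rOp_diagOp_commute {N n : ℕ} (l : ℂ) {a b c : Fin n} (hab : a ≠ b) (hac : a ≠ c)
    (hbc : b ≠ c) : Commute (diagOp N l a c * diagOp N l b c) (rOp N l a b) := by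
  refine Commute.mul_right ?_ ?_
  · exact (diagonal_commute _ _).mul_left (diagonal_commute _ _)
  · have h : SemiconjBy (diagOp N l a c * diagOp N l b c)
        (theta N (site c (actK N l (-1)) * site a (actE N l))
          (site c (actK N l 1) * site b (actF N)))
        (theta N (site a (actE N l)) (site b (actF N))) := by
      apply theta_semiconj
      · rw [SemiconjBy, ← mul_assoc (site a _), siteE_diagOp l hac, mul_assoc, mul_assoc,
          mul_assoc, (site_diagOp_commute l hab hac _).eq, ← mul_assoc (site c _),
          (siteK_diagOp_commute l b c c (-1)).eq, mul_assoc]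
      · rw [SemiconjBy, ← mul_assoc (site b _), (site_diagOp_commute l hab.symm hbc _).eq,
          mul_assoc, mul_assoc, siteF_diagOp l hbc]
    have hk : Commute (site c (actK N l 1)) (site c (actK N l (-1)) * site a (actE N l)) := by
      refine Commute.mul_right ?_ (site_commute hac.symm _ _)
      rw [Commute, SemiconjBy, siteK_inv, siteK_inv']
    rw [theta_shift hk (site_commute hbc.symm _ _),
      mul_assoc, (site_commute hac (actE N l) (actK N l 1)).eq, ← mul_assoc, siteK_inv',
      one_mul] at h
    exact h

theorem yang_baxter {N n : ℕ} (hN : 2 ≤ N) (l : ℂ) {a b c : Fin n} (hab : a ≠ b) (hac : a ≠ c)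
    (hbc : b ≠ c) :
    rOp N l a b * (rOp N l a c * rOp N l b c) = rOp N l b c * rOp N l a c * rOp N l a b := by
  have h1 : SemiconjBy (rOp N l a b)
      (theta N (site a (actE N l) * site b (actK N l 1) + site b (actE N l)) (site c (actF N)))
      (theta N (site b (actE N l) * site a (actK N l 1) + site a (actE N l))
        (site c (actF N))) := by
    apply theta_semiconj
    · rw [add_comm, add_comm (site b _ * _), (site_commute hab.symm (actE N l) (actK N l 1)).eq]
      exact rOp_E hN l hab
    · refine Commute.symm (Commute.mul_right (site_diagOp_commute l hac.symm hbc.symm _) ?_)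
      exact theta_semiconj (site_commute hac.symm _ _) (site_commute hbc.symm _ _)
  have h2 := rOp_diagOp_commute (N := N) l hab hac hbc
  rw [rOp_mul_rOp hN l hab hac hbc, rOp_mul_rOp hN l hab.symm hbc hac, ← mul_assoc, ← h2.eq,
    mul_assoc, h1.eq, ← mul_assoc]
  congr 2
  exact (diagonal_commute _ _).eq

theorem atSites_smul {N n : ℕ} (i j : Fin n) (c : ℂ)
    (A : Matrix (Fin N × Fin N) (Fin N × Fin N) ℂ) : atSites i j (c • A) = c • atSites i j A := by
  ext e e'
  simp only [atSites, Matrix.of_apply, Matrix.smul_apply]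
  split_ifs <;> simp

theorem atSites_sum {N n : ℕ} (i j : Fin n) (s : Finset ℕ)
    (A : ℕ → Matrix (Fin N × Fin N) (Fin N × Fin N) ℂ) :
    atSites i j (∑ k ∈ s, A k) = ∑ k ∈ s, atSites i j (A k) := by
  ext e e'
  simp only [atSites, Matrix.of_apply, Matrix.sum_apply]
  split_ifs <;> simp

theorem atSites_flip_mul {N n : ℕ} (i j : Fin n)
    (A : Matrix (Fin N × Fin N) (Fin N × Fin N) ℂ) :
    atSites i j (flipMatrix N * A) = permOp N (Equiv.swap i j) * atSites i j A := by
  have h : ∀ p p', (flipMatrix N * A) p p' = A p.swap p' := by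
    intro p p'
    rw [Matrix.mul_apply, Finset.sum_eq_single p.swap]
    · simp [flipMatrix]
    · intro x _ hx
      rw [flipMatrix, Matrix.of_apply, if_neg, zero_mul]
      rintro rfl
      simp at hx
    · simp
  ext e e'
  rw [permOp_mul_apply]
  simp only [atSites, Matrix.of_apply, h, Equiv.symm_swap, Function.comp_apply,
    Equiv.swap_apply_left, Equiv.swap_apply_right, Prod.swap]
  congr 1
  refine propext (forall_congr' fun k => forall_congr' fun hi => forall_congr' fun hj => ?_)
  rw [Equiv.swap_apply_of_ne_of_ne hi hj]

theorem atSites_diagonal_mul {N n : ℕ} (i j : Fin n) (d : Fin N × Fin N → ℂ)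
    (A : Matrix (Fin N × Fin N) (Fin N × Fin N) ℂ) :
    atSites i j (Matrix.diagonal d * A) =
      Matrix.diagonal (fun e : Fin n → Fin N => d (e i, e j)) * atSites i j A := by
  ext e e'
  simp only [atSites, Matrix.of_apply, Matrix.diagonal_mul]
  split_ifs <;> simp

theorem atSites_kronecker {N n : ℕ} {i j : Fin n} (hij : i ≠ j)
    (A B : Matrix (Fin N) (Fin N) ℂ) : atSites i j (A ⊗ₖ B) = site i A * site j B := by
  rw [site, site, ← tensorOp_mul]
  ext e e'
  simp only [atSites, tensorOp, Matrix.of_apply, Matrix.kronecker_apply, Pi.mul_apply]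
  split_ifs with h
  · rw [Finset.prod_eq_mul i j hij]
    · simp [Pi.mulSingle_eq_of_ne hij, Pi.mulSingle_eq_of_ne hij.symm]
    · rintro k - ⟨hi, hj⟩
      rw [Pi.mulSingle_eq_of_ne hi, Pi.mulSingle_eq_of_ne hj, one_mul, h k hi hj,
        Matrix.one_apply_eq]
    · simp
    · simp
  · push Not at h
    obtain ⟨k, hi, hj, hne⟩ := h
    refine (Finset.prod_eq_zero (Finset.mem_univ k) ?_).symm
    rw [Pi.mulSingle_eq_of_ne hi, Pi.mulSingle_eq_of_ne hj, one_mul, Matrix.one_apply_ne hne]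

theorem atSites_rMatrix {N n : ℕ} (l : ℂ) {i j : Fin n} (hij : i ≠ j) :
    atSites i j (rMatrix N l) =
      zetaPow N (-(l * l) / 2) • (permOp N (Equiv.swap i j) * rOp N l i j) := by
  rw [rMatrix, atSites_smul, atSites_flip_mul, atSites_diagonal_mul, atSites_sum, rOp, theta]
  congr 3
  refine Finset.sum_congr rfl fun k _ => ?_
  rw [atSites_smul, atSites_kronecker hij, site_pow, site_pow]

theorem isUnit_atSites_rMatrix {N n : ℕ} (hN : 2 ≤ N) (l : ℂ) {i j : Fin n} (hij : i ≠ j) :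
    IsUnit (atSites i j (rMatrix N l)) := by
  rw [atSites_rMatrix l hij, Algebra.smul_def]
  refine IsUnit.mul ?_ (IsUnit.mul ?_ (IsUnit.mul ?_ ?_))
  · exact (IsUnit.mk0 _ (zetaPow_ne_zero N _)).map (algebraMap ℂ _)
  · exact IsUnit.of_mul_eq_one (permOp N (Equiv.swap i j))
      (by rw [permOp_mul, Equiv.swap_mul_self, permOp_one])
  · rw [diagOp, Matrix.isUnit_diagonal, Pi.isUnit_iff]
    exact fun e => IsUnit.mk0 _ (zetaPow_ne_zero N _)
  · exact isUnit_theta hN (site_commute hij _ _) (siteF_pow j)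

theorem braid_aux {A : Type*} [Monoid A] {P Q X Y Z : A} (p3 : Q * Z = X * Q) (p1 : P * Z = Y * P)
    (p2 : P * Y = Z * P) (p4 : Q * X = Z * Q) (hP : P * Q * P = Q * P * Q)
    (yb : X * (Z * Y) = Y * Z * X) :
    P * X * (Q * Y) * (P * X) = Q * Y * (P * X) * (Q * Y) :=
  calc P * X * (Q * Y) * (P * X) = P * (X * Q) * (Y * P) * X := by simp only [mul_assoc]
    _ = P * Q * (Z * P) * Z * X := by rw [← p3, ← p1]; simp only [mul_assoc]
    _ = P * Q * P * (Y * Z * X) := by rw [← p2]; simp only [mul_assoc]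
    _ = Q * P * Q * (X * (Z * Y)) := by rw [hP, yb]
    _ = Q * P * (Z * Q) * Z * Y := by rw [← p4]; simp only [mul_assoc]
    _ = Q * (Y * P) * (X * Q) * Y := by rw [← p3, ← p1]; simp only [mul_assoc]
    _ = Q * Y * (P * X) * (Q * Y) := by simp only [mul_assoc]

theorem braid_relation {N n : ℕ} (hN : 2 ≤ N) (l : ℂ) {a b c : Fin n} (hab : a ≠ b)
    (hac : a ≠ c) (hbc : b ≠ c) :
    atSites a b (rMatrix N l) * atSites b c (rMatrix N l) * atSites a b (rMatrix N l) =
      atSites b c (rMatrix N l) * atSites a b (rMatrix N l) * atSites b c (rMatrix N l) := by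
  have p1 := permOp_rOp (N := N) l (Equiv.swap a b) b c
  have p2 := permOp_rOp (N := N) l (Equiv.swap a b) a c
  have p3 := permOp_rOp (N := N) l (Equiv.swap b c) a b
  have p4 := permOp_rOp (N := N) l (Equiv.swap b c) a c
  rw [Equiv.swap_apply_right, Equiv.swap_apply_of_ne_of_ne hac.symm hbc.symm] at p1
  rw [Equiv.swap_apply_left, Equiv.swap_apply_of_ne_of_ne hac.symm hbc.symm] at p2
  rw [Equiv.swap_apply_left, Equiv.swap_apply_of_ne_of_ne hab hac] at p3
  rw [Equiv.swap_apply_right, Equiv.swap_apply_of_ne_of_ne hab hac] at p4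
  have hP : permOp N (Equiv.swap a b) * permOp N (Equiv.swap b c) * permOp N (Equiv.swap a b) =
      permOp N (Equiv.swap b c) * permOp N (Equiv.swap a b) * permOp N (Equiv.swap b c) := by
    simp only [permOp_mul, ← mul_assoc]
    congr 1
    have q1 := Equiv.swap_mul_swap_mul_swap hab hac
    have q2 := Equiv.swap_mul_swap_mul_swap hbc.symm hac.symm
    rw [Equiv.swap_comm c b, Equiv.swap_comm b a] at q2
    rw [q1, q2, Equiv.swap_comm]
  have yb := yang_baxter hN l hab hac hbc
  rw [atSites_rMatrix l hab, atSites_rMatrix l hbc]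
  simp only [smul_mul_smul_comm]
  rw [braid_aux p3 p1 p2 p4 hP yb]

theorem far_commute {N n : ℕ} (l : ℂ) {a b c d : Fin n} (hab : a ≠ b) (hcd : c ≠ d)
    (hac : a ≠ c) (had : a ≠ d) (hbc : b ≠ c) (hbd : b ≠ d) :
    Commute (atSites a b (rMatrix N l)) (atSites c d (rMatrix N l)) := by
  rw [atSites_rMatrix l hab, atSites_rMatrix l hcd]
  refine Commute.smul_left (Commute.smul_right ?_ _) _
  have h1 := permOp_rOp (N := N) l (Equiv.swap a b) c d
  have h2 := permOp_rOp (N := N) l (Equiv.swap c d) a b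
  rw [Equiv.swap_apply_of_ne_of_ne hac.symm hbc.symm,
    Equiv.swap_apply_of_ne_of_ne had.symm hbd.symm] at h1
  rw [Equiv.swap_apply_of_ne_of_ne hac had, Equiv.swap_apply_of_ne_of_ne hbc hbd] at h2
  have h3 : Commute (permOp N (Equiv.swap a b)) (permOp N (Equiv.swap c d)) := by
    rw [Commute, SemiconjBy, permOp_mul, permOp_mul, Equiv.mul_swap_eq_swap_mul,
      Equiv.swap_apply_of_ne_of_ne hac had, Equiv.swap_apply_of_ne_of_ne hbc hbd]
  have h4 : Commute (rOp N l a b) (rOp N l c d) := by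
    refine Commute.mul_left (Commute.mul_right (diagonal_commute _ _) ?_)
      (Commute.mul_right ?_ ?_)
    · exact theta_semiconj (site_diagOp_commute l hac.symm hbc.symm _).symm
        (site_diagOp_commute l had.symm hbd.symm _).symm
    · exact (theta_semiconj (N := N) (site_diagOp_commute l hac had (actE N l)).symm
        (site_diagOp_commute l hbc hbd (actF N)).symm).symm
    · refine theta_semiconj (Commute.symm ?_) (Commute.symm ?_)
      · exact theta_semiconj (site_commute hac.symm _ _) (site_commute hbc.symm _ _)
      · exact theta_semiconj (site_commute had.symm _ _) (site_commute hbd.symm _ _)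
  exact Commute.mul_left (Commute.mul_right h3 h1) (Commute.mul_right (Commute.symm h2) h4)

/-! ### The action on `U_N(l)^{⊗n}` through the iterated coproduct -/

/-- `E` on `U_N(l)^{⊗n}`, for the coproduct `Δ(E) = 1 ⊗ E + E ⊗ K`. -/
def totE (N : ℕ) (l : ℂ) (n : ℕ) : Matrix (Fin n → Fin N) (Fin n → Fin N) ℂ :=
  ∑ i : Fin n, tensorOp fun j =>
    if j < i then 1 else if j = i then actE N l else actK N l 1

/-- `F` on `U_N(l)^{⊗n}`, for the coproduct `Δ(F) = K⁻¹ ⊗ F + F ⊗ 1`. -/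
def totF (N : ℕ) (l : ℂ) (n : ℕ) : Matrix (Fin n → Fin N) (Fin n → Fin N) ℂ :=
  ∑ i : Fin n, tensorOp fun j =>
    if j < i then actK N l (-1) else if j = i then actF N else 1

/-- `K` on `U_N(l)^{⊗n}`, for the coproduct `Δ(K) = K ⊗ K`. -/
def totK (N : ℕ) (l : ℂ) (n : ℕ) : Matrix (Fin n → Fin N) (Fin n → Fin N) ℂ :=
  tensorOp fun _ => actK N l 1

theorem tensorOp_site_commute {N n : ℕ} {M : Fin n → Matrix (Fin N) (Fin N) ℂ} {a : Fin n}
    (h : M a = 1) (X : Matrix (Fin N) (Fin N) ℂ) : Commute (tensorOp M) (site a X) := by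
  rw [Commute, SemiconjBy, site, ← tensorOp_mul, ← tensorOp_mul]
  congr 1
  ext k : 1
  by_cases hk : k = a
  · subst hk
    simp [h]
  · simp [Pi.mulSingle_eq_of_ne hk]

theorem tensorOp_rMatrix_commute {N n : ℕ} (l : ℂ) {a b : Fin n} (hab : a ≠ b)
    {M : Fin n → Matrix (Fin N) (Fin N) ℂ} {m : ℤ} (ha : M a = actK N l m)
    (hb : M b = actK N l m) : Commute (tensorOp M) (atSites a b (rMatrix N l)) := by
  rw [atSites_rMatrix l hab]
  refine Commute.smul_right (Commute.mul_right ?_ (Commute.mul_right ?_ ?_)) _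
  · rw [Commute, SemiconjBy, permOp_tensorOp]
    congr 2
    ext k : 1
    rw [Function.comp_apply]
    by_cases h1 : k = a
    · rw [h1, Equiv.swap_apply_left, ha, hb]
    · by_cases h2 : k = b
      · rw [h2, Equiv.swap_apply_right, ha, hb]
      · rw [Equiv.swap_apply_of_ne_of_ne h1 h2]
  · exact tensorOp_diagOp_commute l ha hb
  · have hM : tensorOp M = site a (actK N l m) * site b (actK N l m) *
        tensorOp fun k => if k = a ∨ k = b then 1 else M k := by
      rw [site, site, ← tensorOp_mul, ← tensorOp_mul]
      congr 1
      ext k : 1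
      by_cases h1 : k = a
      · subst h1
        simp [ha, Pi.mulSingle_eq_of_ne hab]
      · by_cases h2 : k = b
        · subst h2
          simp [hb, Pi.mulSingle_eq_of_ne hab.symm]
        · simp [h1, h2, Pi.mulSingle_eq_of_ne]
    rw [hM]
    refine Commute.mul_left ?_ ?_
    · have h : SemiconjBy (site a (actK N l m) * site b (actK N l m))
          (theta N (site a (actE N l)) (site b (actF N)))
          (theta N (zetaPow N (2 * m) • site a (actE N l))
            (zetaPow N (-2 * m) • site b (actF N))) := by
        apply theta_semiconj
        · rw [SemiconjBy, mul_assoc, (site_commute hab.symm _ _).eq, ← mul_assoc, siteKE,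
            smul_mul_assoc, smul_mul_assoc, mul_assoc]
        · rw [SemiconjBy, mul_assoc, siteKF, mul_smul_comm, smul_mul_assoc, ← mul_assoc,
            ← mul_assoc, (site_commute hab _ _).eq]
      have h' : theta N (zetaPow N (2 * m) • site a (actE N l))
          (zetaPow N (-2 * m) • site b (actF N)) =
          theta N (site a (actE N l)) (site b (actF N)) := by
        refine Finset.sum_congr rfl fun k _ => ?_
        rw [smul_pow, smul_pow, smul_mul_smul_comm, ← mul_pow, ← zetaPow_add, neg_mul,
          add_neg_cancel, zetaPow_zero, one_pow, one_smul]
      rw [h'] at h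
      exact h
    · exact theta_semiconj (tensorOp_site_commute (by simp) _) (tensorOp_site_commute (by simp) _)

theorem totK_commute {N n : ℕ} (l : ℂ) {a b : Fin n} (hab : a ≠ b) :
    Commute (totK N l n) (atSites a b (rMatrix N l)) :=
  tensorOp_rMatrix_commute l hab rfl rfl

theorem totE_commute {N n : ℕ} (hN : 2 ≤ N) (l : ℂ) {a b : Fin n} (hab : (a : ℕ) + 1 = b) :
    Commute (totE N l n) (atSites a b (rMatrix N l)) := by
  have hne : a ≠ b := fun h => by subst h; omega
  rw [totE, ← Finset.add_sum_erase _ _ (Finset.mem_univ a),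
    ← Finset.add_sum_erase _ _ (Finset.mem_erase.2 ⟨hne.symm, Finset.mem_univ b⟩), ← add_assoc]
  refine Commute.add_left ?_ (Commute.sum_left _ _ _ fun i hi => ?_)
  · have ha : (tensorOp fun j => if j < a then 1 else if j = a then actE N l else actK N l 1) =
        site a (actE N l) * site b (actK N l 1) *
          tensorOp fun j => if j ≤ b then 1 else actK N l 1 := by
      rw [site, site, ← tensorOp_mul, ← tensorOp_mul]
      congr 1
      ext k : 1
      simp only [Pi.mul_apply]
      rcases lt_trichotomy k a with h | h | h
      · have h2 : k < b := by rw [Fin.lt_def] at h ⊢; omega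
        simp [h, h2.le, Pi.mulSingle_eq_of_ne h.ne, Pi.mulSingle_eq_of_ne h2.ne]
      · subst h
        have h2 : k ≤ b := by rw [Fin.le_def]; omega
        simp [h2, Pi.mulSingle_eq_of_ne hne]
      · rcases eq_or_ne k b with h3 | h3
        · subst h3
          simp [not_lt.2 h.le, h.ne']
        · have h2 : ¬ k ≤ b := by
            rw [Fin.le_def]; rw [Fin.lt_def] at h
            have : (k : ℕ) ≠ b := fun e => h3 (Fin.ext e)
            omega
          simp [not_lt.2 h.le, h.ne', h2, Pi.mulSingle_eq_of_ne h3]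
    have hb : (tensorOp fun j => if j < b then 1 else if j = b then actE N l else actK N l 1) =
        site b (actE N l) * tensorOp fun j => if j ≤ b then 1 else actK N l 1 := by
      rw [site, ← tensorOp_mul]
      congr 1
      ext k : 1
      simp only [Pi.mul_apply]
      rcases lt_trichotomy k b with h | h | h
      · simp [h, h.le, Pi.mulSingle_eq_of_ne h.ne]
      · subst h
        simp
      · simp [not_lt.2 h.le, h.ne', not_le.2 h]
    rw [ha, hb, ← add_mul, add_comm]
    refine Commute.mul_left ?_ (tensorOp_rMatrix_commute (m := 0) l hne ?_ ?_)
    · rw [atSites_rMatrix l hne]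
      refine Commute.smul_right (Commute.symm ?_) _
      refine SemiconjBy.mul_left ?_ (rOp_E hN l hne)
      have h1 := permOp_site (Equiv.swap a b) b (actE N l)
      have h2 := permOp_site (Equiv.swap a b) a (actE N l)
      have h3 := permOp_site (Equiv.swap a b) b (actK N l 1)
      rw [Equiv.swap_apply_right] at h1 h3
      rw [Equiv.swap_apply_left] at h2
      rw [(site_commute hne (actE N l) (actK N l 1)).eq, SemiconjBy, mul_add, add_mul, h1,
        ← mul_assoc, h3, mul_assoc, h2, mul_assoc]
    · rw [actK_zero, if_pos]
      rw [Fin.le_def]; omega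
    · rw [actK_zero, if_pos le_rfl]
  · simp only [Finset.mem_erase, Finset.mem_univ, and_true] at hi
    rcases lt_trichotomy i a with h | h | h
    · have h2 : i < b := by rw [Fin.lt_def] at h ⊢; omega
      exact tensorOp_rMatrix_commute (m := 1) l hne (by simp [not_lt.2 h.le, h.ne'])
        (by simp [not_lt.2 h2.le, h2.ne'])
    · exact absurd h hi.2
    · have h2 : b < i := by
        rw [Fin.lt_def] at h ⊢
        have : (i : ℕ) ≠ b := fun e => hi.1 (Fin.ext e)
        omega
      exact tensorOp_rMatrix_commute (m := 0) l hne (by simp [h, actK_zero])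
        (by simp [h2, actK_zero])

theorem totF_commute {N n : ℕ} (hN : 2 ≤ N) (l : ℂ) {a b : Fin n} (hab : (a : ℕ) + 1 = b) :
    Commute (totF N l n) (atSites a b (rMatrix N l)) := by
  have hne : a ≠ b := fun h => by subst h; omega
  rw [totF, ← Finset.add_sum_erase _ _ (Finset.mem_univ a),
    ← Finset.add_sum_erase _ _ (Finset.mem_erase.2 ⟨hne.symm, Finset.mem_univ b⟩), ← add_assoc]
  refine Commute.add_left ?_ (Commute.sum_left _ _ _ fun i hi => ?_)
  · have ha : (tensorOp fun j => if j < a then actK N l (-1) else if j = a then actF N else 1) =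
        site a (actF N) * tensorOp fun j => if j < a then actK N l (-1) else 1 := by
      rw [site, ← tensorOp_mul]
      congr 1
      ext k : 1
      simp only [Pi.mul_apply]
      rcases lt_trichotomy k a with h | h | h
      · simp [h, Pi.mulSingle_eq_of_ne h.ne]
      · subst h
        simp
      · simp [not_lt.2 h.le, h.ne']
    have hb : (tensorOp fun j => if j < b then actK N l (-1) else if j = b then actF N else 1) =
        site a (actK N l (-1)) * site b (actF N) *
          tensorOp fun j => if j < a then actK N l (-1) else 1 := by
      rw [site, site, ← tensorOp_mul, ← tensorOp_mul]
      congr 1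
      ext k : 1
      simp only [Pi.mul_apply]
      rcases lt_trichotomy k a with h | h | h
      · have h2 : k < b := by rw [Fin.lt_def] at h ⊢; omega
        simp [h, h2, Pi.mulSingle_eq_of_ne h.ne, Pi.mulSingle_eq_of_ne h2.ne]
      · subst h
        have h2 : k < b := by rw [Fin.lt_def]; omega
        simp [h2, Pi.mulSingle_eq_of_ne hne]
      · rcases eq_or_ne k b with h3 | h3
        · subst h3
          simp [not_lt.2 h.le, Pi.mulSingle_eq_of_ne h.ne']
        · have h2 : ¬ k < b := by
            rw [Fin.lt_def] at h ⊢
            have : (k : ℕ) ≠ b := fun e => h3 (Fin.ext e)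
            omega
          simp [not_lt.2 h.le, h2, h3, Pi.mulSingle_eq_of_ne h.ne']
    rw [ha, hb, ← add_mul]
    refine Commute.mul_left ?_ (tensorOp_rMatrix_commute (m := 0) l hne ?_ ?_)
    · rw [atSites_rMatrix l hne]
      refine Commute.smul_right (Commute.symm ?_) _
      refine SemiconjBy.mul_left ?_ (rOp_F hN l hne)
      have h1 := permOp_site (Equiv.swap a b) a (actF N)
      have h2 := permOp_site (Equiv.swap a b) b (actF N)
      have h3 := permOp_site (Equiv.swap a b) a (actK N l (-1))
      rw [Equiv.swap_apply_left] at h1 h3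
      rw [Equiv.swap_apply_right] at h2
      rw [SemiconjBy, mul_add, add_mul, h1, ← mul_assoc, h3, mul_assoc, h2, mul_assoc]
    · rw [actK_zero, if_neg (lt_irrefl a)]
    · rw [actK_zero, if_neg]
      rw [Fin.lt_def]; omega
  · simp only [Finset.mem_erase, Finset.mem_univ, and_true] at hi
    rcases lt_trichotomy i a with h | h | h
    · have h2 : i < b := by rw [Fin.lt_def] at h ⊢; omega
      exact tensorOp_rMatrix_commute (m := 0) l hne
        (by simp [not_lt.2 h.le, h.ne', actK_zero])
        (by simp [not_lt.2 h2.le, h2.ne', actK_zero])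
    · exact absurd h hi.2
    · have h2 : b < i := by
        rw [Fin.lt_def] at h ⊢
        have : (i : ℕ) ≠ b := fun e => hi.1 (Fin.ext e)
        omega
      exact tensorOp_rMatrix_commute (m := -1) l hne (by simp [h]) (by simp [h2])

/-! ### The braid group and its representations -/

/-- The defining relations of the braid group: the generator `σ_{i+1}` is indexed by
`i : Fin (n - 1)`. -/
def braidRels (n : ℕ) : Set (FreeGroup (Fin (n - 1))) :=
  {r | (∃ i j : Fin (n - 1), (i : ℕ) + 1 = j ∧ r =
      FreeGroup.of i * FreeGroup.of j * FreeGroup.of i *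
        (FreeGroup.of j * FreeGroup.of i * FreeGroup.of j)⁻¹) ∨
    (∃ i j : Fin (n - 1), (i : ℕ) + 2 ≤ j ∧ r =
      FreeGroup.of i * FreeGroup.of j * (FreeGroup.of j * FreeGroup.of i)⁻¹)}

/-- The braid group `B_n` on `n` strands, through Artin's presentation. -/
abbrev BraidGroup (n : ℕ) : Type := PresentedGroup (braidRels n)

/-- The operator `id ⊗ ⋯ ⊗ R ⊗ ⋯ ⊗ id` on `U_N(l)^{⊗n}`, with `R` on the neighbouring factors
`i` and `i + 1` (counted from `0`). -/
def braidGen (N : ℕ) (l : ℂ) (n : ℕ) (i : Fin (n - 1)) :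
    Matrix (Fin n → Fin N) (Fin n → Fin N) ℂ :=
  atSites ⟨i, by omega⟩ ⟨i + 1, by omega⟩ (rMatrix N l)

theorem isUnit_braidGen {N : ℕ} (hN : 2 ≤ N) (l : ℂ) (n : ℕ) (i : Fin (n - 1)) :
    IsUnit (braidGen N l n i) :=
  isUnit_atSites_rMatrix hN l (by simp [Fin.ext_iff])

/-- The braid group representation `φ : B_n → GL(U_N(l)^{⊗n})`,
`φ(σ_i) = id^{⊗(i-1)} ⊗ R ⊗ id^{⊗(n-1-i)}`. -/
def braidRep {N : ℕ} (hN : 2 ≤ N) (l : ℂ) (n : ℕ) :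
    BraidGroup n →* Matrix.GeneralLinearGroup (Fin n → Fin N) ℂ :=
  PresentedGroup.toGroup (f := fun i => (isUnit_braidGen hN l n i).unit) (by
    rintro r (⟨i, j, hij, rfl⟩ | ⟨i, j, hij, rfl⟩)
    · simp only [map_mul, map_inv, FreeGroup.lift_apply_of]
      rw [mul_inv_eq_one]
      apply Units.ext
      have hj : (⟨j, by omega⟩ : Fin n) = ⟨i + 1, by omega⟩ := Fin.ext hij.symm
      simp only [Units.val_mul, IsUnit.unit_spec, braidGen, hj]
      exact braid_relation hN l (by simp [Fin.ext_iff]) (by simp [Fin.ext_iff]; omega)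
        (by simp [Fin.ext_iff]; omega)
    · simp only [map_mul, map_inv, FreeGroup.lift_apply_of]
      rw [mul_inv_eq_one]
      apply Units.ext
      simp only [Units.val_mul, IsUnit.unit_spec, braidGen]
      exact far_commute l (by simp [Fin.ext_iff]) (by simp [Fin.ext_iff])
        (by simp [Fin.ext_iff]; omega) (by simp [Fin.ext_iff]; omega)
        (by simp [Fin.ext_iff]; omega) (by simp [Fin.ext_iff]; omega))

theorem braidRep_of {N : ℕ} (hN : 2 ≤ N) (l : ℂ) (n : ℕ) (i : Fin (n - 1)) :
    (braidRep hN l n (PresentedGroup.of i) : Matrix (Fin n → Fin N) (Fin n → Fin N) ℂ) =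
      braidGen N l n i := by
  rw [braidRep, PresentedGroup.toGroup.of]
  rfl

theorem braidRep_commute {N : ℕ} (hN : 2 ≤ N) (l : ℂ) (n : ℕ)
    {X : Matrix (Fin n → Fin N) (Fin n → Fin N) ℂ} (hX : ∀ i, Commute X (braidGen N l n i))
    (β : BraidGroup n) :
    Commute X (braidRep hN l n β : Matrix (Fin n → Fin N) (Fin n → Fin N) ℂ) := by
  have hβ : β ∈ Subgroup.closure (Set.range (PresentedGroup.of (rels := braidRels n))) := by
    rw [PresentedGroup.closure_range_of]
    trivial
  induction hβ using Subgroup.closure_induction with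
  | mem x hx =>
    obtain ⟨i, rfl⟩ := hx
    rw [braidRep_of]
    exact hX i
  | one => rw [map_one]; exact Commute.one_right X
  | mul x y _ _ hx hy => rw [map_mul]; exact hx.mul_right hy
  | inv x _ hx => rw [map_inv]; exact hx.units_inv_right

/-- The intertwiner space `T_k = Hom(U_N(nl - 2k), U_N(l)^{⊗n})`: the linear maps that commute
with the actions of `E`, `F` and `K`. -/
def intertwiner (N : ℕ) (l : ℂ) (n k : ℕ) :
    Submodule ℂ (Matrix (Fin n → Fin N) (Fin N) ℂ) where
  carrier := {X | totE N l n * X = X * actE N (n * l - 2 * k) ∧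
    totF N l n * X = X * actF N ∧ totK N l n * X = X * actK N (n * l - 2 * k) 1}
  add_mem' := by
    rintro X Y ⟨h1, h2, h3⟩ ⟨h1', h2', h3'⟩
    simp only [Set.mem_ofPred_eq, Matrix.mul_add, Matrix.add_mul, h1, h2, h3, h1', h2', h3',
      and_self]
  zero_mem' := by simp
  smul_mem' := by
    rintro c X ⟨h1, h2, h3⟩
    simp only [Set.mem_ofPred_eq, Matrix.mul_smul, Matrix.smul_mul, h1, h2, h3, and_self]

theorem braidRep_mul_mem {N : ℕ} (hN : 2 ≤ N) (l : ℂ) (n k : ℕ) (β : BraidGroup n)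
    {X : Matrix (Fin n → Fin N) (Fin N) ℂ} (hX : X ∈ intertwiner N l n k) :
    (braidRep hN l n β : Matrix (Fin n → Fin N) (Fin n → Fin N) ℂ) * X ∈
      intertwiner N l n k := by
  obtain ⟨h1, h2, h3⟩ := hX
  have c1 := braidRep_commute hN l n (X := totE N l n) (fun i => totE_commute hN l rfl) β
  have c2 := braidRep_commute hN l n (X := totF N l n) (fun i => totF_commute hN l rfl) β
  have c3 := braidRep_commute hN l n (X := totK N l n)
    (fun i => totK_commute l (by simp [Fin.ext_iff])) β
  refine ⟨?_, ?_, ?_⟩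
  · rw [← Matrix.mul_assoc, c1.eq, Matrix.mul_assoc, h1, Matrix.mul_assoc]
  · rw [← Matrix.mul_assoc, c2.eq, Matrix.mul_assoc, h2, Matrix.mul_assoc]
  · rw [← Matrix.mul_assoc, c3.eq, Matrix.mul_assoc, h3, Matrix.mul_assoc]

/-- The braid group representation on `T_k`, by composition with `φ(β)`. -/
def intertwinerRep {N : ℕ} (hN : 2 ≤ N) (l : ℂ) (n k : ℕ) :
    Representation ℂ (BraidGroup n) (intertwiner N l n k) where
  toFun β :=
    { toFun := fun X => ⟨(braidRep hN l n β : Matrix (Fin n → Fin N) (Fin n → Fin N) ℂ) * X.1,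
        braidRep_mul_mem hN l n k β X.2⟩
      map_add' := fun X Y => Subtype.ext (Matrix.mul_add _ _ _)
      map_smul' := fun c X => Subtype.ext (Matrix.mul_smul _ _ _) }
  map_one' := by
    ext X : 2
    simp
  map_mul' β γ := by
    ext X : 2
    simp [Matrix.mul_assoc]

/-- The canonical map `⨁_k T_k ⊗ U_N(nl - 2k) → U_N(l)^{⊗n}`, `X ⊗ v ↦ X v`. -/
def decompMap (N : ℕ) (l : ℂ) (n : ℕ) :
    ((k : Fin N) → TensorProduct ℂ (intertwiner N l n k) (Fin N → ℂ)) →ₗ[ℂ]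
      ((Fin n → Fin N) → ℂ) :=
  ∑ k : Fin N, (TensorProduct.lift
    ((Matrix.toLin' (R := ℂ) (m := Fin n → Fin N) (n := Fin N)).toLinearMap ∘ₗ
      (intertwiner N l n k).subtype)) ∘ₗ LinearMap.proj k

/-- The partial trace `tr_{2,…,n} : End(U_N(l)^{⊗n}) → End(U_N(l))`, over all tensor factors but
the first: the coefficient of `v_a` in the image of `v_b` is the sum over `e_2, …, e_n` of the
coefficients of `v_a ⊗ v_{e_2} ⊗ ⋯ ⊗ v_{e_n}` in the image of `v_b ⊗ v_{e_2} ⊗ ⋯ ⊗ v_{e_n}`. -/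
def partialTrace {N n : ℕ} [NeZero n] (A : Matrix (Fin n → Fin N) (Fin n → Fin N) ℂ) :
    Matrix (Fin N) (Fin N) ℂ :=
  Matrix.of fun a b => ∑ e with e 0 = b, A (Function.update e 0 a) e

/-- The operator `id ⊗ h^{⊗(n-1)}` on `U_N(l)^{⊗n}`, with `h = K^{1-N}`. -/
def twistOp (N : ℕ) (l : ℂ) (n : ℕ) [NeZero n] : Matrix (Fin n → Fin N) (Fin n → Fin N) ℂ :=
  tensorOp fun j => if j = 0 then 1 else actK N l (1 - N)

/-- `l` is generic with respect to `ζ`. -/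
def IsGeneric (N : ℕ) (l : ℂ) : Prop := ∀ i : ℤ, qInt N (l - i) ≠ 0

end
end ColoredAlexander

/-!
Write `V = U_N(l)`, `W = V^{⊗m}` and `n = m + 1`, so that `V^{⊗n} = V ⊗ W`.

*The decomposition.* A vector `p` with `E p = 0` and `K p = ζ^(nl-2k) p` gives the intertwiner
`v_j ↦ F^j p / [j]!` (`exists_intertwiner`), because `E^N = F^N = 0` on every tensor power
(`add_pow_of_skew_commute`: the mixed terms of the `q`-binomial formula contain `[N] = 0`). As
`E^j` maps `v_j ∈ U_N(nl-2k)` to a nonzero multiple of `v_0`, applying powers of `E` reduces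
injectivity of the canonical map to the separation of the eigenvalues of `K`, and surjectivity to
the decomposition of `ker E` into eigenspaces of `K`
(`decompMap_injective`, `decompMap_surjective`).

*The partial trace.* The operator `A = φ(β)` commutes with `K` and `F`, and so does its twisted
partial trace, which is therefore a scalar (`twistedTrace_of_ne`, `twistedTrace_succ`). To find the
scalar, write `A = ∑ (A X) Y` with intertwiners `X : U_N(nl-2k) → V ⊗ W` that run through bases of
the spaces `T_k` and dual intertwiners `Y` (`sum_mul_intertwinerCoord`). Everything then follows
from a cyclicity property (`trace_contract_intertwiners`): for intertwiners `X : U_N(m) → V ⊗ W`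
and `Y : V ⊗ W → U_N(m)`, the entry at `v_0` of the twisted partial trace of `X Y` is
`[l; N-1] / [m; N-1]` times the entry at `v_0` of `Y X`.

Proof of the cyclicity. The identity of `U_N(m)` is `∑_i F^i e F^{N-1-i} / [N-1]!`, where `e` sends
`v_{N-1}` to `v_0` and the other basis vectors to `0` (`sum_actF_pow_raise`). The operators `F^i` can
be moved through `X`, around the trace over `W`, and to the right of the inclusion `w ↦ v_0 ⊗ w`;
by the factorization of `x^N - y^N` the resulting sum turns this inclusion into `w ↦ v_{N-1} ⊗ w`
(`sum_tensF_pow_mul_tensorVec`). Finally `E^{N-1} = [m; N-1] e` on `U_N(m)`, so that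
`e` is moved through `Y` as a power of `E`, and
`p ↦ E^{N-1} (v_{N-1} ⊗ h v_0^*(p))` is `[l; N-1]` times the identity on the highest weight vectors
`p` of `V ⊗ W` (`tensE_pow_mulVec_of_highest`).
-/

namespace ColoredAlexander

noncomputable section

open scoped Kronecker TensorProduct

/-! ### Powers of `ζ` and quantum integers -/

theorem zetaPow_nat_mul (N k : ℕ) (a : ℂ) : zetaPow N (k * a) = zetaPow N a ^ k := by
  rw [zetaPow, zetaPow, ← Complex.exp_nat_mul]
  congr 1
  ring

theorem zetaPow_two_isPrimitiveRoot {N : ℕ} (hN : 2 ≤ N) : IsPrimitiveRoot (zetaPow N 2) N := by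
  have h := Complex.isPrimitiveRoot_exp N (by omega)
  convert h using 1
  rw [zetaPow]
  congr 1
  ring

theorem zetaPow_sub_two_mul_eq_iff {N : ℕ} (hN : 2 ≤ N) (a : ℂ) {i j : ℕ} (hi : i < N)
    (hj : j < N) : zetaPow N (a - 2 * i) = zetaPow N (a - 2 * j) ↔ i = j := by
  refine ⟨fun h => ?_, fun h => by rw [h]⟩
  refine (zetaPow_two_isPrimitiveRoot hN).pow_inj hi hj ?_
  have e1 : zetaPow N (a - 2 * i) * zetaPow N (2 * i) = zetaPow N a := by
    rw [← zetaPow_add]; congr 1; ring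
  have e2 : zetaPow N (a - 2 * j) * zetaPow N (2 * j) = zetaPow N a := by
    rw [← zetaPow_add]; congr 1; ring
  rw [← e2, h] at e1
  have := mul_left_cancel₀ (zetaPow_ne_zero N _) e1
  rwa [mul_comm, mul_comm (2 : ℂ) (j : ℂ), zetaPow_nat_mul, zetaPow_nat_mul] at this

theorem qFall_succ (N : ℕ) (a : ℂ) (i : ℕ) :
    qFall N a (i + 1) = qFall N a i * qInt N (a - i) := by
  rw [qFall, Finset.prod_range_succ, qFall]

theorem qFall_ne_zero_of_le {N : ℕ} {a : ℂ} {i k : ℕ} (h : qFall N a k ≠ 0) (hik : i ≤ k) :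
    qFall N a i ≠ 0 := by
  rw [qFall, Finset.prod_ne_zero_iff] at h ⊢
  exact fun j hj => h j (Finset.mem_range.2 ((Finset.mem_range.1 hj).trans_le hik))

theorem qFall_self_ne_zero {N : ℕ} (hN : 2 ≤ N) {k : ℕ} (hk : k < N) : qFall N k k ≠ 0 := by
  induction k with
  | zero => simp [qFall]
  | succ k ih =>
    rw [qFall_succ_self]
    refine mul_ne_zero ?_ (ih (by omega))
    exact_mod_cast qInt_ne_zero hN (Nat.succ_pos k) hk

theorem rCoeff_ne_zero {N : ℕ} (hN : 2 ≤ N) {k : ℕ} (hk : k < N) : rCoeff N k ≠ 0 :=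
  div_ne_zero (mul_ne_zero (zetaPow_ne_zero N _) (pow_ne_zero _ (zeta_sub_ne_zero hN)))
    (qFall_self_ne_zero hN hk)

/-! ### Two identities at a root of unity -/

/-- In the `q`-binomial expansion of `(x + y) ^ N` all mixed terms carry the factor
`[N]_ζ = 0`. -/
theorem add_pow_of_skew_commute {N : ℕ} (hN : 2 ≤ N) {A : Type*} [Ring A] [Algebra ℂ A] {x y : A}
    (h : y * x = zetaPow N (-2) • (x * y)) : (x + y) ^ N = x ^ N + y ^ N := by
  obtain ⟨M, rfl⟩ : ∃ M, N = M + 1 := ⟨N - 1, by omega⟩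
  have hM : rCoeff (M + 1) M ≠ 0 := rCoeff_ne_zero hN (Nat.lt_succ_self M)
  refine smul_right_injective A hM ?_
  simp only
  rw [pow_succ', ← mul_smul_comm, qbinom hN h M (Nat.lt_succ_self M), add_mul, Finset.mul_sum,
    Finset.mul_sum]
  -- `x * (x^a y^(b+1))` and `y * (x^(a+1) y^b)` contribute to the same monomial and cancel.
  have key : ∀ a b : ℕ, a + b + 1 = M →
      (rCoeff (M + 1) a * rCoeff (M + 1) (b + 1)) +
        zetaPow (M + 1) (-2 * (a + 1)) * (rCoeff (M + 1) (a + 1) * rCoeff (M + 1) b) = 0 := by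
    intro a b hab
    have ha : qInt (M + 1) ((a : ℂ) + 1) ≠ 0 := by
      exact_mod_cast qInt_ne_zero hN (Nat.succ_pos a) (by omega)
    have hb : qInt (M + 1) ((b : ℂ) + 1) ≠ 0 := by
      exact_mod_cast qInt_ne_zero hN (Nat.succ_pos b) (by omega)
    have ra := rCoeff_succ hN (k := a) (by omega)
    have rb := rCoeff_succ hN (k := b) (by omega)
    have hz := qInt_add (M + 1) ((a : ℂ) + 1) ((b : ℂ) + 1)
    have hs : (a : ℂ) + 1 + (b + 1) = ((M + 1 : ℕ) : ℂ) := by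
      exact_mod_cast (by omega : a + 1 + (b + 1) = M + 1)
    rw [hs, qInt_self hN] at hz
    refine (mul_eq_zero.1 (?_ : (qInt (M + 1) ((a : ℂ) + 1) * qInt (M + 1) ((b : ℂ) + 1)) * _ = 0)
      ).resolve_left (mul_ne_zero ha hb)
    have z1 : zetaPow (M + 1) b = zetaPow (M + 1) (-1) * zetaPow (M + 1) (b + 1) := by
      rw [← zetaPow_add]; congr 1; ring
    have z2 : zetaPow (M + 1) (-2 * (a + 1)) * zetaPow (M + 1) a =
        zetaPow (M + 1) (-1) * zetaPow (M + 1) (-(a + 1)) := by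
      rw [← zetaPow_add, ← zetaPow_add]; congr 1; ring
    calc _ = qInt (M + 1) ((a : ℂ) + 1) * rCoeff (M + 1) a *
          (qInt (M + 1) ((b : ℂ) + 1) * rCoeff (M + 1) (b + 1)) +
          zetaPow (M + 1) (-2 * (a + 1)) * (qInt (M + 1) ((a : ℂ) + 1) * rCoeff (M + 1) (a + 1)) *
            (qInt (M + 1) ((b : ℂ) + 1) * rCoeff (M + 1) b) := by ring
      _ = 0 := by
        rw [ra, rb, z1]
        linear_combination (rCoeff (M + 1) a * rCoeff (M + 1) b *
          (zetaPow (M + 1) 1 - zetaPow (M + 1) (-1)) * qInt (M + 1) (b + 1)) * z2 -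
          (rCoeff (M + 1) a * rCoeff (M + 1) b * (zetaPow (M + 1) 1 - zetaPow (M + 1) (-1)) *
          zetaPow (M + 1) (-1)) * hz
  have t1 : ∀ p : ℕ × ℕ, x * (rCoeff (M + 1) p.1 * rCoeff (M + 1) p.2) • (x ^ p.1 * y ^ p.2) =
      (rCoeff (M + 1) p.1 * rCoeff (M + 1) p.2) • (x ^ (p.1 + 1) * y ^ p.2) := by
    intro p
    rw [mul_smul_comm, ← mul_assoc, ← pow_succ']
  have t2 : ∀ p : ℕ × ℕ, y * (rCoeff (M + 1) p.1 * rCoeff (M + 1) p.2) • (x ^ p.1 * y ^ p.2) =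
      (zetaPow (M + 1) (-2 * p.1) * (rCoeff (M + 1) p.1 * rCoeff (M + 1) p.2)) •
        (x ^ p.1 * y ^ (p.2 + 1)) := by
    intro p
    rw [mul_smul_comm, ← mul_assoc, comm_pow h, smul_mul_assoc, mul_assoc, ← pow_succ', smul_smul,
      mul_comm (zetaPow _ _)]
  simp only [t1, t2]
  obtain ⟨m, rfl⟩ : ∃ m, M = m + 1 := ⟨M - 1, by omega⟩
  rw [Finset.Nat.sum_antidiagonal_succ', Finset.Nat.sum_antidiagonal_succ]
  have hc : (∑ p ∈ Finset.HasAntidiagonal.antidiagonal m,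
      (rCoeff (m + 1 + 1) p.1 * rCoeff (m + 1 + 1) (p.2 + 1)) • (x ^ (p.1 + 1) * y ^ (p.2 + 1))) +
      ∑ p ∈ Finset.HasAntidiagonal.antidiagonal m, (zetaPow (m + 1 + 1) (-2 * (p.1 + 1 : ℕ)) *
        (rCoeff (m + 1 + 1) (p.1 + 1) * rCoeff (m + 1 + 1) p.2)) •
        (x ^ (p.1 + 1) * y ^ (p.2 + 1)) = 0 := by
    rw [← Finset.sum_add_distrib]
    refine Finset.sum_eq_zero fun p hp => ?_
    rw [Finset.HasAntidiagonal.mem_antidiagonal] at hp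
    rw [← add_smul]
    push_cast
    rw [key p.1 p.2 (by omega), zero_smul]
  rw [add_add_add_comm, hc, add_zero, smul_add]
  simp [rCoeff_zero, zetaPow_zero]

/-- The numbers `ζ^(a + 2j)` for `j < N` are the roots of `X ^ N - ζ^(Na)`; the product over all
of them but the last is a geometric sum. -/
theorem prod_sub_smul_eq_geom_sum {N : ℕ} (hN : 2 ≤ N) {B : Type*} [CommRing B] [Algebra ℂ B]
    (a : ℂ) (x y : B) :
    ∏ j ∈ Finset.range (N - 1), (x - zetaPow N (a + 2 * j) • y) =
      ∑ i ∈ Finset.range N, x ^ i * (zetaPow N (a - 2) • y) ^ (N - 1 - i) := by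
  open Polynomial in
  have h : ∏ j ∈ Finset.range (N - 1), ((X : ℂ[X][X]) - C (zetaPow N (a + 2 * j) • X)) =
      ∑ i ∈ Finset.range N, X ^ i * (C (zetaPow N (a - 2) • (X : ℂ[X]))) ^ (N - 1 - i) := by
    have hl : zetaPow N (a + 2 * (N - 1 : ℕ)) = zetaPow N (a - 2) := by
      rw [Nat.cast_sub (by omega), Nat.cast_one,
        show a + 2 * ((N : ℂ) - 1) = (a - 2) + 2 * N by ring, zetaPow_add,
        zetaPow_two_mul_self hN, mul_one]
    have hω : IsPrimitiveRoot (C (zetaPow N 2) : ℂ[X]) N :=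
      (zetaPow_two_isPrimitiveRoot hN).map_of_injective (C_injective (R := ℂ))
    have hp := X_pow_sub_C_eq_prod hω (α := zetaPow N a • (X : ℂ[X])) (by omega) rfl
    have hr : ∀ j : ℕ, (C (zetaPow N 2) : ℂ[X]) ^ j * (zetaPow N a • X) =
        zetaPow N (a + 2 * j) • X := by
      intro j
      rw [← C_pow, ← smul_eq_C_mul, smul_smul, ← zetaPow_nat_mul, ← zetaPow_add]
      congr 2
      ring
    have he : (zetaPow N a • (X : ℂ[X])) ^ N = (zetaPow N (a - 2) • X) ^ N := by
      rw [_root_.smul_pow, _root_.smul_pow, ← zetaPow_nat_mul, ← zetaPow_nat_mul]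
      congr 1
      rw [show (N : ℂ) * a = N * (a - 2) + 2 * N by ring, zetaPow_add, zetaPow_two_mul_self hN,
        mul_one]
    obtain ⟨M, rfl⟩ : ∃ M, N = M + 1 := ⟨N - 1, by omega⟩
    simp only [hr] at hp
    rw [he, C_pow, ← Commute.geom_sum₂_mul (Commute.all _ _), Finset.prod_range_succ] at hp
    rw [Nat.add_sub_cancel] at hl ⊢
    rw [hl] at hp
    exact (mul_right_cancel₀ (X_sub_C_ne_zero _) hp).symm
  have h2 := congrArg (Polynomial.eval₂ (Polynomial.aeval (R := ℂ) y).toRingHom x) h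
  simpa only [Polynomial.eval₂_mul, Polynomial.eval₂_sub, Polynomial.eval₂_X, Polynomial.eval₂_C,
    AlgHom.toRingHom_eq_coe, RingHom.coe_coe, map_smul, Polynomial.aeval_X,
    Polynomial.eval₂_finsetProd, Polynomial.eval₂_finsetSum,
    Polynomial.eval₂_pow] using h2

/-! ### Finite-dimensional modules over quantum `sl_2` -/

/-- The matrices `E`, `F`, `K`, `L` define an action of quantum `sl_2` in which `L` is the inverse
of `K` and `E ^ N = F ^ N = 0`. -/
structure IsQuantumModule (N : ℕ) {ι : Type*} [Fintype ι] [DecidableEq ι]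
    (E F K L : Matrix ι ι ℂ) : Prop where
  K_mul_L : K * L = 1
  K_mul_E : K * E = zetaPow N 2 • (E * K)
  K_mul_F : K * F = zetaPow N (-2) • (F * K)
  E_mul_F : E * F - F * E = (zetaPow N 1 - zetaPow N (-1))⁻¹ • (K - L)
  E_pow : E ^ N = 0
  F_pow : F ^ N = 0

theorem smul_zetaPow_eq_iff {N : ℕ} {M : Type*} [AddCommGroup M] [Module ℂ M] (a : ℂ) (x y : M) :
    x = zetaPow N a • y ↔ y = zetaPow N (-a) • x := by
  constructor
  · rintro rfl
    rw [smul_smul, ← zetaPow_add, neg_add_cancel, zetaPow_zero, one_smul]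
  · rintro rfl
    rw [smul_smul, ← zetaPow_add, add_neg_cancel, zetaPow_zero, one_smul]

namespace IsQuantumModule

variable {N : ℕ} {ι : Type*} [Fintype ι] [DecidableEq ι] {E F K L : Matrix ι ι ℂ}

theorem L_mul_K (h : IsQuantumModule N E F K L) : L * K = 1 :=
  mul_eq_one_comm.1 h.K_mul_L

theorem L_mul_E (h : IsQuantumModule N E F K L) : L * E = zetaPow N (-2) • (E * L) := by
  have h1 : L * (K * E) * L = zetaPow N 2 • (L * (E * K) * L) := by
    rw [h.K_mul_E, mul_smul_comm, smul_mul_assoc]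
  rw [← mul_assoc, h.L_mul_K, one_mul, mul_assoc, mul_assoc, h.K_mul_L, mul_one] at h1
  exact (smul_zetaPow_eq_iff 2 _ _).1 h1

theorem L_mul_F (h : IsQuantumModule N E F K L) : L * F = zetaPow N 2 • (F * L) := by
  have h1 : L * (K * F) * L = zetaPow N (-2) • (L * (F * K) * L) := by
    rw [h.K_mul_F, mul_smul_comm, smul_mul_assoc]
  rw [← mul_assoc, h.L_mul_K, one_mul, mul_assoc, mul_assoc, h.K_mul_L, mul_one] at h1
  simpa using (smul_zetaPow_eq_iff (-2) _ _).1 h1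

theorem reindex {κ : Type*} [Fintype κ] [DecidableEq κ] (h : IsQuantumModule N E F K L)
    (e : κ ≃ ι) : IsQuantumModule N (E.submatrix e e) (F.submatrix e e) (K.submatrix e e)
      (L.submatrix e e) := by
  have hp : ∀ (X : Matrix ι ι ℂ) (k : ℕ), X.submatrix e e ^ k = (X ^ k).submatrix e e := by
    intro X k
    induction k with
    | zero => simp
    | succ k ih => rw [pow_succ, pow_succ, ih, Matrix.submatrix_mul_equiv]
  refine ⟨?_, ?_, ?_, ?_, ?_, ?_⟩
  · rw [Matrix.submatrix_mul_equiv, h.K_mul_L, Matrix.submatrix_one_equiv]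
  · rw [Matrix.submatrix_mul_equiv, Matrix.submatrix_mul_equiv, h.K_mul_E]; rfl
  · rw [Matrix.submatrix_mul_equiv, Matrix.submatrix_mul_equiv, h.K_mul_F]; rfl
  · rw [Matrix.submatrix_mul_equiv, Matrix.submatrix_mul_equiv]
    exact congrArg (fun X : Matrix ι ι ℂ => X.submatrix e e) h.E_mul_F
  · rw [hp, h.E_pow]; rfl
  · rw [hp, h.F_pow]; rfl

/-- The tensor product of two modules, for the coproduct `Δ(E) = 1 ⊗ E + E ⊗ K`,
`Δ(F) = K⁻¹ ⊗ F + F ⊗ 1`, `Δ(K) = K ⊗ K`. -/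
theorem kronecker (hN : 2 ≤ N) {κ : Type*} [Fintype κ] [DecidableEq κ]
    {E' F' K' L' : Matrix κ κ ℂ} (h : IsQuantumModule N E F K L)
    (h' : IsQuantumModule N E' F' K' L') :
    IsQuantumModule N (1 ⊗ₖ E' + E ⊗ₖ K') (L ⊗ₖ F' + F ⊗ₖ 1) (K ⊗ₖ K') (L ⊗ₖ L') := by
  have hp : ∀ (X : Matrix ι ι ℂ) (Y : Matrix κ κ ℂ) (k : ℕ), (X ⊗ₖ Y) ^ k = (X ^ k) ⊗ₖ (Y ^ k) := by
    intro X Y k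
    induction k with
    | zero => simp
    | succ k ih => rw [pow_succ, pow_succ, pow_succ, ih, Matrix.mul_kronecker_mul]
  have hN0 : N ≠ 0 := by omega
  refine ⟨?_, ?_, ?_, ?_, ?_, ?_⟩
  · rw [← Matrix.mul_kronecker_mul, h.K_mul_L, h'.K_mul_L, Matrix.one_kronecker_one]
  · simp only [mul_add, add_mul, ← Matrix.mul_kronecker_mul, h.K_mul_E, h'.K_mul_E, mul_one,
      one_mul, Matrix.kronecker_smul, Matrix.smul_kronecker, smul_add]
  · have hc : L * K = K * L := h.L_mul_K.trans h.K_mul_L.symm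
    simp only [mul_add, add_mul, ← Matrix.mul_kronecker_mul, h.K_mul_F, h'.K_mul_F, mul_one,
      one_mul, Matrix.kronecker_smul, Matrix.smul_kronecker, smul_add, hc]
  · have e1 : (E * L) ⊗ₖ (K' * F') = (L * E) ⊗ₖ (F' * K') := by
      rw [h'.K_mul_F, h.L_mul_E, Matrix.kronecker_smul, Matrix.smul_kronecker]
    have e2 : E' * F' = F' * E' + (zetaPow N 1 - zetaPow N (-1))⁻¹ • (K' - L') := by
      rw [← h'.E_mul_F]; abel
    have e3 : E * F = F * E + (zetaPow N 1 - zetaPow N (-1))⁻¹ • (K - L) := by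
      rw [← h.E_mul_F]; abel
    simp only [mul_add, add_mul, ← Matrix.mul_kronecker_mul, mul_one, one_mul, e1, e2, e3,
      Matrix.kronecker_add, Matrix.add_kronecker, Matrix.kronecker_smul, Matrix.smul_kronecker,
      sub_eq_add_neg, smul_add, Matrix.kronecker_add, Matrix.add_kronecker]
    have n1 : L ⊗ₖ (-L') = -(L ⊗ₖ L') := by ext; simp
    have n2 : (-L) ⊗ₖ K' = -(L ⊗ₖ K') := by ext; simp
    rw [n1, n2, smul_neg, smul_neg]
    abel
  · rw [add_comm, add_pow_of_skew_commute hN, hp, hp, h.E_pow, h'.E_pow, Matrix.kronecker_zero,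
      Matrix.zero_kronecker, add_zero]
    rw [← Matrix.mul_kronecker_mul, ← Matrix.mul_kronecker_mul, h'.K_mul_E, one_mul, mul_one,
      Matrix.kronecker_smul, smul_smul, ← zetaPow_add, neg_add_cancel, zetaPow_zero, one_smul]
  · rw [add_pow_of_skew_commute hN, hp, hp, h.F_pow, h'.F_pow, Matrix.kronecker_zero,
      Matrix.zero_kronecker, add_zero]
    rw [← Matrix.mul_kronecker_mul, ← Matrix.mul_kronecker_mul, h.L_mul_F, one_mul, mul_one,
      Matrix.smul_kronecker, smul_smul, ← zetaPow_add, neg_add_cancel, zetaPow_zero, one_smul]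

end IsQuantumModule

theorem isQuantumModule_act {N : ℕ} (hN : 2 ≤ N) (l : ℂ) :
    IsQuantumModule N (actE N l) (actF N) (actK N l 1) (actK N l (-1)) where
  K_mul_L := by rw [actK_mul, add_neg_cancel, actK_zero]
  K_mul_E := by simpa using actK_mul_actE N l 1
  K_mul_F := by simpa using actK_mul_actF N l 1
  E_mul_F := actE_mul_actF hN l
  E_pow := actE_pow N l
  F_pow := actF_pow N

/-! ### Tensor powers -/

/-- The identification of `U_N(l) ⊗ U_N(l)^{⊗m}` with `U_N(l)^{⊗(m+1)}` on indices of basis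
vectors. -/
abbrev consIndex (N m : ℕ) : Fin N × (Fin m → Fin N) ≃ (Fin (m + 1) → Fin N) :=
  Fin.consEquiv fun _ => Fin N

theorem tensorOp_submatrix {N m : ℕ} (M : Fin (m + 1) → Matrix (Fin N) (Fin N) ℂ) :
    (tensorOp M).submatrix (consIndex N m) (consIndex N m) =
      M 0 ⊗ₖ tensorOp fun j => M j.succ := by
  ext ⟨a, e⟩ ⟨b, e'⟩
  simp [tensorOp, Fin.prod_univ_succ, Fin.consEquiv]

theorem submatrix_finset_sum {α β γ δ σ : Type*} (s : Finset σ) (M : σ → Matrix α β ℂ) (f : γ → α)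
    (g : δ → β) : (∑ i ∈ s, M i).submatrix f g = ∑ i ∈ s, (M i).submatrix f g := by
  ext
  simp [Matrix.sum_apply]

theorem kronecker_finset_sum {α β γ δ σ : Type*} (s : Finset σ) (A : Matrix α β ℂ)
    (M : σ → Matrix γ δ ℂ) : A ⊗ₖ (∑ i ∈ s, M i) = ∑ i ∈ s, A ⊗ₖ M i := by
  ext
  simp [Matrix.sum_apply, Finset.mul_sum]

theorem totE_submatrix (N : ℕ) (l : ℂ) (m : ℕ) :
    (totE N l (m + 1)).submatrix (consIndex N m) (consIndex N m) =
      1 ⊗ₖ totE N l m + actE N l ⊗ₖ totK N l m := by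
  rw [totE, submatrix_finset_sum, Fin.sum_univ_succ, add_comm, totE, kronecker_finset_sum]
  congr 1
  · refine Finset.sum_congr rfl fun i _ => ?_
    rw [tensorOp_submatrix]
    simp
  · rw [tensorOp_submatrix]
    simp [totK]

theorem totF_submatrix (N : ℕ) (l : ℂ) (m : ℕ) :
    (totF N l (m + 1)).submatrix (consIndex N m) (consIndex N m) =
      actK N l (-1) ⊗ₖ totF N l m + actF N ⊗ₖ 1 := by
  rw [totF, submatrix_finset_sum, Fin.sum_univ_succ, add_comm, totF, kronecker_finset_sum]
  congr 1
  · refine Finset.sum_congr rfl fun i _ => ?_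
    rw [tensorOp_submatrix]
    simp
  · rw [tensorOp_submatrix, ← tensorOp_one]
    simp [Pi.one_def]

theorem totK_submatrix (N : ℕ) (l : ℂ) (m : ℕ) :
    (totK N l (m + 1)).submatrix (consIndex N m) (consIndex N m) =
      actK N l 1 ⊗ₖ totK N l m :=
  tensorOp_submatrix _

theorem isQuantumModule_tot {N : ℕ} (hN : 2 ≤ N) (l : ℂ) (n : ℕ) :
    IsQuantumModule N (totE N l n) (totF N l n) (totK N l n)
      (tensorOp fun _ => actK N l (-1)) := by
  induction n with
  | zero =>
    have h1 : ∀ M : Fin 0 → Matrix (Fin N) (Fin N) ℂ, tensorOp M = 1 := fun M => by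
      rw [← tensorOp_one, Subsingleton.elim M 1]
    have hE : totE N l 0 = 0 := by simp [totE]
    have hF : totF N l 0 = 0 := by simp [totF]
    have hN0 : N ≠ 0 := by omega
    constructor <;> simp [hE, hF, totK, h1, hN0]
  | succ m ih =>
    have h := ((isQuantumModule_act hN l).kronecker hN ih).reindex (consIndex N m).symm
    rw [← totE_submatrix, ← totF_submatrix, ← totK_submatrix,
      ← tensorOp_submatrix fun _ => actK N l (-1)] at h
    simpa using h

theorem totK_eq_diagonal (N : ℕ) (l : ℂ) (n : ℕ) :
    totK N l n =
      Matrix.diagonal fun e => zetaPow N (n * l - 2 * ((∑ j, (e j : ℕ) : ℕ) : ℂ)) := by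
  induction n with
  | zero =>
    rw [totK, Subsingleton.elim (fun _ => actK N l 1 : Fin 0 → _) 1, tensorOp_one]
    simp [zetaPow_zero]
  | succ m ih =>
    apply (Matrix.reindex (consIndex N m).symm (consIndex N m).symm).injective
    simp only [Matrix.reindex_apply, Equiv.symm_symm]
    rw [totK_submatrix, ih, actK, Matrix.diagonal_kronecker_diagonal, Matrix.submatrix_diagonal_equiv]
    congr 1
    ext ⟨a, e⟩
    simp only [Function.comp_apply, Fin.consEquiv, Equiv.coe_fn_mk, Fin.sum_univ_succ,
      Fin.cons_zero, Fin.cons_succ, ← zetaPow_add]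
    congr 1
    push_cast
    ring

/-! ### Basis vectors of `U_N(l)` -/

/-- The basis vector `v_i` of `U_N(l)`, with `v_i = 0` for `i ≥ N`. -/
def basisVec (N i : ℕ) : Fin N → ℂ := fun j => if (j : ℕ) = i then 1 else 0

theorem basisVec_eq_zero {N i : ℕ} (h : N ≤ i) : basisVec N i = 0 := by
  ext j
  exact if_neg (by omega)

theorem basisVec_eq_single {N : ℕ} (i : Fin N) : basisVec N i = Pi.single i 1 := by
  ext j
  simp [basisVec, Pi.single_apply, Fin.ext_iff]

theorem mulVec_basisVec {N : ℕ} {κ : Type*} (A : Matrix κ (Fin N) ℂ) (i : Fin N) :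
    A.mulVec (basisVec N i) = A.col i := by
  rw [basisVec_eq_single, Matrix.mulVec_single_one]

theorem basisVec_vecMul {N : ℕ} {κ : Type*} (A : Matrix (Fin N) κ ℂ) (i : Fin N) :
    Matrix.vecMul (basisVec N i) A = A.row i := by
  rw [basisVec_eq_single, Matrix.single_one_vecMul]

theorem matrix_ext_basisVec {N : ℕ} {κ : Type*} {A B : Matrix κ (Fin N) ℂ}
    (h : ∀ i < N, A.mulVec (basisVec N i) = B.mulVec (basisVec N i)) : A = B := by
  ext e i
  have := congrFun (h i i.2) e
  rwa [mulVec_basisVec, mulVec_basisVec] at this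

theorem actF_mulVec (N i : ℕ) :
    (actF N).mulVec (basisVec N i) = qInt N (i + 1) • basisVec N (i + 1) := by
  rcases lt_or_ge i N with h | h
  · ext j
    rw [mulVec_basisVec (actF N) ⟨i, h⟩]
    simp [actF, basisVec, Matrix.col]
  · rw [basisVec_eq_zero h, basisVec_eq_zero (by omega)]
    simp

theorem actE_mulVec {N : ℕ} (l : ℂ) {i : ℕ} (h : i + 1 < N) :
    (actE N l).mulVec (basisVec N (i + 1)) = qInt N (l - i) • basisVec N i := by
  ext j
  rw [mulVec_basisVec (actE N l) ⟨i + 1, h⟩]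
  simp [actE, basisVec, Matrix.col]

theorem actE_mulVec_zero {N : ℕ} (hN : 2 ≤ N) (l : ℂ) :
    (actE N l).mulVec (basisVec N 0) = 0 := by
  ext j
  rw [mulVec_basisVec (actE N l) ⟨0, by omega⟩]
  simp [actE, Matrix.col]

theorem actK_mulVec (N : ℕ) (l : ℂ) (m : ℤ) (i : ℕ) :
    (actK N l m).mulVec (basisVec N i) = zetaPow N (m * (l - 2 * i)) • basisVec N i := by
  ext j
  rw [actK, Matrix.mulVec_diagonal]
  by_cases h : (j : ℕ) = i
  · simp [h]
  · simp [h, basisVec]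

theorem vecMul_actF {N i : ℕ} (h : i + 1 < N) :
    Matrix.vecMul (basisVec N (i + 1)) (actF N) = qInt N (i + 1) • basisVec N i := by
  ext j
  rw [basisVec_vecMul (actF N) ⟨i + 1, h⟩]
  by_cases hj : (j : ℕ) = i
  · simp [actF, basisVec, Matrix.row, hj]
  · simp [actF, basisVec, Matrix.row, hj, Ne.symm hj]

theorem vecMul_actF_zero {N : ℕ} (hN : 2 ≤ N) :
    Matrix.vecMul (basisVec N 0) (actF N) = 0 := by
  ext j
  rw [basisVec_vecMul (actF N) ⟨0, by omega⟩]
  simp [actF, Matrix.row]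

theorem vecMul_actE (N : ℕ) (l : ℂ) (i : ℕ) :
    Matrix.vecMul (basisVec N i) (actE N l) = qInt N (l - i) • basisVec N (i + 1) := by
  rcases lt_or_ge i N with h | h
  · ext j
    rw [basisVec_vecMul (actE N l) ⟨i, h⟩]
    by_cases hj : (j : ℕ) = i + 1
    · simp [actE, basisVec, Matrix.row, hj]
    · simp [actE, basisVec, Matrix.row, hj, Ne.symm hj]
  · rw [basisVec_eq_zero h, basisVec_eq_zero (by omega)]
    simp

theorem vecMul_actK (N : ℕ) (l : ℂ) (m : ℤ) (i : ℕ) :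
    Matrix.vecMul (basisVec N i) (actK N l m) = zetaPow N (m * (l - 2 * i)) • basisVec N i := by
  ext j
  rw [actK, Matrix.vecMul_diagonal]
  by_cases h : (j : ℕ) = i
  · simp [h, mul_comm]
  · simp [h, basisVec]

theorem actF_pow_mulVec_zero (N i : ℕ) :
    (actF N ^ i).mulVec (basisVec N 0) = qFall N i i • basisVec N i := by
  induction i with
  | zero => simp [qFall]
  | succ i ih =>
    rw [pow_succ', ← Matrix.mulVec_mulVec, ih, Matrix.mulVec_smul, actF_mulVec, smul_smul,
      qFall_succ_self, mul_comm]

theorem actE_pow_mulVec {N : ℕ} (l : ℂ) {i : ℕ} (h : i < N) :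
    (actE N l ^ i).mulVec (basisVec N i) = qFall N l i • basisVec N 0 := by
  induction i with
  | zero => simp [qFall]
  | succ i ih =>
    rw [pow_succ, ← Matrix.mulVec_mulVec, actE_mulVec l h, Matrix.mulVec_smul, ih (by omega),
      smul_smul, qFall_succ, mul_comm]

theorem actE_pow_mulVec_of_lt {N : ℕ} (hN : 2 ≤ N) (l : ℂ) {i k : ℕ} (hi : i < N) (h : i < k) :
    (actE N l ^ k).mulVec (basisVec N i) = 0 := by
  obtain ⟨d, rfl⟩ : ∃ d, k = d + 1 + i := ⟨k - i - 1, by omega⟩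
  rw [pow_add, ← Matrix.mulVec_mulVec, actE_pow_mulVec l hi, pow_succ, ← Matrix.mulVec_mulVec,
    Matrix.mulVec_smul, actE_mulVec_zero hN, smul_zero, Matrix.mulVec_zero]

/-- The matrix unit that sends the lowest weight vector `v_{N-1}` of `U_N(l)` to the highest weight
vector `v_0`. -/
def raise (N : ℕ) : Matrix (Fin N) (Fin N) ℂ :=
  Matrix.vecMulVec (basisVec N 0) (basisVec N (N - 1))

theorem basisVec_dotProduct {N i j : ℕ} (hi : i < N) :
    basisVec N i ⬝ᵥ basisVec N j = if i = j then 1 else 0 := by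
  rw [basisVec_eq_single ⟨i, hi⟩, single_one_dotProduct]
  rfl

theorem actE_pow_pred {N : ℕ} (hN : 2 ≤ N) (l : ℂ) :
    actE N l ^ (N - 1) = qFall N l (N - 1) • raise N := by
  refine matrix_ext_basisVec fun i hi => ?_
  rw [Matrix.smul_mulVec, raise, Matrix.vecMulVec_mulVec, basisVec_dotProduct (by omega)]
  rcases eq_or_ne (N - 1) i with h | h
  · rw [if_pos h, ← h, actE_pow_mulVec l (by omega)]
    simp
  · rw [actE_pow_mulVec_of_lt hN l hi (by omega), if_neg h]
    simp

/-- The identity of `U_N(l)` is spread out from the matrix unit `raise N` by the powers of `F`. -/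
theorem sum_actF_pow_raise {N : ℕ} (hN : 2 ≤ N) :
    ∑ i ∈ Finset.range N, actF N ^ i * raise N * actF N ^ (N - 1 - i) =
      qFall N (N - 1 : ℕ) (N - 1) • (1 : Matrix (Fin N) (Fin N) ℂ) := by
  have hF : ∀ d j : ℕ, qFall N j j • (actF N ^ d).mulVec (basisVec N j) =
      qFall N (j + d : ℕ) (j + d) • basisVec N (j + d) := by
    intro d j
    rw [← actF_pow_mulVec_zero, ← Matrix.mulVec_smul, ← actF_pow_mulVec_zero, Matrix.mulVec_mulVec,
      ← pow_add, add_comm]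
  refine matrix_ext_basisVec fun j hj => ?_
  refine smul_right_injective _ (qFall_self_ne_zero hN hj) ?_
  simp only
  rw [Matrix.sum_mulVec, Finset.smul_sum, Finset.sum_eq_single j]
  · rw [← Matrix.mulVec_mulVec, ← Matrix.mulVec_mulVec, ← Matrix.mulVec_smul, ← Matrix.mulVec_smul,
      hF, Nat.add_sub_cancel' (by omega : j ≤ N - 1), Matrix.mulVec_smul, Matrix.mulVec_smul, raise,
      Matrix.vecMulVec_mulVec, basisVec_dotProduct (by omega)]
    rw [if_pos rfl, MulOpposite.op_one, one_smul, actF_pow_mulVec_zero, Matrix.smul_mulVec,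
      Matrix.one_mulVec, smul_comm]
  · intro i hi hij
    rw [← Matrix.mulVec_mulVec, ← Matrix.mulVec_mulVec, ← Matrix.mulVec_smul, ← Matrix.mulVec_smul,
      hF, Matrix.mulVec_smul, raise, Matrix.vecMulVec_mulVec, basisVec_dotProduct (by omega),
      if_neg (by have := Finset.mem_range.1 hi; omega)]
    simp
  · intro h
    exact absurd (Finset.mem_range.2 hj) h

/-! ### Inserting and contracting the first tensor factor -/

section Slot

variable {N : ℕ} {ι : Type*} [DecidableEq ι]

/-- The map `W → U_N(l) ⊗ W`, `w ↦ v ⊗ w`. -/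
def tensorVec (ι : Type*) [DecidableEq ι] (v : Fin N → ℂ) : Matrix (Fin N × ι) ι ℂ :=
  Matrix.of fun p w => v p.1 * (1 : Matrix ι ι ℂ) p.2 w

/-- The map `U_N(l) ⊗ W → W`, `x ⊗ w ↦ f(x) w`, for a linear form `f` on `U_N(l)`. -/
def contractVec (ι : Type*) [DecidableEq ι] (f : Fin N → ℂ) : Matrix ι (Fin N × ι) ℂ :=
  Matrix.of fun w p => f p.1 * (1 : Matrix ι ι ℂ) w p.2

theorem tensorVec_smul (c : ℂ) (v : Fin N → ℂ) :
    tensorVec ι (c • v) = c • tensorVec ι v := by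
  ext p w
  simp [tensorVec, mul_assoc]

theorem contractVec_smul (c : ℂ) (f : Fin N → ℂ) :
    contractVec ι (c • f) = c • contractVec ι f := by
  ext p w
  simp [contractVec, mul_assoc]

theorem contractVec_zero : contractVec ι (0 : Fin N → ℂ) = 0 := by
  ext p w
  simp [contractVec]

variable [Fintype ι]

theorem kronecker_mul_tensorVec (M : Matrix (Fin N) (Fin N) ℂ) (X : Matrix ι ι ℂ)
    (v : Fin N → ℂ) : (M ⊗ₖ X) * tensorVec ι v = tensorVec ι (M.mulVec v) * X := by
  ext ⟨a, w⟩ w'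
  simp [Matrix.mul_apply, tensorVec, Fintype.sum_prod_type, Matrix.one_apply, Matrix.mulVec,
    dotProduct, Finset.sum_mul, mul_right_comm]

theorem contractVec_mul_kronecker (M : Matrix (Fin N) (Fin N) ℂ) (X : Matrix ι ι ℂ)
    (f : Fin N → ℂ) : contractVec ι f * (M ⊗ₖ X) = X * contractVec ι (Matrix.vecMul f M) := by
  ext w ⟨a, w'⟩
  simp [Matrix.mul_apply, contractVec, Fintype.sum_prod_type, Matrix.one_apply, Matrix.vecMul,
    dotProduct, Finset.mul_sum, mul_left_comm, mul_comm]

theorem contractVec_mul_tensorVec (f v : Fin N → ℂ) :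
    contractVec ι f * tensorVec ι v = (f ⬝ᵥ v) • (1 : Matrix ι ι ℂ) := by
  ext w w'
  simp [Matrix.mul_apply, contractVec, tensorVec, Fintype.sum_prod_type, Matrix.one_apply,
    dotProduct]

theorem contractVec_mul_mul_tensorVec (A : Matrix (Fin N × ι) (Fin N × ι) ℂ) (a b : Fin N) :
    contractVec ι (basisVec N a) * A * tensorVec ι (basisVec N b) =
      A.submatrix (Prod.mk a) (Prod.mk b) := by
  ext w w'
  simp [Matrix.mul_apply, contractVec, tensorVec, Fintype.sum_prod_type, Matrix.one_apply,
    basisVec_eq_single, Pi.single_apply, Finset.sum_ite_eq]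

theorem eq_zero_of_contractVec {p : Fin N × ι → ℂ}
    (h : ∀ i < N, (contractVec ι (basisVec N i)).mulVec p = 0) : p = 0 := by
  ext ⟨a, w⟩
  have := congrFun (h a a.2) w
  simpa [Matrix.mulVec, dotProduct, contractVec, basisVec_eq_single, Pi.single_apply,
    Fintype.sum_prod_type, Matrix.one_apply, Finset.sum_ite_eq] using this

/-! ### The action on `U_N(l) ⊗ W` -/

variable {E F K : Matrix ι ι ℂ}

/-- `E` on `U_N(l) ⊗ W`. -/
def tensE (N : ℕ) (l : ℂ) (E K : Matrix ι ι ℂ) : Matrix (Fin N × ι) (Fin N × ι) ℂ :=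
  1 ⊗ₖ E + actE N l ⊗ₖ K

/-- `F` on `U_N(l) ⊗ W`. -/
def tensF (N : ℕ) (l : ℂ) (F : Matrix ι ι ℂ) : Matrix (Fin N × ι) (Fin N × ι) ℂ :=
  actK N l (-1) ⊗ₖ F + actF N ⊗ₖ 1

theorem tensF_mul_tensorVec (l : ℂ) (i : ℕ) :
    tensF N l F * tensorVec ι (basisVec N i) =
      zetaPow N (2 * i - l) • (tensorVec ι (basisVec N i) * F) +
        qInt N (i + 1) • tensorVec ι (basisVec N (i + 1)) := by
  rw [tensF, Matrix.add_mul, kronecker_mul_tensorVec, kronecker_mul_tensorVec, actK_mulVec, actF_mulVec,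
    tensorVec_smul, tensorVec_smul, Matrix.mul_one, Matrix.smul_mul]
  congr 3
  push_cast
  ring

theorem contractVec_mul_tensF_zero (hN : 2 ≤ N) (l : ℂ) :
    contractVec ι (basisVec N 0) * tensF N l F =
      zetaPow N (-l) • (F * contractVec ι (basisVec N 0)) := by
  rw [tensF, Matrix.mul_add, contractVec_mul_kronecker, contractVec_mul_kronecker, vecMul_actK,
    vecMul_actF_zero hN, contractVec_smul, contractVec_zero, Matrix.mul_zero, add_zero, Matrix.mul_smul]
  congr 2
  push_cast
  ring

theorem contractVec_mul_tensF {i : ℕ} (hi : i + 1 < N) (l : ℂ) :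
    contractVec ι (basisVec N (i + 1)) * tensF N l F =
      zetaPow N (2 * (i + 1) - l) • (F * contractVec ι (basisVec N (i + 1))) +
        qInt N (i + 1) • contractVec ι (basisVec N i) := by
  rw [tensF, Matrix.mul_add, contractVec_mul_kronecker, contractVec_mul_kronecker, vecMul_actK,
    vecMul_actF hi, contractVec_smul, contractVec_smul, Matrix.one_mul, Matrix.mul_smul]
  congr 3
  push_cast
  ring

theorem contractVec_mul_tensE (l : ℂ) (i : ℕ) :
    contractVec ι (basisVec N i) * tensE N l E K =
      E * contractVec ι (basisVec N i) +
        qInt N (l - i) • (K * contractVec ι (basisVec N (i + 1))) := by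
  rw [tensE, Matrix.mul_add, contractVec_mul_kronecker, contractVec_mul_kronecker, Matrix.vecMul_one,
    vecMul_actE, contractVec_smul, Matrix.mul_smul]

/-- A vector of `U_N(l) ⊗ W` killed by `E` is determined by its component along `v_0`. -/
theorem eq_zero_of_tensE {l : ℂ} (hl : IsGeneric N l) {L : Matrix ι ι ℂ} (hLK : L * K = 1)
    {p : Fin N × ι → ℂ} (hE : (tensE N l E K).mulVec p = 0)
    (h0 : (contractVec ι (basisVec N 0)).mulVec p = 0) : p = 0 := by
  refine eq_zero_of_contractVec fun i _ => ?_
  induction i with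
  | zero => exact h0
  | succ i ih =>
    have h := congrArg (fun M => M.mulVec p) (contractVec_mul_tensE (N := N) (E := E) (K := K) l i)
    simp only [← Matrix.mulVec_mulVec, Matrix.add_mulVec, Matrix.smul_mulVec, hE,
      ih (by omega), Matrix.mulVec_zero, zero_add] at h
    have h2 := (smul_eq_zero.1 h.symm).resolve_left (by simpa using hl i)
    have h3 := congrArg L.mulVec h2
    rwa [Matrix.mulVec_mulVec, hLK, Matrix.one_mulVec, Matrix.mulVec_zero] at h3

theorem contractVec_mul_tensE_pow_of_lt (l : ℂ) {m i j : ℕ} (him : i + m < j) (hj : j < N) :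
    contractVec ι (basisVec N i) * tensE N l E K ^ m * tensorVec ι (basisVec N j) = 0 := by
  induction m generalizing i with
  | zero =>
    rw [pow_zero, Matrix.mul_one, contractVec_mul_tensorVec, basisVec_dotProduct (by omega),
      if_neg (by omega), zero_smul]
  | succ m ih =>
    rw [pow_succ', ← Matrix.mul_assoc, contractVec_mul_tensE, Matrix.add_mul, Matrix.add_mul,
      Matrix.mul_assoc, Matrix.mul_assoc, ← Matrix.mul_assoc (contractVec _ _), ih (by omega),
      Matrix.smul_mul, Matrix.smul_mul, Matrix.mul_assoc, Matrix.mul_assoc,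
      ← Matrix.mul_assoc (contractVec _ _), ih (by omega), Matrix.mul_zero, Matrix.mul_zero,
      smul_zero, add_zero]

theorem contractVec_mul_tensE_pow (l : ℂ) (m i : ℕ) (him : i + m < N) :
    contractVec ι (basisVec N i) * tensE N l E K ^ m * tensorVec ι (basisVec N (i + m)) =
      qFall N (l - i) m • K ^ m := by
  induction m generalizing i with
  | zero =>
    rw [pow_zero, Matrix.mul_one, contractVec_mul_tensorVec, basisVec_dotProduct (by omega)]
    simp [qFall]
  | succ m ih =>
    have h := ih (i + 1) (by omega)
    have hq : qFall N (l - i) (m + 1) = qInt N (l - i) * qFall N (l - (i + 1 : ℕ)) m := by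
      rw [qFall, Finset.prod_range_succ', mul_comm, qFall]
      congr 1
      · simp
      · refine Finset.prod_congr rfl fun j _ => ?_
        congr 1
        push_cast
        ring
    rw [pow_succ', ← Matrix.mul_assoc, contractVec_mul_tensE, Matrix.add_mul, Matrix.add_mul,
      Matrix.mul_assoc, Matrix.mul_assoc, ← Matrix.mul_assoc (contractVec _ _),
      contractVec_mul_tensE_pow_of_lt l (by omega) him,
      Matrix.smul_mul, Matrix.smul_mul, Matrix.mul_assoc, Matrix.mul_assoc,
      ← Matrix.mul_assoc (contractVec _ _), add_comm m 1, ← add_assoc, h, Matrix.mul_zero,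
      zero_add, Matrix.mul_smul, smul_smul, add_comm 1 m, hq, pow_succ']

/-- Up to the factor `[l; N-1]`, the map `w ↦ E^{N-1} (v_{N-1} ⊗ h w)` with `h = K^{1-N}` is inverse
to the restriction of `x ⊗ w ↦ v_0^*(x) w` to the highest weight vectors. -/
theorem tensE_pow_mulVec_of_highest {l : ℂ} (hN : 2 ≤ N) (hl : IsGeneric N l)
    (hE : (tensE N l E K) ^ N = (0 : Matrix (Fin N × ι) (Fin N × ι) ℂ))
    {L h : Matrix ι ι ℂ} (hLK : L * K = 1) (hKh : K ^ (N - 1) * h = 1)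
    {p : Fin N × ι → ℂ} (hp : (tensE N l E K).mulVec p = 0) :
    (tensE N l E K ^ (N - 1) * tensorVec ι (basisVec N (N - 1)) * h *
      contractVec ι (basisVec N 0)).mulVec p = qFall N l (N - 1) • p := by
  rw [← sub_eq_zero]
  refine eq_zero_of_tensE hl hLK (E := E) ?_ ?_
  · rw [Matrix.mulVec_sub, Matrix.mulVec_smul, hp, smul_zero, sub_zero, Matrix.mulVec_mulVec,
      ← Matrix.mul_assoc, ← Matrix.mul_assoc, ← Matrix.mul_assoc, ← pow_succ',
      Nat.sub_add_cancel (by omega), hE]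
    simp
  · have h1 := contractVec_mul_tensE_pow (N := N) (E := E) (K := K) l (N - 1) 0 (by omega)
    rw [zero_add] at h1
    rw [Matrix.mulVec_sub, Matrix.mulVec_smul, Matrix.mulVec_mulVec, ← Matrix.mul_assoc,
      ← Matrix.mul_assoc, ← Matrix.mul_assoc, h1, Matrix.smul_mul, hKh, Matrix.smul_mul,
      Matrix.one_mul, Matrix.smul_mulVec]
    simp

end Slot

/-! ### Cyclicity of the modified trace -/

/-- The geometric sum in `x` and `ζ^(a-2) y` factors into the operators `x - ζ^(a+2j) y`, which take
`v j` to a multiple of `v (j + 1)`. -/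
theorem geom_sum_apply_of_recurrence {N : ℕ} (hN : 2 ≤ N) {M : Type*} [AddCommGroup M]
    [Module ℂ M] {x y : Module.End ℂ M} (hxy : Commute x y) (a : ℂ) {v : ℕ → M} {q : ℕ → ℂ}
    (hv : ∀ j, x (v j) = zetaPow N (a + 2 * j) • y (v j) + q j • v (j + 1)) :
    ∑ i ∈ Finset.range N, (x ^ i * (zetaPow N (a - 2) • y) ^ (N - 1 - i)) (v 0) =
      (∏ j ∈ Finset.range (N - 1), q j) • v (N - 1) := by
  have hc : ∀ s ∈ ({x, y} : Set (Module.End ℂ M)), ∀ t ∈ ({x, y} : Set (Module.End ℂ M)),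
      s * t = t * s := by
    rintro s (rfl | rfl) t (rfl | rfl)
    exacts [rfl, hxy.eq, hxy.symm.eq, rfl]
  let _ : CommRing (Algebra.adjoin ℂ {x, y}) :=
    { (inferInstance : Ring (Algebra.adjoin ℂ {x, y})) with
      mul_comm := (Algebra.isMulCommutative_adjoin ℂ hc).is_comm.comm }
  let x' : Algebra.adjoin ℂ {x, y} := ⟨x, Algebra.subset_adjoin (by simp)⟩
  let y' : Algebra.adjoin ℂ {x, y} := ⟨y, Algebra.subset_adjoin (by simp)⟩
  have h := prod_sub_smul_eq_geom_sum hN a x' y'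
  have hk : ∀ k, ((∏ j ∈ Finset.range k, (x' - zetaPow N (a + 2 * j) • y') :
      Algebra.adjoin ℂ {x, y}) : Module.End ℂ M) (v 0) = (∏ j ∈ Finset.range k, q j) • v k := by
    intro k
    induction k with
    | zero => simp
    | succ k ih =>
      rw [Finset.prod_range_succ, mul_comm, Finset.prod_range_succ, mul_smul]
      change (x - zetaPow N (a + 2 * k) • y) (_) = _
      rw [ih, map_smul, LinearMap.sub_apply, LinearMap.smul_apply, hv, add_sub_cancel_left]
  rw [← hk, h, AddSubmonoidClass.coe_finsetSum, LinearMap.sum_apply]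
  rfl

section Cyclic

variable {N : ℕ} {ι : Type*} [Fintype ι] [DecidableEq ι] {E F K L h : Matrix ι ι ℂ}

/-- The case of `geom_sum_apply_of_recurrence` where `x` is composition with `F` of `U_N(l) ⊗ W`, `y`
is composition with `F` of `W`, and `v j` is the map `w ↦ v_j ⊗ w`. -/
theorem sum_tensF_pow_mul_tensorVec (hN : 2 ≤ N) (l : ℂ) :
    ∑ i ∈ Finset.range N, zetaPow N (-l - 2) ^ (N - 1 - i) •
        (tensF N l F ^ i * tensorVec ι (basisVec N 0) * F ^ (N - 1 - i)) =
      qFall N (N - 1 : ℕ) (N - 1) • tensorVec ι (basisVec N (N - 1)) := by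
  let x : Module.End ℂ (Matrix (Fin N × ι) ι ℂ) :=
    { toFun := fun X => tensF N l F * X
      map_add' := fun X Y => Matrix.mul_add _ _ _
      map_smul' := fun c X => Matrix.mul_smul _ _ _ }
  let y : Module.End ℂ (Matrix (Fin N × ι) ι ℂ) :=
    { toFun := fun X => X * F
      map_add' := fun X Y => Matrix.add_mul _ _ _
      map_smul' := fun c X => Matrix.smul_mul _ _ _ }
  have hxy : Commute x y := LinearMap.ext fun X => (Matrix.mul_assoc _ _ _).symm
  have hx : ∀ (k : ℕ) X, (x ^ k) X = tensF N l F ^ k * X := by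
    intro k X
    induction k with
    | zero => simp
    | succ k ih =>
      rw [pow_succ', Module.End.mul_apply, ih, pow_succ', Matrix.mul_assoc]
      rfl
  have hy : ∀ (k : ℕ) X, (y ^ k) X = X * F ^ k := by
    intro k X
    induction k with
    | zero => simp
    | succ k ih =>
      rw [pow_succ', Module.End.mul_apply, ih, pow_succ, ← Matrix.mul_assoc]
      rfl
  have hv : ∀ j : ℕ, x (tensorVec ι (basisVec N j)) =
      zetaPow N (-l + 2 * j) • y (tensorVec ι (basisVec N j)) +
        qInt N (j + 1) • tensorVec ι (basisVec N (j + 1)) := by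
    intro j
    rw [neg_add_eq_sub]
    exact tensF_mul_tensorVec l j
  have hf : ∀ k : ℕ, ∏ j ∈ Finset.range k, qInt N (j + 1) = qFall N k k := by
    intro k
    induction k with
    | zero => simp [qFall]
    | succ k ih => rw [Finset.prod_range_succ, ih, qFall_succ_self, mul_comm]
  have hg := geom_sum_apply_of_recurrence hN hxy (-l) hv
  rw [hf] at hg
  rw [← hg]
  refine Finset.sum_congr rfl fun i _ => ?_
  rw [Module.End.mul_apply, smul_pow, LinearMap.smul_apply, hx, hy, Matrix.mul_smul,
    Matrix.mul_assoc]

theorem pow_mul_comm_of_mul_comm {α β : Type*} [Fintype α] [Fintype β] [DecidableEq α]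
    [DecidableEq β] {A : Matrix α α ℂ} {B : Matrix β β ℂ} {X : Matrix α β ℂ}
    (hX : A * X = X * B) (k : ℕ) : A ^ k * X = X * B ^ k := by
  induction k with
  | zero => simp
  | succ k ih => rw [pow_succ, Matrix.mul_assoc, hX, ← Matrix.mul_assoc, ih, pow_succ,
      Matrix.mul_assoc]

theorem skew_commute_pow {A : Type*} [Ring A] [Algebra ℂ A] {x y : A} {c : ℂ}
    (h : x * y = c • (y * x)) (k : ℕ) : x * y ^ k = c ^ k • (y ^ k * x) := by
  induction k with
  | zero => simp
  | succ k ih =>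
    rw [pow_succ, ← mul_assoc, ih, smul_mul_assoc, mul_assoc, h, mul_smul_comm, smul_smul,
      mul_assoc, pow_succ]

theorem contractVec_mul_tensF_pow (hN : 2 ≤ N) (l : ℂ) (k : ℕ) :
    contractVec ι (basisVec N 0) * tensF N l F ^ k =
      zetaPow N (-l) ^ k • (F ^ k * contractVec ι (basisVec N 0)) := by
  induction k with
  | zero => simp
  | succ k ih =>
    rw [pow_succ, ← Matrix.mul_assoc, ih, Matrix.smul_mul, Matrix.mul_assoc,
      contractVec_mul_tensF_zero hN, Matrix.mul_smul, smul_smul, ← Matrix.mul_assoc, ← pow_succ,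
      ← pow_succ]

/-- Moving the lowering operators from the intermediate module `U_N(m)` around the twisted trace
turns the identity of `U_N(m)` into the matrix unit `raise N` and `v_0` into `v_{N-1}`. -/
theorem trace_contract_eq_trace_raise (hN : 2 ≤ N) (l : ℂ)
    (hF : h * F = zetaPow N (-2) • (F * h))
    {X : Matrix (Fin N × ι) (Fin N) ℂ} {Y : Matrix (Fin N) (Fin N × ι) ℂ}
    (hX : tensF N l F * X = X * actF N) (hY : Y * tensF N l F = actF N * Y) :
    (h * (contractVec ι (basisVec N 0) * (X * Y) * tensorVec ι (basisVec N 0))).trace =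
      (h * (contractVec ι (basisVec N 0) * (X * raise N * Y) *
        tensorVec ι (basisVec N (N - 1)))).trace := by
  refine mul_left_cancel₀ (qFall_self_ne_zero hN (by omega : N - 1 < N)) ?_
  have h1 : qFall N (N - 1 : ℕ) (N - 1) • (X * Y) =
      ∑ i ∈ Finset.range N, X * (actF N ^ i * raise N * actF N ^ (N - 1 - i)) * Y := by
    rw [← Matrix.sum_mul, ← Matrix.mul_sum, sum_actF_pow_raise hN, Matrix.mul_smul,
      Matrix.smul_mul, Matrix.mul_one]
  have h2 := sum_tensF_pow_mul_tensorVec (ι := ι) (F := F) hN l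
  have hs : ∀ (c : ℂ) (M : Matrix ι ι ℂ), c * M.trace = (c • M).trace :=
    fun c M => (Matrix.trace_smul c M).symm
  have e0 : qFall N (N - 1 : ℕ) (N - 1) •
      (h * (contractVec ι (basisVec N 0) * (X * Y) * tensorVec ι (basisVec N 0))) =
      h * (contractVec ι (basisVec N 0) * (qFall N (N - 1 : ℕ) (N - 1) • (X * Y)) *
        tensorVec ι (basisVec N 0)) := by
    simp only [Matrix.mul_smul, Matrix.smul_mul]
  rw [hs, hs, e0, h1, ← Matrix.mul_smul, ← Matrix.mul_smul, ← h2]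
  simp only [Matrix.mul_sum, Matrix.sum_mul, Matrix.trace_sum]
  rw [← Finset.sum_range_reflect]
  refine Finset.sum_congr rfl fun i hi => ?_
  have hi' : N - 1 - (N - 1 - i) = i := by have := Finset.mem_range.1 hi; omega
  rw [hi']
  generalize N - 1 - i = k
  have e1 : X * (actF N ^ k * raise N * actF N ^ i) * Y =
      tensF N l F ^ k * (X * raise N * Y) * tensF N l F ^ i := by
    simp only [← Matrix.mul_assoc]
    rw [← pow_mul_comm_of_mul_comm hX, Matrix.mul_assoc _ (actF N ^ i),
      pow_mul_comm_of_mul_comm hY.symm]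
    simp only [← Matrix.mul_assoc]
  have e2 : h * (contractVec ι (basisVec N 0) * (tensF N l F ^ k * (X * raise N * Y) *
        tensF N l F ^ i) * tensorVec ι (basisVec N 0)) =
      zetaPow N (-l - 2) ^ k • (F ^ k * (h * (contractVec ι (basisVec N 0) * (X * raise N * Y) *
        (tensF N l F ^ i * tensorVec ι (basisVec N 0))))) := by
    rw [← Matrix.mul_assoc (contractVec _ _), ← Matrix.mul_assoc (contractVec _ _),
      contractVec_mul_tensF_pow hN, sub_eq_add_neg, zetaPow_add, mul_pow, mul_smul]
    simp only [Matrix.smul_mul, Matrix.mul_smul, smul_smul, ← Matrix.mul_assoc]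
    rw [skew_commute_pow hF]
    simp only [Matrix.smul_mul, smul_smul]
  rw [e1, e2, Matrix.trace_smul, Matrix.trace_mul_comm]
  simp only [Matrix.mul_smul, Matrix.trace_smul, ← Matrix.mul_assoc]

/-- Cyclicity of the modified trace: exchanging the composition `X Y` of two intertwiners for `Y X`
changes the twisted trace by a factor that depends only on the modules in between. -/
theorem trace_contract_intertwiners (hN : 2 ≤ N) {l m : ℂ} (hl : IsGeneric N l)
    (hm : qFall N m (N - 1) ≠ 0)
    (hE : (tensE N l E K) ^ N = 0) (hLK : L * K = 1) (hKh : K ^ (N - 1) * h = 1)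
    (hF : h * F = zetaPow N (-2) • (F * h))
    {X : Matrix (Fin N × ι) (Fin N) ℂ} {Y : Matrix (Fin N) (Fin N × ι) ℂ}
    (hXE : tensE N l E K * X = X * actE N m) (hYE : Y * tensE N l E K = actE N m * Y)
    (hXF : tensF N l F * X = X * actF N) (hYF : Y * tensF N l F = actF N * Y) :
    (h * (contractVec ι (basisVec N 0) * (X * Y) * tensorVec ι (basisVec N 0))).trace =
      qFall N l (N - 1) / qFall N m (N - 1) *
        (basisVec N 0 ⬝ᵥ (Y * X).mulVec (basisVec N 0)) := by
  rw [trace_contract_eq_trace_raise hN l hF hXF hYF, div_mul_eq_mul_div, eq_div_iff hm, mul_comm,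
    ← smul_eq_mul, ← Matrix.trace_smul]
  -- `raise N = Z * raise N` keeps the projection to `v_0` on the side of `X`, while the remaining
  -- factor `raise N` becomes a power of `E` and moves through `Y`.
  let Z : Matrix (Fin N) (Fin N) ℂ := Matrix.vecMulVec (basisVec N 0) (basisVec N 0)
  have hZ : qFall N m (N - 1) • raise N = Z * actE N m ^ (N - 1) := by
    rw [actE_pow_pred hN, Matrix.mul_smul, raise, Matrix.vecMulVec_mul_vecMulVec,
      basisVec_dotProduct (by omega)]
    simp
  have e1 : qFall N m (N - 1) • (X * raise N * Y) = X * Z * Y * tensE N l E K ^ (N - 1) := by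
    rw [← Matrix.smul_mul, ← Matrix.mul_smul, hZ, ← Matrix.mul_assoc, Matrix.mul_assoc,
      pow_mul_comm_of_mul_comm hYE.symm, ← Matrix.mul_assoc]
  have hp : (tensE N l E K).mulVec (X.mulVec (basisVec N 0)) = 0 := by
    rw [Matrix.mulVec_mulVec, hXE, ← Matrix.mulVec_mulVec, actE_mulVec_zero hN, Matrix.mulVec_zero]
  have e2 := tensE_pow_mulVec_of_highest hN hl hE hLK hKh hp
  rw [← Matrix.mul_smul, ← Matrix.smul_mul, ← Matrix.mul_smul, e1]
  have e3 : h * (contractVec ι (basisVec N 0) * (X * Z * Y * tensE N l E K ^ (N - 1)) *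
      tensorVec ι (basisVec N (N - 1))) = (h * contractVec ι (basisVec N 0) * (X * Z * Y)) *
      (tensE N l E K ^ (N - 1) * tensorVec ι (basisVec N (N - 1))) := by
    simp only [← Matrix.mul_assoc]
  have e4 : X * Z = Matrix.vecMulVec (X.mulVec (basisVec N 0)) (basisVec N 0) :=
    Matrix.mul_vecMulVec _ _ _
  rw [e3, Matrix.trace_mul_comm, e4, ← Matrix.mul_assoc, ← Matrix.mul_assoc,
    Matrix.mul_vecMulVec, ← Matrix.mul_assoc, e2, Matrix.vecMulVec_mul, Matrix.trace_vecMulVec, smul_dotProduct,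
    ← Matrix.mulVec_mulVec, Matrix.dotProduct_mulVec, dotProduct_comm, smul_eq_mul]

end Cyclic

/-! ### The twisted partial trace is a scalar -/

section Scalar

variable {N : ℕ} {ι : Type*} [Fintype ι] [DecidableEq ι] {F K L h : Matrix ι ι ℂ}

/-- An entry of the partial trace over `W` of `(1 ⊗ h) A`. -/
def twistedTrace (h : Matrix ι ι ℂ) (A : Matrix (Fin N × ι) (Fin N × ι) ℂ) (i j : ℕ) : ℂ :=
  (h * (contractVec ι (basisVec N i) * A * tensorVec ι (basisVec N j))).trace

/-- The partial trace commutes with `K`, whose eigenvalues on `U_N(l)` are distinct. -/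
theorem twistedTrace_of_ne (hN : 2 ≤ N) (l : ℂ) {A : Matrix (Fin N × ι) (Fin N × ι) ℂ}
    (hKL : K * L = 1) (hKh : K * h = h * K) (hA : Commute (actK N l 1 ⊗ₖ K) A) {i j : ℕ}
    (hi : i < N) (hj : j < N) (hij : i ≠ j) : twistedTrace h A i j = 0 := by
  have hLK : L * K = 1 := mul_eq_one_comm.1 hKL
  have e := congrArg
    (fun M => contractVec ι (basisVec N i) * M * tensorVec ι (basisVec N j)) hA.eq
  beta_reduce at e
  rw [← Matrix.mul_assoc, ← Matrix.mul_assoc, contractVec_mul_kronecker, vecMul_actK,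
    contractVec_smul, Matrix.mul_assoc (_ * A), kronecker_mul_tensorVec, actK_mulVec,
    tensorVec_smul] at e
  simp only [Int.cast_one, one_mul, Matrix.smul_mul, Matrix.mul_smul] at e
  have e2 := congrArg (fun M => (h * L * M).trace) e
  have t1 : (h * L * (K * contractVec ι (basisVec N i) * A * tensorVec ι (basisVec N j))).trace =
      twistedTrace h A i j := by
    rw [twistedTrace, Matrix.mul_assoc K, Matrix.mul_assoc K, ← mul_assoc, mul_assoc h, hLK,
      mul_one]
  have t2 : (h * L * (contractVec ι (basisVec N i) * A * (tensorVec ι (basisVec N j) * K))).trace =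
      twistedTrace h A i j := by
    rw [twistedTrace, ← Matrix.mul_assoc (_ * A) _ K, ← mul_assoc, Matrix.trace_mul_comm, ← mul_assoc,
      ← mul_assoc, hKh, mul_assoc h, hKL, mul_one]
  simp only [mul_smul_comm, Matrix.trace_smul, t1, t2, smul_eq_mul] at e2
  by_contra hne
  exact hij ((zetaPow_sub_two_mul_eq_iff hN l hi hj).1 (mul_right_cancel₀ hne e2))

/-- The partial trace commutes with `F`: the twist `h` cancels the effect of moving `F` on `W` around
the trace. -/
theorem twistedTrace_succ (hN : 2 ≤ N) (l : ℂ) {A : Matrix (Fin N × ι) (Fin N × ι) ℂ}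
    (hF : h * F = zetaPow N (-2) • (F * h)) (hA : Commute (tensF N l F) A) {i : ℕ}
    (hi : i + 1 < N) : twistedTrace h A (i + 1) (i + 1) = twistedTrace h A i i := by
  have hq : qInt N ((i : ℂ) + 1) ≠ 0 := by exact_mod_cast qInt_ne_zero hN (Nat.succ_pos i) hi
  have e := congrArg
    (fun M => contractVec ι (basisVec N (i + 1)) * M * tensorVec ι (basisVec N i)) hA.eq
  beta_reduce at e
  rw [← Matrix.mul_assoc, ← Matrix.mul_assoc, contractVec_mul_tensF hi,
    Matrix.mul_assoc (_ * A), tensF_mul_tensorVec] at e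
  have e2 := congrArg (fun M => (h * M).trace) e
  have t1 : (h * (F * contractVec ι (basisVec N (i + 1)) * A * tensorVec ι (basisVec N i))).trace =
      zetaPow N (-2) *
        (h * (contractVec ι (basisVec N (i + 1)) * A * (tensorVec ι (basisVec N i) * F))).trace := by
    rw [Matrix.mul_assoc F, Matrix.mul_assoc F, ← mul_assoc, hF, smul_mul_assoc,
      Matrix.trace_smul, mul_assoc, Matrix.trace_mul_comm, ← Matrix.mul_assoc _ _ F, mul_assoc,
      smul_eq_mul]
  simp only [Matrix.add_mul, Matrix.mul_add, Matrix.smul_mul, Matrix.mul_smul, Matrix.trace_add,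
    Matrix.trace_smul, t1, smul_eq_mul] at e2
  have hz : zetaPow N (2 * (i + 1) - l) * zetaPow N (-2) = zetaPow N (2 * i - l) := by
    rw [← zetaPow_add]
    congr 1
    ring
  rw [← mul_assoc, hz] at e2
  exact (mul_left_cancel₀ hq (add_left_cancel e2)).symm

theorem twistedTrace_self (hN : 2 ≤ N) (l : ℂ) {A : Matrix (Fin N × ι) (Fin N × ι) ℂ}
    (hF : h * F = zetaPow N (-2) • (F * h)) (hA : Commute (tensF N l F) A) {i : ℕ}
    (hi : i < N) : twistedTrace h A i i = twistedTrace h A 0 0 := by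
  induction i with
  | zero => rfl
  | succ i ih => rw [twistedTrace_succ hN l hF hA hi, ih (by omega)]

end Scalar

/-! ### Highest weight vectors and intertwiners -/

section HighestWeight

variable {N : ℕ} {ι : Type*} [Fintype ι] [DecidableEq ι] {E F K L : Matrix ι ι ℂ}

/-- The linear map `U_N(m) → W` with `v_j ↦ F^j p / [j]!`. It is an intertwiner if `p` is a highest
weight vector of weight `m`. -/
def highestWeightMap (N : ℕ) (F : Matrix ι ι ℂ) (p : ι → ℂ) : Matrix ι (Fin N) ℂ :=
  Matrix.of fun e j => ((qFall N (j : ℕ) j)⁻¹ • (F ^ (j : ℕ)).mulVec p) e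

theorem highestWeightMap_mulVec (F : Matrix ι ι ℂ) (p : ι → ℂ) {j : ℕ} (hj : j < N) :
    (highestWeightMap N F p).mulVec (basisVec N j) = (qFall N j j)⁻¹ • (F ^ j).mulVec p := by
  rw [mulVec_basisVec _ ⟨j, hj⟩]
  rfl

theorem IsQuantumModule.F_mul_highestWeightMap (hN : 2 ≤ N) (h : IsQuantumModule N E F K L)
    (p : ι → ℂ) : F * highestWeightMap N F p = highestWeightMap N F p * actF N := by
  refine matrix_ext_basisVec fun j hj => ?_
  rw [← Matrix.mulVec_mulVec, ← Matrix.mulVec_mulVec, highestWeightMap_mulVec F p hj, actF_mulVec,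
    Matrix.mulVec_smul, Matrix.mulVec_smul, Matrix.mulVec_mulVec, ← pow_succ']
  rcases lt_or_ge (j + 1) N with h1 | h1
  · have hq : qInt N ((j : ℂ) + 1) ≠ 0 := by exact_mod_cast qInt_ne_zero hN (Nat.succ_pos j) h1
    rw [highestWeightMap_mulVec F p h1, qFall_succ_self, smul_smul, mul_inv, ← mul_assoc,
      mul_inv_cancel₀ hq, one_mul]
  · rw [basisVec_eq_zero h1, pow_eq_zero_of_le h1 h.F_pow]
    simp

theorem IsQuantumModule.K_mul_highestWeightMap (h : IsQuantumModule N E F K L) {m : ℂ}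
    {p : ι → ℂ} (hK : K.mulVec p = zetaPow N m • p) :
    K * highestWeightMap N F p = highestWeightMap N F p * actK N m 1 := by
  refine matrix_ext_basisVec fun j hj => ?_
  rw [← Matrix.mulVec_mulVec, ← Matrix.mulVec_mulVec, highestWeightMap_mulVec F p hj, actK_mulVec,
    Matrix.mulVec_smul, Matrix.mulVec_smul, Matrix.mulVec_mulVec, skew_commute_pow h.K_mul_F,
    Matrix.smul_mulVec, ← Matrix.mulVec_mulVec, hK, Matrix.mulVec_smul,
    highestWeightMap_mulVec F p hj, smul_smul (_ ^ _), ← zetaPow_nat_mul, ← zetaPow_add, smul_comm]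
  congr 2
  push_cast
  ring

theorem IsQuantumModule.E_mul_highestWeightMap (hN : 2 ≤ N) (h : IsQuantumModule N E F K L) {m : ℂ}
    {p : ι → ℂ} (hE : E.mulVec p = 0) (hK : K.mulVec p = zetaPow N m • p) :
    E * highestWeightMap N F p = highestWeightMap N F p * actE N m := by
  have hL : L.mulVec p = zetaPow N (-m) • p := by
    have h1 := congrArg L.mulVec hK
    rw [Matrix.mulVec_mulVec, h.L_mul_K, Matrix.one_mulVec, Matrix.mulVec_smul] at h1
    exact (smul_zetaPow_eq_iff m _ _).1 h1
  refine matrix_ext_basisVec fun j hj => ?_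
  rw [← Matrix.mulVec_mulVec, ← Matrix.mulVec_mulVec, highestWeightMap_mulVec F p hj]
  cases j with
  | zero => simp [Matrix.mulVec_smul, hE, actE_mulVec_zero hN]
  | succ j =>
    have hq : qInt N ((j : ℂ) + 1) ≠ 0 := by exact_mod_cast qInt_ne_zero hN (Nat.succ_pos j) hj
    have h1 := congrArg (fun M => M.mulVec p) (e_comm_fpow hN h.E_mul_F h.K_mul_F h.L_mul_F j)
    simp only [Matrix.sub_mulVec, ← Matrix.mulVec_mulVec, hE, Matrix.mulVec_zero, sub_zero,
      Matrix.smul_mulVec, hK, hL, smul_smul, ← zetaPow_add, ← sub_smul, Matrix.mulVec_smul] at h1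
    rw [actE_mulVec m hj, Matrix.mulVec_smul, Matrix.mulVec_smul,
      highestWeightMap_mulVec F p (by omega), h1, qFall_succ_self, smul_smul, smul_smul]
    congr 1
    have hz : zetaPow N (-j + m) - zetaPow N (j + -m) =
        (zetaPow N 1 - zetaPow N (-1)) * qInt N (m - j) := by
      rw [qInt, mul_div_cancel₀ _ (zeta_sub_ne_zero hN)]
      congr 2 <;> ring
    rw [hz]
    have := zeta_sub_ne_zero hN
    field_simp

end HighestWeight

/-! ### The decomposition of the tensor power -/

section Decomposition

variable {N n : ℕ} {l : ℂ}

theorem exists_intertwiner (hN : 2 ≤ N) (k : ℕ) {p : (Fin n → Fin N) → ℂ}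
    (hE : (totE N l n).mulVec p = 0)
    (hK : (totK N l n).mulVec p = zetaPow N (n * l - 2 * k) • p) :
    ∃ X : intertwiner N l n k, X.1.mulVec (basisVec N 0) = p := by
  have h := isQuantumModule_tot hN l n
  refine ⟨⟨highestWeightMap N (totF N l n) p, h.E_mul_highestWeightMap hN hE hK,
    h.F_mul_highestWeightMap hN p, h.K_mul_highestWeightMap hK⟩, ?_⟩
  simp [highestWeightMap_mulVec _ p (by omega : 0 < N), qFall]

theorem intertwiner_eq_zero (hN : 2 ≤ N) {k : ℕ} (X : intertwiner N l n k)
    (h : X.1.mulVec (basisVec N 0) = 0) : X = 0 := by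
  ext1
  refine matrix_ext_basisVec fun j hj => ?_
  have h1 := pow_mul_comm_of_mul_comm X.2.2.1 j
  have h2 := congrArg (fun M => M.mulVec (basisVec N 0)) h1
  simp only [← Matrix.mulVec_mulVec, h, Matrix.mulVec_zero, actF_pow_mulVec_zero,
    Matrix.mulVec_smul] at h2
  rw [(smul_eq_zero.1 h2.symm).resolve_left (qFall_self_ne_zero hN hj)]
  simp

theorem intertwiner_totE_pow {k : ℕ} (X : intertwiner N l n k) (i : ℕ) (v : Fin N → ℂ) :
    (totE N l n ^ i).mulVec (X.1.mulVec v) =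
      X.1.mulVec ((actE N (n * l - 2 * k) ^ i).mulVec v) := by
  rw [Matrix.mulVec_mulVec, Matrix.mulVec_mulVec, pow_mul_comm_of_mul_comm X.2.1]

theorem zetaPow_sub_two_mul_mod (hN : 2 ≤ N) (a : ℂ) (s : ℕ) :
    zetaPow N (a - 2 * (s % N : ℕ)) = zetaPow N (a - 2 * s) := by
  have hs : (s : ℂ) = (s % N : ℕ) + N * (s / N : ℕ) := by
    exact_mod_cast (Nat.mod_add_div s N).symm
  have h : zetaPow N (2 * N * (s / N : ℕ)) = 1 := by
    rw [mul_comm, zetaPow_nat_mul, zetaPow_two_mul_self hN, one_pow]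
  rw [← mul_one (zetaPow N (a - 2 * s)), ← h, ← zetaPow_add, hs]
  congr 1
  ring

/-- The projection onto the eigenspace of `K` for the eigenvalue `ζ^(nl - 2k)`. -/
def weightProj (N : ℕ) (l : ℂ) (n k : ℕ) : Matrix (Fin n → Fin N) (Fin n → Fin N) ℂ :=
  open Classical in
  Matrix.diagonal fun e =>
    if zetaPow N (n * l - 2 * ((∑ j, (e j : ℕ) : ℕ) : ℂ)) = zetaPow N (n * l - 2 * k) then 1 else 0

theorem totE_weightProj_mulVec (hN : 2 ≤ N) (k : ℕ) {p : (Fin n → Fin N) → ℂ}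
    (hE : (totE N l n).mulVec p = 0) :
    (totE N l n).mulVec ((weightProj N l n k).mulVec p) = 0 := by
  classical
  have h := (isQuantumModule_tot hN l n).K_mul_E
  rw [totK_eq_diagonal] at h
  obtain ⟨d, hd⟩ : ∃ d, totE N l n * weightProj N l n k = Matrix.diagonal d * totE N l n := by
    refine ⟨fun e => if zetaPow N (n * l - 2 * ((∑ j, (e j : ℕ) : ℕ) : ℂ)) =
      zetaPow N 2 * zetaPow N (n * l - 2 * k) then 1 else 0, ?_⟩
    ext e e'
    have he := congrFun (congrFun h e) e'
    rw [Matrix.diagonal_mul, Matrix.smul_apply, Matrix.mul_diagonal, smul_eq_mul] at he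
    rw [weightProj, Matrix.mul_diagonal, Matrix.diagonal_mul]
    by_cases h0 : totE N l n e e' = 0
    · simp [h0]
    · have h1 : zetaPow N (n * l - 2 * ((∑ j, (e j : ℕ) : ℕ) : ℂ)) =
          zetaPow N 2 * zetaPow N (n * l - 2 * ((∑ j, (e' j : ℕ) : ℕ) : ℂ)) :=
        mul_right_cancel₀ h0 (by rw [he]; ring)
      rw [h1, mul_comm]
      simp only [mul_right_inj' (zetaPow_ne_zero N 2)]
  rw [Matrix.mulVec_mulVec, hd, ← Matrix.mulVec_mulVec, hE, Matrix.mulVec_zero]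

theorem totK_weightProj_mulVec (k : ℕ) (p : (Fin n → Fin N) → ℂ) :
    (totK N l n).mulVec ((weightProj N l n k).mulVec p) =
      zetaPow N (n * l - 2 * k) • (weightProj N l n k).mulVec p := by
  ext e
  rw [totK_eq_diagonal, weightProj, Pi.smul_apply, Matrix.mulVec_diagonal, Matrix.mulVec_diagonal]
  split_ifs with h
  · rw [h, smul_eq_mul]
  · simp

theorem sum_weightProj (hN : 2 ≤ N) : ∑ k : Fin N, weightProj N l n k = 1 := by
  ext e e'
  rw [Matrix.sum_apply]
  by_cases h : e = e'
  · subst h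
    simp only [weightProj, Matrix.diagonal_apply_eq, Matrix.one_apply_eq]
    rw [Finset.sum_eq_single ⟨(∑ j, (e j : ℕ)) % N, Nat.mod_lt _ (by omega)⟩]
    · rw [if_pos (zetaPow_sub_two_mul_mod hN _ _).symm]
    · intro k _ hk
      rw [if_neg]
      rw [← zetaPow_sub_two_mul_mod hN, zetaPow_sub_two_mul_eq_iff hN _ (Nat.mod_lt _ (by omega)) k.2]
      exact fun h => hk (Fin.ext h.symm)
    · simp
  · simp [weightProj, h]

/-- The eigenvalues `ζ^(nl - 2k)` of `K` are distinct for `0 ≤ k < N`. -/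
theorem eq_zero_of_sum_weight (hN : 2 ≤ N) {p : Fin N → (Fin n → Fin N) → ℂ}
    (hp : ∀ k : Fin N, (totK N l n).mulVec (p k) = zetaPow N (n * l - 2 * k) • p k)
    (hs : ∑ k, p k = 0) (k : Fin N) : p k = 0 := by
  ext e
  have h1 : ∀ k : Fin N, p k e ≠ 0 →
      zetaPow N (n * l - 2 * ((∑ j, (e j : ℕ) : ℕ) : ℂ)) = zetaPow N (n * l - 2 * (k : ℕ)) := by
    intro k hk
    have := congrFun (hp k) e
    rw [totK_eq_diagonal, Matrix.mulVec_diagonal] at this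
    exact mul_right_cancel₀ hk this
  by_contra hk
  have h2 := congrFun hs e
  rw [Finset.sum_apply, Finset.sum_eq_single k] at h2
  · exact hk h2
  · intro j _ hj
    by_contra h3
    exact hj (Fin.ext ((zetaPow_sub_two_mul_eq_iff hN _ j.2 k.2).1 ((h1 j h3).symm.trans (h1 k hk))))
  · simp

theorem decompMap_apply_tmul (X : (k : Fin N) → intertwiner N l n k) (v : Fin N → Fin N → ℂ) :
    decompMap N l n (fun k => X k ⊗ₜ v k) = ∑ k, (X k).1.mulVec (v k) := by
  simp [decompMap, LinearMap.sum_apply]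

theorem decompMap_single_tmul (k : Fin N) (X : intertwiner N l n k) (v : Fin N → ℂ) :
    decompMap N l n (Pi.single k (X ⊗ₜ v)) = X.1.mulVec v := by
  rw [decompMap, LinearMap.sum_apply, Finset.sum_eq_single k]
  · simp
  · intro j _ hj
    simp [Pi.single_eq_of_ne hj]
  · simp

/-- The canonical map in terms of the components of its argument along `T_k ⊗ v_i`. -/
theorem decompMap_eq_sum (z : (k : Fin N) → TensorProduct ℂ (intertwiner N l n k) (Fin N → ℂ)) :
    decompMap N l n z = ∑ k : Fin N, ∑ i : Fin N,
      (TensorProduct.piScalarRight ℂ ℂ (intertwiner N l n k) (Fin N) (z k) i).1.mulVec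
        (basisVec N i) := by
  rw [decompMap, LinearMap.sum_apply]
  refine Finset.sum_congr rfl fun k _ => ?_
  rw [LinearMap.comp_apply, LinearMap.proj_apply]
  induction z k with
  | zero => simp
  | add x y hx hy => rw [map_add, hx, hy, ← Finset.sum_add_distrib]; simp [Matrix.add_mulVec]
  | tmul X v =>
    have hv : v = ∑ i : Fin N, v i • basisVec N i := by
      ext j
      simp [basisVec_eq_single, Pi.single_apply]
    conv_lhs => rw [hv]
    simp [Matrix.smul_mulVec]

theorem decompMap_injective (hN : 2 ≤ N)
    (hden : ∀ i < N, qFall N (n * l - 2 * i) (N - 1) ≠ 0) :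
    Function.Injective (decompMap N l n) := by
  rw [injective_iff_map_eq_zero]
  intro z hz
  rw [decompMap_eq_sum] at hz
  set x := fun (k i : Fin N) =>
    TensorProduct.piScalarRight ℂ ℂ (intertwiner N l n k) (Fin N) (z k) i with hx
  -- By descending induction on `i`: `E ^ i` kills the components along `v_j` for `j < i`.
  have key : ∀ d, ∀ i : Fin N, N ≤ i + d → ∀ k, x k i = 0 := by
    intro d
    induction d with
    | zero => intro i hi; omega
    | succ d ih =>
      intro i hi k
      have hi' : ∀ j : Fin N, i < j → ∀ k, x k j = 0 := fun j hj => ih j (by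
        rw [Fin.lt_def] at hj; omega)
      have h1 := congrArg (totE N l n ^ (i : ℕ)).mulVec hz
      rw [Matrix.mulVec_zero, Matrix.mulVec_sum] at h1
      have h2 : ∀ k : Fin N, (totE N l n ^ (i : ℕ)).mulVec
          (∑ j : Fin N, (x k j).1.mulVec (basisVec N j)) =
          qFall N (n * l - 2 * (k : ℕ)) i • (x k i).1.mulVec (basisVec N 0) := by
        intro k
        rw [Matrix.mulVec_sum, Finset.sum_eq_single i]
        · rw [intertwiner_totE_pow, actE_pow_mulVec _ i.2, Matrix.mulVec_smul]
        · intro j _ hj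
          rcases lt_or_gt_of_ne hj with h | h
          · rw [intertwiner_totE_pow, actE_pow_mulVec_of_lt hN _ j.2 h, Matrix.mulVec_zero]
          · rw [hi' j h k]
            simp
        · simp
      have h3 := eq_zero_of_sum_weight (l := l) hN
        (p := fun k : Fin N => qFall N (n * l - 2 * (k : ℕ)) i • (x k i).1.mulVec (basisVec N 0))
        (fun k => by
          rw [Matrix.mulVec_smul, Matrix.mulVec_mulVec, (x k i).2.2.2, ← Matrix.mulVec_mulVec,
            actK_mulVec, Matrix.mulVec_smul, smul_comm]
          simp)
        (by rw [← h1]; exact Finset.sum_congr rfl fun k _ => (h2 k).symm) k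
      exact intertwiner_eq_zero hN _ ((smul_eq_zero.1 h3).resolve_left
        (qFall_ne_zero_of_le (hden k k.2) (by omega)))
  ext1 k
  refine (TensorProduct.piScalarRight ℂ ℂ (intertwiner N l n k) (Fin N)).injective ?_
  rw [Pi.zero_apply, map_zero]
  ext1 i
  exact key N i (by omega) k

/-- If `E^(m+1) w = 0`, then `E^m w` is a sum of highest weight vectors, and the summands
`U_N(nl - 2k)` contain a vector with the same image under `E^m`; subtracting it lowers `m`. -/
theorem decompMap_surjective (hN : 2 ≤ N)
    (hden : ∀ i < N, qFall N (n * l - 2 * i) (N - 1) ≠ 0) :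
    Function.Surjective (decompMap N l n) := by
  have key : ∀ m ≤ N, ∀ w, (totE N l n ^ m).mulVec w = 0 →
      w ∈ LinearMap.range (decompMap N l n) := by
    intro m
    induction m with
    | zero =>
      intro _ w hw
      rw [pow_zero, Matrix.one_mulVec] at hw
      rw [hw]
      exact zero_mem _
    | succ m ih =>
      intro hm w hw
      have hp : (totE N l n).mulVec ((totE N l n ^ m).mulVec w) = 0 := by
        rwa [Matrix.mulVec_mulVec, ← pow_succ']
      choose X hX using fun k : Fin N => exists_intertwiner hN k
        (totE_weightProj_mulVec hN k hp) (totK_weightProj_mulVec k _)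
      let z : (k : Fin N) → TensorProduct ℂ (intertwiner N l n k) (Fin N → ℂ) := fun k =>
        X k ⊗ₜ ((qFall N (n * l - 2 * (k : ℕ)) m)⁻¹ • basisVec N m)
      have hz : (totE N l n ^ m).mulVec (decompMap N l n z) = (totE N l n ^ m).mulVec w := by
        rw [decompMap_apply_tmul, Matrix.mulVec_sum]
        have : ∀ k : Fin N, (totE N l n ^ m).mulVec ((X k).1.mulVec
            ((qFall N (n * l - 2 * (k : ℕ)) m)⁻¹ • basisVec N m)) =
            (weightProj N l n k).mulVec ((totE N l n ^ m).mulVec w) := by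
          intro k
          rw [intertwiner_totE_pow, Matrix.mulVec_smul, actE_pow_mulVec _ (by omega), smul_smul,
            inv_mul_cancel₀ (qFall_ne_zero_of_le (hden k k.2) (by omega)), one_smul, hX]
        rw [Finset.sum_congr rfl fun k _ => this k, ← Matrix.sum_mulVec, sum_weightProj hN,
          Matrix.one_mulVec]
      have h1 := ih (by omega) (w - decompMap N l n z) (by rw [Matrix.mulVec_sub, hz, sub_self])
      have h2 := add_mem h1 (LinearMap.mem_range_self (decompMap N l n) z)
      rwa [sub_add_cancel] at h2
  intro w
  exact key N le_rfl w (by rw [(isQuantumModule_tot hN l n).E_pow, Matrix.zero_mulVec])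

end Decomposition

/-! ### Coordinates with respect to the decomposition -/

section Coordinates

variable {N n : ℕ} {l : ℂ}

/-- The coordinate map `U_N(l)^{⊗n} → U_N(nl - 2k)` that belongs to the inverse `e` of the
decomposition and to the basis vector `b s` of the intertwiner space `T_k`. -/
def intertwinerCoord
    (e : ((k : Fin N) → intertwiner N l n k ⊗[ℂ] (Fin N → ℂ)) ≃ₗ[ℂ] ((Fin n → Fin N) → ℂ))
    (k : Fin N) {σ : Type*} (b : Module.Basis σ ℂ (intertwiner N l n k)) (s : σ) :
    Matrix (Fin N) (Fin n → Fin N) ℂ :=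
  LinearMap.toMatrix' ((TensorProduct.lid ℂ (Fin N → ℂ)).toLinearMap ∘ₗ
    LinearMap.rTensor (Fin N → ℂ) (b.coord s) ∘ₗ LinearMap.proj k ∘ₗ e.symm.toLinearMap)

variable {e : ((k : Fin N) → intertwiner N l n k ⊗[ℂ] (Fin N → ℂ)) ≃ₗ[ℂ] ((Fin n → Fin N) → ℂ)}

theorem intertwinerCoord_mulVec {k : Fin N} {σ : Type*}
    (b : Module.Basis σ ℂ (intertwiner N l n k)) (s : σ)
    (z : (k : Fin N) → intertwiner N l n k ⊗[ℂ] (Fin N → ℂ)) :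
    (intertwinerCoord e k b s).mulVec (e z) =
      TensorProduct.lid ℂ (Fin N → ℂ) (LinearMap.rTensor (Fin N → ℂ) (b.coord s) (z k)) := by
  rw [intertwinerCoord, LinearMap.toMatrix'_mulVec]
  simp

/-- The coordinate maps commute with every operator that acts on the summands `T_k ⊗ U_N(nl - 2k)`
through the second factor. -/
theorem intertwinerCoord_mul (he : ∀ z, e z = decompMap N l n z)
    {A : Matrix (Fin n → Fin N) (Fin n → Fin N) ℂ} {B : Fin N → Matrix (Fin N) (Fin N) ℂ}
    (hA : ∀ (k : Fin N) (X : intertwiner N l n k), A * X.1 = X.1 * B k) (k : Fin N)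
    {σ : Type*} (b : Module.Basis σ ℂ (intertwiner N l n k)) (s : σ) :
    intertwinerCoord e k b s * A = B k * intertwinerCoord e k b s := by
  have h1 : ∀ z, A.mulVec (e z) = e fun k => LinearMap.lTensor _ (B k).mulVecLin (z k) := by
    intro z
    rw [he, he, decompMap, LinearMap.sum_apply, LinearMap.sum_apply, Matrix.mulVec_sum]
    refine Finset.sum_congr rfl fun k _ => ?_
    rw [LinearMap.comp_apply, LinearMap.comp_apply, LinearMap.proj_apply, LinearMap.proj_apply]
    induction z k with
    | zero => simp
    | add x y hx hy => rw [map_add, Matrix.mulVec_add, hx, hy, map_add, map_add]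
    | tmul X v => simp [hA]
  refine Matrix.toLin'.injective (LinearMap.ext fun w => ?_)
  obtain ⟨z, rfl⟩ := e.surjective w
  rw [Matrix.toLin'_apply, Matrix.toLin'_apply, ← Matrix.mulVec_mulVec, ← Matrix.mulVec_mulVec, h1,
    intertwinerCoord_mulVec, intertwinerCoord_mulVec]
  induction z k with
  | zero => simp
  | add x y hx hy => simp only [map_add, hx, hy, Matrix.mulVec_add]
  | tmul X v => simp [Matrix.mulVec_smul]

/-- The intertwiners `b k s` and their coordinate maps resolve the identity. -/
theorem sum_mul_intertwinerCoord (he : ∀ z, e z = decompMap N l n z)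
    {σ : Fin N → Type*} [∀ k, Fintype (σ k)]
    (b : ∀ k : Fin N, Module.Basis (σ k) ℂ (intertwiner N l n k)) :
    ∑ k, ∑ s, (b k s).1 * intertwinerCoord e k (b k) s = 1 := by
  refine Matrix.toLin'.injective (LinearMap.ext fun w => ?_)
  obtain ⟨z, rfl⟩ := e.surjective w
  rw [Matrix.toLin'_apply, Matrix.toLin'_apply, Matrix.one_mulVec]
  conv_rhs => rw [he, decompMap, LinearMap.sum_apply]
  rw [Matrix.sum_mulVec]
  refine Finset.sum_congr rfl fun k _ => ?_
  rw [Matrix.sum_mulVec, LinearMap.comp_apply, LinearMap.proj_apply]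
  simp only [← Matrix.mulVec_mulVec, intertwinerCoord_mulVec]
  induction z k with
  | zero => simp
  | add x y hx hy => simp only [map_add, Matrix.mulVec_add, Finset.sum_add_distrib, hx, hy]
  | tmul X v =>
    have hX : X.1 = ∑ s, (b k).repr X s • (b k s).1 := by
      refine (congrArg (Submodule.subtype _) ((b k).sum_repr X)).symm.trans ?_
      rw [map_sum]
      rfl
    simp only [LinearMap.rTensor_tmul, Module.Basis.coord_apply, TensorProduct.lid_tmul,
      LinearMap.comp_apply, TensorProduct.lift.tmul, Submodule.subtype_apply,
      LinearEquiv.coe_coe, Matrix.toLin'_apply, Matrix.mulVec_smul]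
    rw [hX, Matrix.sum_mulVec]
    simp only [Matrix.smul_mulVec]

theorem intertwinerCoord_mul_intertwiner (he : ∀ z, e z = decompMap N l n z) {k : Fin N}
    {σ : Type*} (b : Module.Basis σ ℂ (intertwiner N l n k)) (s : σ) (X : intertwiner N l n k)
    (v : Fin N → ℂ) : (intertwinerCoord e k b s * X.1).mulVec v = b.repr X s • v := by
  rw [← Matrix.mulVec_mulVec, ← decompMap_single_tmul, ← he, intertwinerCoord_mulVec]
  simp

end Coordinates

/-! ### The partial trace -/

theorem tensorOp_const_pow {N m : ℕ} (M : Matrix (Fin N) (Fin N) ℂ) (k : ℕ) :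
    (tensorOp fun _ : Fin m => M) ^ k = tensorOp fun _ => M ^ k := by
  induction k with
  | zero => rw [pow_zero, ← tensorOp_one]; simp [Pi.one_def]
  | succ k ih => rw [pow_succ, ih, ← tensorOp_mul]; simp [Pi.mul_def, pow_succ]

theorem actK_pow (N : ℕ) (l : ℂ) (a : ℤ) (k : ℕ) : actK N l a ^ k = actK N l (k * a) := by
  induction k with
  | zero => simp [actK_zero]
  | succ k ih => rw [pow_succ, ih, actK_mul]; congr 1; push_cast; ring

theorem twistOp_submatrix {N : ℕ} (hN : 2 ≤ N) (l : ℂ) (m : ℕ) :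
    (twistOp N l (m + 1)).submatrix (consIndex N m) (consIndex N m) =
      1 ⊗ₖ ((tensorOp fun _ : Fin m => actK N l (-1)) ^ (N - 1)) := by
  rw [tensorOp_const_pow, actK_pow, Nat.cast_sub (by omega), twistOp, tensorOp_submatrix]
  simp

theorem partialTrace_apply {N m : ℕ}
    (A : Matrix (Fin (m + 1) → Fin N) (Fin (m + 1) → Fin N) ℂ) (a b : Fin N) :
    partialTrace A a b =
      ((A.submatrix (consIndex N m) (consIndex N m)).submatrix (Prod.mk a) (Prod.mk b)).trace := by
  rw [partialTrace, Matrix.of_apply, Finset.sum_filter, ← (consIndex N m).sum_comp,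
    Fintype.sum_prod_type, Finset.sum_eq_single b]
  · simp [Matrix.trace, Fin.consEquiv]
  · intro c _ hc
    simp [Fin.consEquiv, hc]
  · simp

theorem partialTrace_twistOp_mul {N : ℕ} (hN : 2 ≤ N) (l : ℂ) {m : ℕ}
    (A : Matrix (Fin (m + 1) → Fin N) (Fin (m + 1) → Fin N) ℂ) (a b : Fin N) :
    partialTrace (twistOp N l (m + 1) * A) a b =
      twistedTrace ((tensorOp fun _ : Fin m => actK N l (-1)) ^ (N - 1))
        (A.submatrix (consIndex N m) (consIndex N m)) a b := by
  rw [partialTrace_apply, ← contractVec_mul_mul_tensorVec,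
    ← Matrix.submatrix_mul_equiv _ _ _ (consIndex N m), twistOp_submatrix hN, twistedTrace,
    ← Matrix.mul_assoc, contractVec_mul_kronecker, Matrix.vecMul_one]
  simp only [Matrix.mul_assoc]

theorem IsQuantumModule.K_mul_L_pow {N k : ℕ} {ι : Type*} [Fintype ι] [DecidableEq ι]
    {E F K L : Matrix ι ι ℂ} (h : IsQuantumModule N E F K L) : K * L ^ k = L ^ k * K :=
  (Commute.pow_right (h.K_mul_L.trans h.L_mul_K.symm : Commute K L) k).eq

/-- Conjugation by `h = K^{1-N}` multiplies `F` by `ζ^(2N - 2) = ζ^(-2)`. -/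
theorem IsQuantumModule.L_pow_mul_F {N : ℕ} (hN : 2 ≤ N) {ι : Type*} [Fintype ι] [DecidableEq ι]
    {E F K L : Matrix ι ι ℂ} (h : IsQuantumModule N E F K L) :
    L ^ (N - 1) * F = zetaPow N (-2) • (F * L ^ (N - 1)) := by
  have h1 : F * L = zetaPow N (-2) • (L * F) := (smul_zetaPow_eq_iff 2 _ _).1 h.L_mul_F
  have h2 := skew_commute_pow h1 (N - 1)
  rw [← zetaPow_nat_mul] at h2
  rw [h2, smul_smul, ← zetaPow_add, Nat.cast_sub (by omega), Nat.cast_one,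
    show (-2 : ℂ) + ((N : ℂ) - 1) * -2 = -(2 * N) by ring]
  have h3 : zetaPow N (-(2 * N)) = 1 := by
    rw [← mul_one (zetaPow N (-(2 * N))), ← zetaPow_two_mul_self hN, ← zetaPow_add,
      neg_add_cancel, zetaPow_zero, zetaPow_two_mul_self hN]
  rw [h3, one_smul]

/-- The first entry of the twisted partial trace of `φ(β)` is a sum over the summands of the
decomposition of the tensor power. -/
theorem twistedTrace_braidRep {N m : ℕ} (hN : 2 ≤ N) {l : ℂ} (hl : IsGeneric N l)
    (hden : ∀ i < N, qFall N ((m + 1 : ℕ) * l - 2 * i) (N - 1) ≠ 0)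
    (hbij : Function.Bijective (decompMap N l (m + 1))) (β : BraidGroup (m + 1)) :
    twistedTrace ((tensorOp fun _ : Fin m => actK N l (-1)) ^ (N - 1))
        ((braidRep hN l (m + 1) β).1.submatrix (consIndex N m) (consIndex N m)) 0 0 =
      ∑ i ∈ Finset.range N, qFall N l (N - 1) / qFall N ((m + 1 : ℕ) * l - 2 * i) (N - 1) *
        LinearMap.trace ℂ _ (intertwinerRep hN l (m + 1) i β) := by
  have h := isQuantumModule_tot hN l m
  have hE := ((isQuantumModule_act hN l).kronecker hN h).E_pow
  have hKh : totK N l m ^ (N - 1) * (tensorOp fun _ => actK N l (-1)) ^ (N - 1) = 1 := by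
    rw [← Commute.mul_pow (h.K_mul_L.trans h.L_mul_K.symm), h.K_mul_L, one_pow]
  let e := LinearEquiv.ofBijective (decompMap N l (m + 1)) hbij
  have he : ∀ z, e z = decompMap N l (m + 1) z := fun z => rfl
  have hfree : ∀ k, Module.Free ℂ (intertwiner N l (m + 1) k) := fun k =>
    Module.Free.of_divisionRing ℂ _
  have hfin : ∀ k, FiniteDimensional ℂ (intertwiner N l (m + 1) k) := fun k =>
    FiniteDimensional.finiteDimensional_submodule _
  let b := fun k : Fin N => Module.finBasis ℂ (intertwiner N l (m + 1) k)
  let A := (braidRep hN l (m + 1) β).1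
  let X := fun (k : Fin N) s => (intertwinerRep hN l (m + 1) k β (b k s))
  let Y := fun (k : Fin N) s => intertwinerCoord e k (b k) s
  have hA : A.submatrix (consIndex N m) (consIndex N m) =
      ∑ k, ∑ s, (X k s).1.submatrix (consIndex N m) id * (Y k s).submatrix id (consIndex N m) := by
    have h1 : A = ∑ k, ∑ s, (X k s).1 * Y k s := by
      have h2 := congrArg (fun M => A * M) (sum_mul_intertwinerCoord he b)
      simp only [mul_one, Matrix.mul_sum, ← Matrix.mul_assoc] at h2
      exact h2.symm
    conv_lhs => rw [h1]
    simp only [submatrix_finset_sum]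
    rfl
  have hXY : ∀ (k : Fin N) s, ((tensorOp fun _ : Fin m => actK N l (-1)) ^ (N - 1) *
      (contractVec (Fin m → Fin N) (basisVec N 0) * ((X k s).1.submatrix (consIndex N m) id *
        (Y k s).submatrix id (consIndex N m)) * tensorVec (Fin m → Fin N) (basisVec N 0))).trace =
      qFall N l (N - 1) / qFall N ((m + 1 : ℕ) * l - 2 * (k : ℕ)) (N - 1) *
        (b k).repr (X k s) s := by
    intro k s
    have hYE := intertwinerCoord_mul he (fun k X => X.2.1) k (b k) s
    have hYF := intertwinerCoord_mul he (fun k X => X.2.2.1) k (b k) s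
    have hr : ∀ {B : Matrix (Fin (m + 1) → Fin N) (Fin (m + 1) → Fin N) ℂ}
        {C : Matrix (Fin N) (Fin N) ℂ} {Z : Matrix (Fin (m + 1) → Fin N) (Fin N) ℂ},
        B * Z = Z * C → B.submatrix (consIndex N m) (consIndex N m) *
          Z.submatrix (consIndex N m) id = Z.submatrix (consIndex N m) id * C := by
      intro B C Z hZ
      rw [Matrix.submatrix_mul_equiv, hZ]
      rfl
    have hs : ∀ {B : Matrix (Fin (m + 1) → Fin N) (Fin (m + 1) → Fin N) ℂ}
        {C : Matrix (Fin N) (Fin N) ℂ} {Z : Matrix (Fin N) (Fin (m + 1) → Fin N) ℂ},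
        Z * B = C * Z → Z.submatrix id (consIndex N m) *
          B.submatrix (consIndex N m) (consIndex N m) = C * Z.submatrix id (consIndex N m) := by
      intro B C Z hZ
      rw [Matrix.submatrix_mul_equiv, hZ]
      rfl
    rw [trace_contract_intertwiners hN hl (hden k k.2) hE h.L_mul_K hKh (h.L_pow_mul_F hN)
      (by rw [tensE, ← totE_submatrix]; exact hr (X k s).2.1)
      (by rw [tensE, ← totE_submatrix]; exact hs hYE)
      (by rw [tensF, ← totF_submatrix]; exact hr (X k s).2.2.1)
      (by rw [tensF, ← totF_submatrix]; exact hs hYF),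
      Matrix.submatrix_mul_equiv, Matrix.submatrix_id_id,
      intertwinerCoord_mul_intertwiner he, dotProduct_smul, basisVec_dotProduct (by omega)]
    simp
  change twistedTrace _ (A.submatrix (consIndex N m) (consIndex N m)) 0 0 = _
  rw [hA, twistedTrace]
  simp only [Matrix.mul_sum, Matrix.sum_mul, Matrix.trace_sum, hXY]
  rw [Finset.sum_range]
  refine Finset.sum_congr rfl fun k _ => ?_
  rw [← Finset.mul_sum, LinearMap.trace_eq_matrix_trace ℂ (b k), Matrix.trace]
  simp [LinearMap.toMatrix_apply, X]

end
end ColoredAlexander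

open ColoredAlexander in
theorem proposition4p2 (N n : ℕ) (hN : 2 ≤ N) [NeZero n] (l : ℂ)
    (hl : ColoredAlexander.IsGeneric N l)
    (hden : ∀ i < N, ColoredAlexander.qFall N (n * l - 2 * i) (N - 1) ≠ 0) :
    Function.Bijective (ColoredAlexander.decompMap N l n) ∧
    ∀ β : ColoredAlexander.BraidGroup n,
      ColoredAlexander.partialTrace (ColoredAlexander.twistOp N l n *
        (ColoredAlexander.braidRep hN l n β : Matrix (Fin n → Fin N) (Fin n → Fin N) ℂ)) =
      (∑ i ∈ Finset.range N,
        ColoredAlexander.qFall N l (N - 1) / ColoredAlexander.qFall N (n * l - 2 * i) (N - 1) *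
          LinearMap.trace ℂ _ (ColoredAlexander.intertwinerRep hN l n i β)) •
        (1 : Matrix (Fin N) (Fin N) ℂ) := by
  obtain ⟨m, rfl⟩ : ∃ m, n = m + 1 := ⟨n - 1, by have := NeZero.pos n; omega⟩
  have hbij : Function.Bijective (decompMap N l (m + 1)) :=
    ⟨decompMap_injective hN hden, decompMap_surjective hN hden⟩
  refine ⟨hbij, fun β => ?_⟩
  have h := isQuantumModule_tot hN l m
  have hA : ∀ {X : Matrix (Fin (m + 1) → Fin N) (Fin (m + 1) → Fin N) ℂ},
      (∀ i, Commute X (braidGen N l (m + 1) i)) →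
      Commute (X.submatrix (consIndex N m) (consIndex N m))
        ((braidRep hN l (m + 1) β).1.submatrix (consIndex N m) (consIndex N m)) := by
    intro X hX
    rw [Commute, SemiconjBy, Matrix.submatrix_mul_equiv, Matrix.submatrix_mul_equiv,
      (braidRep_commute hN l (m + 1) hX β).eq]
  have hF := h.L_pow_mul_F hN
  ext a c
  rw [partialTrace_twistOp_mul hN, Matrix.smul_apply, Matrix.one_apply]
  split_ifs with hac
  · rw [hac, twistedTrace_self hN l hF
      (by rw [tensF, ← totF_submatrix]; exact hA fun i => totF_commute hN l rfl) c.2,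
      twistedTrace_braidRep hN hl hden hbij, smul_eq_mul, mul_one]
  · rw [twistedTrace_of_ne hN l h.K_mul_L h.K_mul_L_pow
      (by rw [← totK_submatrix]; exact hA fun i => totK_commute l (by simp [Fin.ext_iff]))
      a.2 c.2 (fun h => hac (Fin.ext h)), smul_zero]
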